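/- Let $\mathbb F$ be a finite field. **Conventions.** Algorithms are uniform probabilistic algorithms (programs with a step count that agrees with probabilistic Turing machines up to a polynomial; they may draw uniform elements of $\{0,\dots,m-1\}$ at cost linear in $m$). Circuits are arithmetic circuits over $\mathbb F$ with constant, addition and multiplication gates of fan-in at most $2$; the size (application time) of a circuit is its number of inputs, gates and outputs. For an algorithm $A$ and distributions $D,U$ put $\mathrm{Adv}_A(D,U)=|\Pr[A(D)=1]-\Pr[A(U)=1]|$. **Trapdoored matrices.** A family of trapdoored $n\times n$ matrices is a sequence $(\mathcal D_n)_n$ of distributions of pairs $(M,C)$, where $M\in\mathbb F^{n\times n}$ and $C$ is a circuit with $C(v)=Mv$ for every $v\in\mathbb F^n$ (for every pair in the support), that can be sampled exactly by an algorithm on input $1^n$ in time $\mathrm{poly}(n)$. It is *indistinguishable from uniform* if for every polynomial-time $A$ the advantage $\mathrm{Adv}_A(M,U_n)$, with $(M,C)\leftarrow\mathcal D_n$ and $U_n$ uniform on $\mathbb F^{n\times n}$, is smaller than every inverse polynomial in $n$ for all large $n$. It has *multiplication time $T(n)$* if for all large $n$ every circuit in the support of $\mathcal D_n$ has size at most $T(n)$.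 **Codes.** A near-linear-time encodable code family $\mathcal K$ with dimension function $k=k(n)$ is a sequence of distributions of pairs $(G,E)$, sampled by a $\mathrm{poly}(n)$-time algorithm on input $1^n$, where $G\in\mathbb F^{n\times k(n)}$ has full column rank (a generator matrix of a code of length $n$ and dimension $k(n)$) and $E$ is a circuit computing $v\mapsto Gv$, of size at most $(n+k)(\log n)^{O(1)}$ for all large $n$. (One fixed, public $G$ for each $n$ is the special case of a distribution concentrated on one $G$.) Assume throughout that the rate is bounded away from one: $k(n)\le\rho n$ for some constant $\rho<1$ and all large $n$. **McEliece assumption.** Let $P$ be a uniformly random $n\times n$ permutation matrix, $G$ drawn from $\mathcal K$, and $S$ a random $k\times k$ matrix, independently, where $S$ is either (a) uniform on $\mathbb F^{k\times k}$ or (b) uniform on $\mathrm{GL}_k(\mathbb F)$. Let $U$ be uniform on $\mathbb F^{n\times k}$, $k=k(n)$. The *polynomial* McEliece assumption for $\mathcal K$ says that for every $A$ running in time $\mathrm{poly}(k)$ and every $d$, $\mathrm{Adv}_A(PGS,U)\le k^{-d}$ for all large $n$. The *subexponential* McEliece assumption says that there is a constant $0<\alpha<1$ such that for every $A$ running in time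 $2^{k^\alpha}$ for all large $n$, $\mathrm{Adv}_A(PGS,U)\le 2^{-k^\alpha}$ for all large $n$. **Theorem.** For each of the two versions (a), (b) of the McEliece assumption: 1. Let $\varepsilon>0$ and $0\le\delta<\min(\varepsilon,1)$, and let $\mathcal K$ be a near-linear-time encodable code family with $n=O(k(n)\,n^{\delta})$ (for instance of constant rate, with $\delta=0$) that satisfies the polynomial McEliece assumption. Then there is a family of trapdoored $n\times n$ matrices over $\mathbb F$ that is indistinguishable from uniform and has multiplication time $n^{1+\varepsilon}$. 2. Let $\mathcal K$ be a near-linear-time encodable code family with $n\le k(n)(\log n)^{O(1)}$ for all large $n$ that satisfies the subexponential McEliece assumption. Then there is a family of trapdoored $n\times n$ matrices over $\mathbb F$ that is indistinguishable from uniform and has multiplication time $n(\log n)^{O(1)}$. -/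

import Mathlib

open Filter

namespace Trapdoor

/-! ## Data and a probabilistic programming language with step count -/

/-- Binary trees (S-expressions), the data on which programs operate. -/
inductive Data : Type
  | nil : Data
  | cons : Data → Data → Data

namespace Data

/-- Number of nodes of a tree. -/
def size : Data → ℕ
  | nil => 1
  | cons a b => a.size + b.size + 1

def fst : Data → Data
  | nil => nil
  | cons a _ => a

def snd : Data → Data
  | nil => nil
  | cons _ b => b

/-- Length of a tree read as a list `cons a₁ (cons a₂ ⋯ nil)`. -/
def length : Data → ℕ
  | nil => 0
  | cons _ b => b.length + 1

/-- A natural number in unary: a list of `n` copies of `nil`. -/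
def ofNat : ℕ → Data
  | 0 => nil
  | n + 1 => cons nil (ofNat n)

def ofList : List Data → Data
  | [] => nil
  | a :: l => cons a (ofList l)

end Data

/-- Programs: a WHILE language on trees.  A program transforms one tree into another. -/
inductive Prog : Type
  /-- return the input -/
  | id : Prog
  /-- return the tree `nil` -/
  | nil : Prog
  /-- return the left subtree -/
  | fst : Prog
  /-- return the right subtree -/
  | snd : Prog
  /-- on input `x`, return the tree with subtrees `f x` and `g x` -/
  | pair : Prog → Prog → Prog
  /-- `comp g f`: first `f`, then `g` -/
  | comp : Prog → Prog → Prog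
  /-- on input `x`, run the first program if the left subtree of `x` is not `nil`, else the
  second one -/
  | ite : Prog → Prog → Prog
  /-- while the left subtree of the current tree is not `nil`, apply the program to the tree -/
  | loop : Prog → Prog
  /-- on a list of length `m ≥ 1`, return a uniformly random element of `{0, …, m - 1}` in unary -/
  | rand : Prog

/-- The output distribution of the instruction `rand`. -/
noncomputable def randDist : Data → PMF Data
  | Data.nil => PMF.pure Data.nil
  | Data.cons _ b => (PMF.uniformOfFintype (Fin (b.length + 1))).map fun i => Data.ofNat i

/-- `Runs p x μ t`: on input `x`, for all outcomes of its random choices, the program `p` halts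
within `t` steps, and its output has the distribution `μ`.  An elementary instruction is charged
the size of the tree it handles (so an output is never larger than the time spent on it, and
running times agree with those of probabilistic Turing machines up to a polynomial). -/
inductive Runs : Prog → Data → PMF Data → ℕ → Prop
  | id (x : Data) : Runs Prog.id x (PMF.pure x) x.size
  | nil (x : Data) : Runs Prog.nil x (PMF.pure Data.nil) 1
  | fst (x : Data) : Runs Prog.fst x (PMF.pure x.fst) x.size
  | snd (x : Data) : Runs Prog.snd x (PMF.pure x.snd) x.size
  | rand (x : Data) : Runs Prog.rand x (randDist x) x.size
  | pair {f g : Prog} {x : Data} {μ ν : PMF Data} {s t : ℕ} :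
      Runs f x μ s → Runs g x ν t →
      Runs (Prog.pair f g) x (μ.bind fun a => ν.map fun b => Data.cons a b) (s + t + 1)
  | comp {g f : Prog} {x : Data} {μ : PMF Data} {κ : Data → PMF Data} {s t : ℕ} :
      Runs f x μ s → (∀ y ∈ μ.support, Runs g y (κ y) t) →
      Runs (Prog.comp g f) x (μ.bind κ) (s + t + 1)
  | ite_then {f g : Prog} {x : Data} {μ : PMF Data} {t : ℕ} :
      x.fst ≠ Data.nil → Runs f x μ t → Runs (Prog.ite f g) x μ (t + 1)
  | ite_else {f g : Prog} {x : Data} {μ : PMF Data} {t : ℕ} :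
      x.fst = Data.nil → Runs g x μ t → Runs (Prog.ite f g) x μ (t + 1)
  | loop_stop {f : Prog} {x : Data} :
      x.fst = Data.nil → Runs (Prog.loop f) x (PMF.pure x) x.size
  | loop_step {f : Prog} {x : Data} {μ : PMF Data} {κ : Data → PMF Data} {s t : ℕ} :
      x.fst ≠ Data.nil → Runs f x μ s → (∀ y ∈ μ.support, Runs (Prog.loop f) y (κ y) t) →
      Runs (Prog.loop f) x (μ.bind κ) (s + t + 1)
  | weaken {p : Prog} {x : Data} {μ : PMF Data} {s t : ℕ} :
      Runs p x μ s → s ≤ t → Runs p x μ t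

/-! ## Circuits -/

/-- Gates of an arithmetic circuit; `add i j` and `mul i j` read the wires `i` and `j`. -/
inductive Gate (F : Type*)
  | const : F → Gate F
  | add : ℕ → ℕ → Gate F
  | mul : ℕ → ℕ → Gate F

/-- Value of a gate, given the values of the preceding wires (a wire that is not there reads 0). -/
def Gate.eval {F : Type*} [Field F] (w : List F) : Gate F → F
  | Gate.const a => a
  | Gate.add i j => w.getD i 0 + w.getD j 0
  | Gate.mul i j => w.getD i 0 * w.getD j 0

/-- An arithmetic circuit with `m` inputs and `n` outputs.  Wires `0, …, m - 1` are the inputs,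
wire `m + i` is the output of the `i`-th gate. -/
structure Circuit (F : Type*) (m n : ℕ) where
  gates : List (Gate F)
  outputs : Fin n → ℕ

namespace Circuit

variable {F : Type*} {m n : ℕ}

/-- The function computed by a circuit: the gates are evaluated one after the other. -/
def eval [Field F] (C : Circuit F m n) (v : Fin m → F) : Fin n → F := fun i =>
  (C.gates.foldl (fun w g => w ++ [g.eval w]) (List.ofFn v)).getD (C.outputs i) 0

/-- Number of inputs, gates and outputs: the number of steps in which the circuit is applied. -/
def size (C : Circuit F m n) : ℕ := m + C.gates.length + n

end Circuit

/-! ## Encodings -/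

section Encodings

variable {F : Type*} [Finite F]

/-- A fixed enumeration of the finite field, in unary.  (All enumerations are equivalent, as a
program can translate between them by a finite table.) -/
noncomputable def encElem (a : F) : Data := Data.ofNat (Finite.equivFin F a)

/-- A matrix as the list of its rows. -/
noncomputable def encMatrix {n m : ℕ} (M : Matrix (Fin n) (Fin m) F) : Data :=
  Data.ofList (List.ofFn fun i => Data.ofList (List.ofFn fun j => encElem (M i j)))

noncomputable def encGate : Gate F → Data
  | Gate.const a => Data.cons (Data.ofNat 0) (encElem a)
  | Gate.add i j => Data.cons (Data.ofNat 1) (Data.cons (Data.ofNat i) (Data.ofNat j))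
  | Gate.mul i j => Data.cons (Data.ofNat 2) (Data.cons (Data.ofNat i) (Data.ofNat j))

noncomputable def encCircuit {m n : ℕ} (C : Circuit F m n) : Data :=
  Data.cons (Data.ofList (C.gates.map encGate))
    (Data.ofList (List.ofFn fun i => Data.ofNat (C.outputs i)))

end Encodings

/-! ## Computational indistinguishability of random matrices -/

/-- The uniform distribution on a finite nonempty type. -/
noncomputable def uniform (α : Type*) [Finite α] [Nonempty α] : PMF α :=
  letI := Fintype.ofFinite α
  PMF.uniformOfFintype α

/-- Distinguishing advantage `|Pr_{x ← D}[A(x) = 1] - Pr_{x ← U}[A(x) = 1]|` of an algorithm `A`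
whose output on `x` has the distribution `out x`. -/
noncomputable def advantage {α : Type*} (D U : PMF α) (out : α → PMF Data) : ℝ :=
  |((D.bind out) (Data.ofNat 1)).toReal - ((U.bind out) (Data.ofNat 1)).toReal|

section Indistinguishability

variable {F : Type*} [Finite F] {r c : ℕ → ℕ}

/-- For all large `n`, the program `A` halts in time `T n` on every `r n × c n` matrix `M`, with an
output of distribution `out n M`. -/
def RunsInTime (A : Prog) (out : ∀ n, Matrix (Fin (r n)) (Fin (c n)) F → PMF Data)
    (T : ℕ → ℝ) : Prop :=
  ∀ᶠ n in atTop, ∀ M : Matrix (Fin (r n)) (Fin (c n)) F,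
    ∃ t : ℕ, (t : ℝ) ≤ T n ∧ Runs A (encMatrix M) (out n M) t

/-- Every probabilistic algorithm running in time polynomial in the security parameter `sec n`
has negligible advantage: below any inverse polynomial in `sec n`. -/
def PolyIndist (sec : ℕ → ℕ) (D U : ∀ n, PMF (Matrix (Fin (r n)) (Fin (c n)) F)) : Prop :=
  ∀ (A : Prog) (out : ∀ n, Matrix (Fin (r n)) (Fin (c n)) F → PMF Data) (a : ℕ),
    RunsInTime A out (fun n => (sec n : ℝ) ^ a + a) →
    ∀ d : ℕ, ∀ᶠ n in atTop, advantage (D n) (U n) (out n) * (sec n : ℝ) ^ d ≤ 1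

/-- For some constant `0 < α < 1`, every probabilistic algorithm running in time
`2 ^ (sec n) ^ α` has advantage at most `2 ^ (-(sec n) ^ α)`. -/
def SubexpIndist (sec : ℕ → ℕ) (D U : ∀ n, PMF (Matrix (Fin (r n)) (Fin (c n)) F)) : Prop :=
  ∃ α : ℝ, 0 < α ∧ α < 1 ∧
    ∀ (A : Prog) (out : ∀ n, Matrix (Fin (r n)) (Fin (c n)) F → PMF Data),
      RunsInTime A out (fun n => (2 : ℝ) ^ ((sec n : ℝ) ^ α)) →
      ∀ᶠ n in atTop, advantage (D n) (U n) (out n) ≤ (2 : ℝ) ^ (-((sec n : ℝ) ^ α))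

end Indistinguishability

/-! ## Trapdoored matrices -/

/-- A family of trapdoored matrix distributions: for each `n`, a distribution of pairs `(M, C)` of
an `r n × c n` matrix `M` and a circuit `C` that computes `v ↦ M v`, samplable in time
polynomial in `n`. -/
structure TrapdooredFamily (F : Type*) [Field F] [Finite F] (r c : ℕ → ℕ) where
  dist : ∀ n, PMF (Matrix (Fin (r n)) (Fin (c n)) F × Circuit F (c n) (r n))
  correct : ∀ n, ∀ MC ∈ (dist n).support, ∀ v, MC.2.eval v = MC.1.mulVec v
  samplable : ∃ (p : Prog) (a : ℕ), ∀ n,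
    Runs p (Data.ofNat n)
      ((dist n).map fun MC => Data.cons (encMatrix MC.1) (encCircuit MC.2)) (n ^ a + a)

namespace TrapdooredFamily

variable {F : Type*} [Field F] [Finite F] {r c : ℕ → ℕ}

/-- The distribution of the matrix alone. -/
noncomputable def matrix (D : TrapdooredFamily F r c) (n : ℕ) :
    PMF (Matrix (Fin (r n)) (Fin (c n)) F) :=
  (D.dist n).map Prod.fst

/-- For all large `n`, every sampled circuit is applied in time `T n`. -/
def Efficient (D : TrapdooredFamily F r c) (T : ℕ → ℝ) : Prop :=
  ∀ᶠ n in atTop, ∀ MC ∈ (D.dist n).support, (MC.2.size : ℝ) ≤ T n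

/-- The matrix is indistinguishable from a uniformly random one in polynomial time. -/
def Indistinguishable (D : TrapdooredFamily F r c) : Prop :=
  PolyIndist (fun n => n) D.matrix fun n => uniform (Matrix (Fin (r n)) (Fin (c n)) F)

end TrapdooredFamily

/-! ## The McEliece assumption -/

/-- A family of near-linear-time encodable codes: for each `n`, a generator matrix
`G ∈ F ^ (n × dim n)` of a code of length `n` and dimension `dim n`, given with a circuit of size
`(n + dim n) polylog(n)` for the encoding map `v ↦ G v`.  The pair is produced by a polynomial-time
algorithm on input `n`, which may be deterministic (one fixed code for each `n`, with uniform
encoding circuits) or randomized (a random member of a class of codes). -/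
structure CodeFamily (F : Type*) [Field F] [Finite F] where
  dim : ℕ → ℕ
  gen : TrapdooredFamily F (fun n => n) dim
  fullRank : ∀ n, ∀ GC ∈ (gen.dist n).support, Function.Injective GC.1.mulVec
  nearLinear : ∃ a : ℕ, gen.Efficient fun n => ((n : ℝ) + dim n) * Real.log n ^ a

/-- The range of the random matrix `S` in `P G S`. -/
inductive Scrambler
  /-- `S` is uniform among all `k × k` matrices -/
  | all
  /-- `S` is uniform among the invertible `k × k` matrices -/
  | invertible

noncomputable def Scrambler.dist (F : Type*) [Field F] [Finite F] (k : ℕ) :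
    Scrambler → PMF (Matrix (Fin k) (Fin k) F)
  | Scrambler.all => uniform (Matrix (Fin k) (Fin k) F)
  | Scrambler.invertible => (uniform (Matrix (Fin k) (Fin k) F)ˣ).map Units.val

namespace CodeFamily

variable {F : Type*} [Field F] [Finite F]

/-- The distribution of `P G S` for a uniformly random permutation matrix `P`, a generator matrix
`G` of the family and a random `S`, all independent. -/
noncomputable def mcEliece (σ : Scrambler) (K : CodeFamily F) (n : ℕ) :
    PMF (Matrix (Fin n) (Fin (K.dim n)) F) :=
  (uniform (Equiv.Perm (Fin n))).bind fun π =>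
    (K.gen.matrix n).bind fun G =>
      (σ.dist F (K.dim n)).map fun S => π.permMatrix F * G * S

/-- The polynomial McEliece assumption; the security parameter is the dimension of the code. -/
def PolyMcEliece (σ : Scrambler) (K : CodeFamily F) : Prop :=
  PolyIndist K.dim (K.mcEliece σ) fun n => uniform (Matrix (Fin n) (Fin (K.dim n)) F)

/-- The subexponential McEliece assumption. -/
def SubexpMcEliece (σ : Scrambler) (K : CodeFamily F) : Prop :=
  SubexpIndist K.dim (K.mcEliece σ) fun n => uniform (Matrix (Fin n) (Fin (K.dim n)) F)

/-- The rate of the codes is bounded away from one. -/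
def RateBelowOne (K : CodeFamily F) : Prop :=
  ∃ ρ : ℝ, ρ < 1 ∧ ∀ᶠ n : ℕ in atTop, (K.dim n : ℝ) ≤ ρ * n

end CodeFamily

end Trapdoor

/-! Construction. Follow the dimensions `n, k(n), k(k(n)), …` down to the first number `r` that is
not above a threshold `s(n)`. Start with `N` independent uniform columns of length `r`, where `N` is
a power of two with `n < N ≤ 2n`. To pass from length `k = k(m)` to length `m`, cut the `N` columns
into groups of `w`, a power of two between `k/4` and `k/2`, and multiply each group by a fresh
generator matrix `G` with freshly permuted rows. At length `n`, the first `n` columns form `M`.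

Multiplication. Because `(PGS)x = PG(Sx)`, it suffices to carry up the chain, for each group of
columns, its product with the matching part of the input. Neighbouring products are added until the
groups have width `w` (all widths are powers of two, so groups nest), and each sum is encoded. A
level needs at most `8n/k` encodings of cost `m polylog(m)`; the rate bound leaves `O(log n)`
levels; the initial products cost `O(n s(n))`. This is `stateCode_correct` and
`trapdooredOfCodes_size_le`.

Security. An encoded group of uniform columns is `PGS` restricted to its first `w` columns: exactly
if `S` is uniform, and up to `2^{-(k-w)}` if `S` is uniform in the general linear group
(`scrambler_dist_le`, `mcEliece_columns_le`). Hence groups can be replaced by uniform columns one at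
a time, from the lowest level upwards, until `M` is uniform. The assumption is about uniform
algorithms, so a reduction that receives a matrix with `m` rows has to find out for which `n`, and
in which position `b`, to plant it, and also whether the distinguisher accepts more or less often on
encoded columns. It guesses `n` and `b` below a bound `R(m)`, and runs the distinguisher three
times: with the challenge, with columns it encodes itself, and with columns it draws uniformly. A
suitable Boolean function of the three answers has acceptance gap `(p₁ - p₀)²` for each usable
guess, where `p₁` and `p₀` are the acceptance probabilities on encoded and on uniform columns.
Squares cannot cancel between guesses, so the total advantage is at least `(p₁ - p₀)² / R(m)²` up to
the statistical error (`sq_div_le_advantage_add`).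

Parameters. All levels have `m > s(n)`, and `R(m)` must exceed `2n`. With `s(n) ≈ n^{1/c}`, `1/c <
ε`, a polynomial `R` suffices, and the circuits have size at most `n^{1+ε}`. With `s(n) ≈ (log n)^q`
the bound `R(m) ≈ 2^{m^{1/q}}` suffices; it is subexponential of the permitted order when `q > 1/α`,
and the circuits have size `n polylog(n)`.

Sampler and reduction have to be actual programs. This is obtained from closure properties of
efficiently computable kernels, most of which are tagged for `fun_prop`. -/

namespace Trapdoor

/-! ### Sizes of trees and of outputs -/

namespace Data

theorem size_pos (x : Data) : 1 ≤ x.size := by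
  cases x <;> simp [size]

theorem size_ofNat (n : ℕ) : (ofNat n).size = 2 * n + 1 := by
  induction n with
  | zero => rfl
  | succ n ih => simp only [ofNat, size, ih]; omega

theorem length_ofNat (n : ℕ) : (ofNat n).length = n := by
  induction n with
  | zero => rfl
  | succ n ih => simp [ofNat, length, ih]

theorem length_le_size (x : Data) : 2 * x.length + 1 ≤ x.size := by
  induction x with
  | nil => simp [size, length]
  | cons a b _ ih => have := a.size_pos; simp only [size, length]; omega

theorem ofNat_injective : Function.Injective ofNat := fun m n h => by
  rw [← length_ofNat m, h, length_ofNat]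

theorem size_fst (x : Data) : x.fst.size ≤ x.size := by
  cases x <;> simp [size, fst]; omega

theorem size_snd (x : Data) : x.snd.size ≤ x.size := by
  cases x <;> simp [size, snd]; omega

theorem ofList_injective : Function.Injective ofList := fun l => by
  induction l with
  | nil => intro l' h; cases l' <;> simp_all [ofList]
  | cons a l ih =>
    intro l' h
    cases l' with
    | nil => simp [ofList] at h
    | cons b l' => simp only [ofList, cons.injEq] at h; rw [h.1, ih h.2]

end Data

theorem randDist_cons (a b : Data) : randDist (Data.cons a b) =
    ((PMF.uniformOfFintype (Fin (b.length + 1))).map Fin.val).map Data.ofNat := rfl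

/-- Each instruction is charged at least the size of its result. So time bounds are also size bounds
for intermediate results, which makes polynomial time closed under composition. -/
theorem Runs.size_le {p : Prog} {x : Data} {μ : PMF Data} {t : ℕ} (h : Runs p x μ t) :
    ∀ y ∈ μ.support, y.size ≤ t := by
  induction h with
  | id x => simp
  | nil x => simp [Data.size]
  | fst x => simp [Data.size_fst]
  | snd x => simp [Data.size_snd]
  | rand x =>
    intro y hy
    cases x with
    | nil => simp only [randDist, PMF.mem_support_pure_iff] at hy; rw [hy]
    | cons a b =>
      rw [randDist_cons, PMF.map_comp, PMF.mem_support_map_iff] at hy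
      obtain ⟨i, -, rfl⟩ := hy
      rw [Function.comp_apply]
      rw [Data.size_ofNat]
      have := b.length_le_size
      have := i.2
      simp only [Data.size]; omega
  | pair _ _ ih1 ih2 =>
    intro y hy
    simp only [PMF.mem_support_bind_iff, PMF.mem_support_map_iff] at hy
    obtain ⟨a, ha, b, hb, rfl⟩ := hy
    have := ih1 a ha
    have := ih2 b hb
    simp only [Data.size]; omega
  | comp _ _ _ ih2 =>
    intro y hy
    obtain ⟨a, ha, hy⟩ := (PMF.mem_support_bind_iff _ _ _).1 hy
    have := ih2 a ha y hy
    omega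
  | ite_then _ _ ih => intro y hy; have := ih y hy; omega
  | ite_else _ _ ih => intro y hy; have := ih y hy; omega
  | loop_stop _ => simp
  | loop_step _ _ _ _ ih2 =>
    intro y hy
    obtain ⟨a, ha, hy⟩ := (PMF.mem_support_bind_iff _ _ _).1 hy
    have := ih2 a ha y hy
    omega
  | weaken _ hst ih => intro y hy; exact (ih y hy).trans hst

/-! ## Typed data -/

/-- Types whose elements are represented by data. -/
class Enc (α : Type*) where
  enc : α → Data
  inj : Function.Injective enc

open Enc (enc)

instance : Enc Data := ⟨id, Function.injective_id⟩

instance : Enc ℕ := ⟨Data.ofNat, Data.ofNat_injective⟩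

instance : Enc Bool := ⟨fun b => cond b (Data.ofNat 1) Data.nil, fun a b => by
  cases a <;> cases b <;> simp [Data.ofNat]⟩

instance {α β : Type*} [Enc α] [Enc β] : Enc (α × β) :=
  ⟨fun p => Data.cons (enc p.1) (enc p.2), fun a b h => by
    simp only [Data.cons.injEq] at h
    exact Prod.ext (Enc.inj h.1) (Enc.inj h.2)⟩

instance {α : Type*} [Enc α] : Enc (List α) :=
  ⟨fun l => Data.ofList (l.map enc),
    Data.ofList_injective.comp (List.map_injective_iff.2 Enc.inj)⟩

/-- The size of the representation. -/
def esize {α : Type*} [Enc α] (a : α) : ℕ := (enc a).size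

section Typed

variable {α β γ δ χ σ : Type*} [Enc α] [Enc β] [Enc γ] [Enc δ] [Enc χ] [Enc σ]

theorem enc_pair (a : α) (b : β) : enc (a, b) = Data.cons (enc a) (enc b) := rfl
theorem enc_cons (a : α) (l : List α) : enc (a :: l) = Data.cons (enc a) (enc l) := rfl
theorem enc_zero : enc (0 : ℕ) = Data.nil := rfl
theorem enc_succ (n : ℕ) : enc (n + 1) = Data.cons Data.nil (enc n) := rfl
theorem enc_true : enc true = Data.cons Data.nil Data.nil := rfl
theorem enc_false : enc false = Data.nil := rfl
theorem enc_data (x : Data) : enc x = x := rfl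

theorem esize_pos (a : α) : 1 ≤ esize a := Data.size_pos _
theorem esize_pair (a : α) (b : β) : esize (a, b) = esize a + esize b + 1 := rfl
theorem esize_mk (p : α × β) : esize p = esize p.1 + esize p.2 + 1 := rfl
theorem esize_nil : esize ([] : List α) = 1 := rfl
theorem esize_cons (a : α) (l : List α) : esize (a :: l) = esize a + esize l + 1 := rfl
theorem esize_nat (n : ℕ) : esize n = 2 * n + 1 := Data.size_ofNat n
theorem esize_bool (b : Bool) : esize b ≤ 3 := by cases b <;> simp [esize, enc, Data.ofNat, Data.size]

theorem esize_list (l : List α) : esize l = (l.map fun a => esize a + 1).sum + 1 := by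
  induction l with
  | nil => rfl
  | cons a l ih => rw [esize_cons, ih, List.map_cons, List.sum_cons]; omega

theorem esize_append (l l' : List α) : esize (l ++ l') + 1 = esize l + esize l' := by
  simp only [esize_list, List.map_append, List.sum_append]; omega

theorem esize_le_of_mem {l : List α} {a : α} (h : a ∈ l) : esize a ≤ esize l := by
  induction l with
  | nil => simp at h
  | cons b l ih =>
    rw [esize_cons]
    rcases List.mem_cons.1 h with rfl | h
    · omega
    · have := ih h; omega

theorem length_le_esize (l : List α) : l.length ≤ esize l := by
  induction l with
  | nil => simp
  | cons b l ih => rw [esize_cons, List.length_cons]; omega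

theorem esize_list_le {l : List α} {L B : ℕ} (hl : l.length ≤ L) (h : ∀ a ∈ l, esize a ≤ B) :
    esize l ≤ L * (B + 1) + 1 := by
  rw [esize_list]
  have := List.sum_le_card_nsmul (l.map fun a => esize a + 1) (B + 1) (by
    simp only [List.mem_map]; rintro _ ⟨a, ha, rfl⟩; have := h a ha; omega)
  simp only [List.length_map, smul_eq_mul] at this
  have := Nat.mul_le_mul_right (B + 1) hl
  omega

/-- `p` computes the distribution `μ` from `a` in time `t`. -/
def TRuns (p : Prog) (a : α) (μ : PMF β) (t : ℕ) : Prop := Runs p (enc a) (μ.map enc) t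

theorem TRuns.mono {p : Prog} {a : α} {μ : PMF β} {s t : ℕ} (h : TRuns p a μ s) (hst : s ≤ t) :
    TRuns p a μ t := Runs.weaken h hst

theorem TRuns.esize_le {p : Prog} {a : α} {μ : PMF β} {t : ℕ} (h : TRuns p a μ t) {b : β}
    (hb : b ∈ μ.support) : esize b ≤ t :=
  Runs.size_le h _ ((PMF.mem_support_map_iff _ _ _).2 ⟨b, hb, rfl⟩)

/-- The kernel on data that corresponds to a kernel on encoded elements. -/
noncomputable def liftKernel (κ : β → PMF γ) (y : Data) : PMF Data :=
  open Classical in if h : ∃ b : β, enc b = y then (κ h.choose).map enc else PMF.pure y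

theorem liftKernel_enc (κ : β → PMF γ) (b : β) : liftKernel κ (enc b) = (κ b).map enc := by
  have h : ∃ b' : β, enc b' = enc b := ⟨b, rfl⟩
  rw [liftKernel, dif_pos h, Enc.inj h.choose_spec]

theorem map_bind_liftKernel (μ : PMF β) (κ : β → PMF γ) :
    (μ.map enc).bind (liftKernel κ) = (μ.bind κ).map enc := by
  rw [PMF.bind_map, PMF.map_bind]
  congr 1
  funext b
  exact liftKernel_enc κ b

/-- `Runs.comp` asks for a kernel on all trees. `liftKernel` extends `κ` arbitrarily off the range
of `enc`, which is harmless because the first output always lies in that range. -/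
theorem TRuns.comp {p q : Prog} {a : α} {μ : PMF β} {κ : β → PMF γ} {s t : ℕ}
    (hp : TRuns p a μ s) (hq : ∀ b ∈ μ.support, TRuns q b (κ b) t) :
    TRuns (Prog.comp q p) a (μ.bind κ) (s + t + 1) := by
  unfold TRuns
  rw [← map_bind_liftKernel]
  refine Runs.comp hp fun y hy => ?_
  obtain ⟨b, hb, rfl⟩ := (PMF.mem_support_map_iff _ _ _).1 hy
  rw [liftKernel_enc]
  exact hq b hb

theorem TRuns.pair {p q : Prog} {a : α} {μ : PMF β} {ν : PMF γ} {s t : ℕ}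
    (hp : TRuns p a μ s) (hq : TRuns q a ν t) :
    TRuns (Prog.pair p q) a (μ.bind fun b => ν.map fun c => (b, c)) (s + t + 1) := by
  have := Runs.pair hp hq
  unfold TRuns
  convert this using 1
  rw [PMF.map_bind, PMF.bind_map]
  congr 1
  funext b
  simp only [Function.comp_apply, PMF.map_comp]
  rfl

/-- A loop whose body consumes the head of the list in the left subtree of the state. -/
theorem TRuns.loop {p : Prog} {f : χ → σ → α → PMF σ} {x : χ} {τ : ℕ} (l : List α)
    (I : ℕ → σ → Prop) (s : σ) (i : ℕ) (hs : I i s)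
    (hstep : ∀ a l' j s, (a :: l') <:+ l → j + (l'.length + 1) = i + l.length → I j s →
      TRuns p (a :: l', x, s) ((f x s a).map fun s' => (l', x, s')) τ ∧
      ∀ s' ∈ (f x s a).support, I (j + 1) s')
    (hlast : ∀ s, I (i + l.length) s → esize (([] : List α), x, s) ≤ τ)
    {foldP : (χ) → σ → List α → PMF σ} (h0 : ∀ s, foldP x s [] = PMF.pure s)
    (h1 : ∀ s a l, foldP x s (a :: l) = (f x s a).bind fun s' => foldP x s' l) :
    TRuns (Prog.loop p) (l, x, s) ((foldP x s l).map fun s' => (([] : List α), x, s'))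
      ((l.length + 1) * (τ + 1)) := by
  induction l generalizing s i with
  | nil =>
    rw [h0, PMF.pure_map]
    unfold TRuns
    rw [PMF.pure_map]
    refine Runs.weaken (Runs.loop_stop rfl) ?_
    have := hlast s hs
    unfold esize at this
    simp only [List.length_nil]
    omega
  | cons a l ih =>
    -- The counter plus the length of the remaining list is constant, so the invariant carries the
    -- index `i + l.length` when the list is used up.
    have h := hstep a l i s (List.suffix_refl _) rfl hs
    rw [h1, PMF.map_bind]
    unfold TRuns
    rw [show ((f x s a).bind fun s' => (foldP x s' l).map fun s' => (([] : List α), x, s')) =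
      ((f x s a).map fun s' => (l, x, s')).bind
        (fun z : List α × χ × σ => (foldP x z.2.2 l).map fun s' => (([] : List α), x, s')) by
        rw [PMF.bind_map]; rfl, ← map_bind_liftKernel]
    refine Runs.weaken (s := τ + (l.length + 1) * (τ + 1) + 1)
      (Runs.loop_step (by simp [enc_pair, enc_cons, Data.fst]) h.1 ?_) ?_
    · intro y hy
      simp only [PMF.map_comp, PMF.mem_support_map_iff] at hy
      obtain ⟨s', hs', rfl⟩ := hy
      simp only [Function.comp_apply]
      rw [liftKernel_enc]
      refine ih s' (i + 1) (h.2 s' hs') (fun a' l' j s hl hj hi => hstep a' l' j s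
        (hl.trans (List.suffix_cons _ _)) (by rw [hj, List.length_cons]; omega) hi) fun s hs => hlast s ?_
      rw [List.length_cons, add_comm l.length, ← add_assoc]; exact hs
    · simp only [List.length_cons]; ring_nf; omega

end Typed

end Trapdoor

namespace Trapdoor
open Enc (enc)

/-! ### Bounds by powers of a size measure -/

section Bounds

variable {α β : Type*} {S : Set α} {V : α → ℕ}

/-- `g` is bounded on `S` by a power of `V`. -/
def PBd (S : Set α) (V g : α → ℕ) : Prop := ∃ c : ℕ, ∀ a ∈ S, g a ≤ V a ^ c

theorem PBd.mono {g h : α → ℕ} (hg : PBd S V g) (hh : ∀ a ∈ S, h a ≤ g a) : PBd S V h := by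
  obtain ⟨c, hc⟩ := hg
  exact ⟨c, fun a ha => (hh a ha).trans (hc a ha)⟩

/-- Since `V ≥ 2`, one has `k ≤ 2 ^ k ≤ V ^ k`, and sums are absorbed in the same way. Pure powers
of `V` can therefore play the role of polynomials. -/
theorem PBd.const (hV : ∀ a ∈ S, 2 ≤ V a) (k : ℕ) : PBd S V fun _ => k :=
  ⟨k, fun a ha => Nat.lt_two_pow_self.le.trans (Nat.pow_le_pow_left (hV a ha) k)⟩

theorem PBd.self : PBd S V V := ⟨1, fun _ _ => by simp⟩

theorem PBd.mul {g h : α → ℕ} (hg : PBd S V g) (hh : PBd S V h) : PBd S V fun a => g a * h a := by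
  obtain ⟨c, hc⟩ := hg
  obtain ⟨d, hd⟩ := hh
  exact ⟨c + d, fun a ha => by rw [pow_add]; exact Nat.mul_le_mul (hc a ha) (hd a ha)⟩

theorem PBd.pow {g : α → ℕ} (hg : PBd S V g) (d : ℕ) : PBd S V fun a => g a ^ d := by
  obtain ⟨c, hc⟩ := hg
  exact ⟨c * d, fun a ha => by rw [pow_mul]; exact Nat.pow_le_pow_left (hc a ha) d⟩

theorem PBd.add (hV : ∀ a ∈ S, 2 ≤ V a) {g h : α → ℕ} (hg : PBd S V g) (hh : PBd S V h) :
    PBd S V fun a => g a + h a := by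
  obtain ⟨c, hc⟩ := hg
  obtain ⟨d, hd⟩ := hh
  refine ⟨c + d + 1, fun a ha => ?_⟩
  have h1 : 1 ≤ V a := by have := hV a ha; omega
  have h2 := (hc a ha).trans (Nat.pow_le_pow_right h1 (Nat.le_add_right c d))
  have h3 := (hd a ha).trans (Nat.pow_le_pow_right h1 (Nat.le_add_left d c))
  rw [pow_succ]
  have := Nat.mul_le_mul_left (V a ^ (c + d)) (hV a ha)
  simp only
  omega

end Bounds

/-! ### Closure properties of efficiently computable kernels -/

section Comp

variable {α β γ δ χ σ : Type*} [Enc α] [Enc β] [Enc γ] [Enc δ] [Enc χ] [Enc σ]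

/-- The kernel `f` is computed on `S` in time a power of `V`. -/
def CompOn (S : Set α) (V : α → ℕ) (f : α → PMF β) : Prop :=
  (∀ a ∈ S, esize a < V a) ∧ ∃ (p : Prog) (c : ℕ), ∀ a ∈ S, TRuns p a (f a) (V a ^ c)

/-- The kernel `f` is computed in polynomial time. -/
def Poly (f : α → PMF β) : Prop := CompOn Set.univ (fun a => esize a + 1) f

/-- The function `f` is computed in polynomial time. -/
@[fun_prop]
def PF (f : α → β) : Prop := Poly fun a => PMF.pure (f a)

/-- `g` is bounded by a polynomial of the size. -/
def PB (g : α → ℕ) : Prop := PBd Set.univ (fun a => esize a + 1) g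

variable {S : Set α} {V : α → ℕ}

theorem CompOn.two_le {f : α → PMF β} (h : CompOn S V f) : ∀ a ∈ S, 2 ≤ V a := fun a ha => by
  have := h.1 a ha
  have := esize_pos a
  omega

theorem CompOn.of_runs {f : α → PMF β} (hV : ∀ a ∈ S, esize a < V a) {g : α → ℕ}
    (hg : PBd S V g) (p : Prog) (h : ∀ a ∈ S, TRuns p a (f a) (g a)) : CompOn S V f := by
  obtain ⟨c, hc⟩ := hg
  exact ⟨hV, p, c, fun a ha => (h a ha).mono (hc a ha)⟩

theorem CompOn.exists_runs {f : α → PMF β} (h : CompOn S V f) :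
    ∃ (p : Prog) (g : α → ℕ), PBd S V g ∧ ∀ a ∈ S, TRuns p a (f a) (g a) := by
  obtain ⟨_, p, c, h⟩ := h
  exact ⟨p, fun a => V a ^ c, ⟨c, fun _ _ => le_rfl⟩, h⟩

theorem CompOn.esize_bound {f : α → PMF β} (h : CompOn S V f) :
    ∃ g : α → ℕ, PBd S V g ∧ ∀ a ∈ S, ∀ b ∈ (f a).support, esize b ≤ g a := by
  obtain ⟨p, g, hg, h⟩ := h.exists_runs
  exact ⟨g, hg, fun a ha b hb => (h a ha).esize_le hb⟩

theorem Poly.two_le : ∀ a ∈ (Set.univ : Set α), 2 ≤ esize a + 1 := fun a _ => by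
  have := esize_pos a
  omega

theorem Poly.of_runs {f : α → PMF β} {g : α → ℕ} (hg : PB g) (p : Prog)
    (h : ∀ a, TRuns p a (f a) (g a)) : Poly f :=
  CompOn.of_runs (fun _ _ => Nat.lt_succ_self _) hg p fun a _ => h a

theorem Poly.compOn {f : α → PMF β} (h : Poly f) (hV : ∀ a ∈ S, esize a < V a) :
    CompOn S V f := by
  obtain ⟨_, p, c, h⟩ := h
  refine ⟨hV, p, c, fun a ha => (h a trivial).mono (Nat.pow_le_pow_left (hV a ha) c)⟩

theorem PB.const (k : ℕ) : PB fun _ : α => k := PBd.const Poly.two_le k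
theorem PB.add {g h : α → ℕ} (hg : PB g) (hh : PB h) : PB fun a => g a + h a :=
  PBd.add Poly.two_le hg hh
theorem PB.mul {g h : α → ℕ} (hg : PB g) (hh : PB h) : PB fun a => g a * h a := PBd.mul hg hh
theorem PB.pow {g : α → ℕ} (hg : PB g) (d : ℕ) : PB fun a => g a ^ d := PBd.pow hg d
theorem PB.mono {g h : α → ℕ} (hg : PB g) (hh : ∀ a, h a ≤ g a) : PB h :=
  PBd.mono hg fun a _ => hh a
theorem PB.esize_self : PB fun a : α => esize a := PBd.self.mono fun _ _ => Nat.le_succ _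

theorem Poly.esize_bound {f : α → PMF β} (h : Poly f) :
    ∃ g : α → ℕ, PB g ∧ ∀ a, ∀ b ∈ (f a).support, esize b ≤ g a := by
  obtain ⟨g, hg, h⟩ := CompOn.esize_bound h
  exact ⟨g, hg, fun a => h a trivial⟩

theorem PF.pb {f : α → β} (h : PF f) : PB fun a => esize (f a) := by
  obtain ⟨g, hg, h⟩ := Poly.esize_bound h
  exact hg.mono fun a => h a _ (by simp)

theorem PF.pb_nat {f : α → ℕ} (h : PF f) : PB f := h.pb.mono fun a => by rw [esize_nat]; omega

theorem PF.pb_length {f : α → List β} (h : PF f) : PB fun a => (f a).length :=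
  h.pb.mono fun a => length_le_esize _

/-- The outer kernel may be efficient only on a set `T` and in its own measure `U`. Both freedoms
matter: a distinguisher obeys its time bound only on large matrices, and the range of guesses of the
reduction may be superpolynomial in its input. -/
theorem CompOn.comp_of {f : α → PMF β} {g : β → PMF γ} {T : Set β} {U : β → ℕ}
    (hg : CompOn T U g) (hf : CompOn S V f) {h : α → ℕ} (hh : PBd S V h)
    (hT : ∀ a ∈ S, ∀ b ∈ (f a).support, b ∈ T ∧ U b ≤ h a) :
    CompOn S V fun a => (f a).bind g := by
  have h2 := hf.two_le
  obtain ⟨p, u, hu, hp⟩ := hf.exists_runs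
  obtain ⟨_, q, c, hq⟩ := hg
  refine CompOn.of_runs hf.1 ((hu.add h2 (hh.pow c)).add h2 (PBd.const h2 1)) (Prog.comp q p)
    fun a ha => (hp a ha).comp fun b hb => ?_
  exact (hq b (hT a ha b hb).1).mono (Nat.pow_le_pow_left (hT a ha b hb).2 c)

theorem CompOn.comp {f : α → PMF β} {g : β → PMF γ} (hg : Poly g) (hf : CompOn S V f) :
    CompOn S V fun a => (f a).bind g := by
  have h2 := hf.two_le
  obtain ⟨u, hu, hb⟩ := hf.esize_bound
  exact CompOn.comp_of hg hf (hu.add h2 (PBd.const h2 1)) fun a ha b h =>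
    ⟨trivial, Nat.succ_le_succ (hb a ha b h)⟩

theorem CompOn.pair {f : α → PMF β} {g : α → PMF γ} (hf : CompOn S V f) (hg : CompOn S V g) :
    CompOn S V fun a => (f a).bind fun b => (g a).map fun c => (b, c) := by
  have h2 := hf.two_le
  obtain ⟨p, u, hu, hp⟩ := hf.exists_runs
  obtain ⟨q, v, hv, hq⟩ := hg.exists_runs
  exact CompOn.of_runs hf.1 ((hu.add h2 hv).add h2 (PBd.const h2 1)) (Prog.pair p q)
    fun a ha => (hp a ha).pair (hq a ha)

theorem Poly.comp {f : α → PMF β} {g : β → PMF γ} (hg : Poly g) (hf : Poly f) :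
    Poly fun a => (f a).bind g := CompOn.comp hg hf

theorem Poly.pair {f : α → PMF β} {g : α → PMF γ} (hf : Poly f) (hg : Poly g) :
    Poly fun a => (f a).bind fun b => (g a).map fun c => (b, c) := CompOn.pair hf hg

theorem Poly.compF {f : α → β} {g : β → PMF γ} (hg : Poly g) (hf : PF f) :
    Poly fun a => g (f a) := by
  have := Poly.comp hg hf
  simpa using this

theorem Poly.of_data {f : α → β} (p : Prog) (g : α → ℕ) (hg : PB g)
    (h : ∀ a, Runs p (enc a) (PMF.pure (enc (f a))) (g a)) : PF f :=
  Poly.of_runs hg p fun a => by unfold TRuns; rw [PMF.pure_map]; exact h a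

@[fun_prop]
theorem PF.id : PF fun a : α => a :=
  Poly.of_data Prog.id _ PB.esize_self fun a => Runs.id _

@[fun_prop]
theorem PF.comp {f : α → β} {g : β → γ} (hg : PF g) (hf : PF f) : PF fun a => g (f a) :=
  Poly.compF (g := fun b => PMF.pure (g b)) hg hf

theorem exists_const_prog (d : Data) : ∃ p t, ∀ x, Runs p x (PMF.pure d) t := by
  induction d with
  | nil => exact ⟨_, _, fun x => Runs.nil x⟩
  | cons a b iha ihb =>
    obtain ⟨p, s, hp⟩ := iha
    obtain ⟨q, t, hq⟩ := ihb
    refine ⟨Prog.pair p q, s + t + 1, fun x => ?_⟩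
    have := Runs.pair (hp x) (hq x)
    simpa [PMF.pure_bind, PMF.pure_map] using this

@[fun_prop]
theorem PF.const (b : β) : PF fun _ : α => b := by
  obtain ⟨p, t, h⟩ := exists_const_prog (enc b)
  exact Poly.of_data p _ (PB.const t) fun a => h _

@[fun_prop]
theorem PF.prodMk {f : α → β} {g : α → γ} (hf : PF f) (hg : PF g) : PF fun a => (f a, g a) := by
  have := Poly.pair hf hg
  simpa [PF, PMF.pure_map] using this

@[fun_prop]
theorem PF.fst {f : α → β × γ} (hf : PF f) : PF fun a => (f a).1 :=
  PF.comp (Poly.of_data Prog.fst _ PB.esize_self fun _ => Runs.fst _) hf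

@[fun_prop]
theorem PF.snd {f : α → β × γ} (hf : PF f) : PF fun a => (f a).2 :=
  PF.comp (Poly.of_data Prog.snd _ PB.esize_self fun _ => Runs.snd _) hf

/-- Pairing with the identity keeps the input available to the second kernel. -/
theorem CompOn.bind {f : α → PMF β} {g : α → β → PMF γ} (hf : CompOn S V f)
    (hg : Poly fun p : α × β => g p.1 p.2) : CompOn S V fun a => (f a).bind (g a) := by
  have h1 : CompOn S V fun a => PMF.pure a := Poly.compOn PF.id hf.1
  have := CompOn.comp hg (h1.pair hf)
  simpa [PMF.bind_map, Function.comp_def] using this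

theorem Poly.bind {f : α → PMF β} {g : α → β → PMF γ} (hf : Poly f)
    (hg : Poly fun p : α × β => g p.1 p.2) : Poly fun a => (f a).bind (g a) := CompOn.bind hf hg

theorem Poly.map {f : α → PMF β} {g : α → β → γ} (hf : Poly f)
    (hg : PF fun p : α × β => g p.1 p.2) : Poly fun a => (f a).map (g a) := by
  have := Poly.bind (g := fun a b => PMF.pure (g a b)) hf hg
  exact this

/-- `Prog.ite` looks at the left subtree, so the program forms `(c a, a)` and each branch drops the
flag. A branch has to be efficient only where it is taken; thus a validity test can guard a call of
the distinguisher. -/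
theorem CompOn.cond {c : α → Bool} {f g : α → PMF β} (hc : PF c) (hV : ∀ a ∈ S, esize a < V a)
    (hf : CompOn {a ∈ S | c a = true} V f) (hg : CompOn {a ∈ S | c a = false} V g) :
    CompOn S V fun a => bif c a then f a else g a := by
  have h2 : ∀ a ∈ S, 2 ≤ V a := fun a ha => by
    have := hV a ha; have := esize_pos a; omega
  obtain ⟨_, p, i, hp⟩ := hf
  obtain ⟨_, q, j, hq⟩ := hg
  obtain ⟨r, k, hr⟩ := (hc.prodMk PF.id).2
  have hself := PBd.self (S := S) (V := V)
  have one := PBd.const h2 1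
  have hb : PBd S V fun a => V a ^ k + (5 + V a + (V a ^ i + V a ^ j) + 1 + 1) + 1 :=
    ((hself.pow k).add h2 ((((((PBd.const h2 5).add h2 hself).add h2
      ((hself.pow i).add h2 (hself.pow j))).add h2 one).add h2 one))).add h2 one
  refine CompOn.of_runs hV hb (Prog.comp (Prog.ite (Prog.comp p Prog.snd) (Prog.comp q Prog.snd)) r)
    fun a ha => ?_
  have h1 := (hr a trivial).mono (Nat.pow_le_pow_left (Nat.succ_le_of_lt (hV a ha)) k)
  have := h1.comp (κ := fun z : Bool × α => bif z.1 then f z.2 else g z.2)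
    (q := Prog.ite (Prog.comp p Prog.snd) (Prog.comp q Prog.snd))
    (t := 5 + V a + (V a ^ i + V a ^ j) + 1 + 1) ?_
  · simpa using this
  intro z hz
  simp only [PMF.mem_support_pure_iff] at hz
  subst hz
  have hs : TRuns Prog.snd (c a, a) (PMF.pure a) (5 + V a) := by
    unfold TRuns
    rw [PMF.pure_map]
    refine Runs.weaken (Runs.snd _) ?_
    have := esize_bool (c a)
    have := hV a ha
    have := esize_pair (c a) a
    unfold esize at *
    omega
  unfold TRuns
  cases h : c a with
  | true =>
    refine Runs.ite_then (by simp [enc_pair, enc_true, Data.fst]) ?_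
    have := hs.comp (κ := fun b => f b) (q := p) (t := V a ^ i) (by
      intro b hb
      simp only [PMF.mem_support_pure_iff] at hb
      subst hb
      exact hp b ⟨ha, h⟩)
    rw [PMF.pure_bind, h] at this
    exact this.mono (by omega)
  | false =>
    refine Runs.ite_else (by simp [enc_pair, enc_false, Data.fst]) ?_
    have := hs.comp (κ := fun b => g b) (q := q) (t := V a ^ j) (by
      intro b hb
      simp only [PMF.mem_support_pure_iff] at hb
      subst hb
      exact hq b ⟨ha, h⟩)
    rw [PMF.pure_bind, h] at this
    exact this.mono (by omega)

theorem Poly.cond {c : α → Bool} {f g : α → PMF β} (hc : PF c) (hf : Poly f) (hg : Poly g) :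
    Poly fun a => bif c a then f a else g a :=
  CompOn.cond hc hf.1 (hf.compOn fun a _ => hf.1 a trivial) (hg.compOn fun a _ => hf.1 a trivial)

@[fun_prop]
theorem PF.cond {c : α → Bool} {f g : α → β} (hc : PF c) (hf : PF f) (hg : PF g) :
    PF fun a => bif c a then f a else g a := by
  have := Poly.cond hc hf hg
  unfold PF
  convert this using 2 with a
  cases h : c a <;> simp [h]

@[fun_prop]
theorem PF.ite {c : α → Prop} [DecidablePred c] {f g : α → β} (hc : PF fun a => decide (c a))
    (hf : PF f) (hg : PF g) : PF fun a => if c a then f a else g a := by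
  have := PF.cond hc hf hg
  simpa [Bool.cond_decide] using this

@[fun_prop]
theorem PF.tail {f : α → List β} (hf : PF f) : PF fun a => (f a).tail :=
  PF.comp (g := List.tail) (Poly.of_data Prog.snd _ PB.esize_self fun l => by
    have := Runs.snd (enc l)
    cases l <;> exact this) hf

@[fun_prop]
theorem PF.headD {f : α → List β} {g : α → β} (hf : PF f) (hg : PF g) :
    PF fun a => (f a).headD (g a) := by
  refine PF.comp (g := fun z : List β × β => z.1.headD z.2) ?_ (hf.prodMk hg)
  refine Poly.of_data (Prog.ite (Prog.comp Prog.fst Prog.fst) Prog.snd)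
    (fun z => esize z + esize z + 1 + 1)
    (((PB.esize_self.add PB.esize_self).add (PB.const 1)).add (PB.const 1)) fun z => ?_
  obtain ⟨l, b⟩ := z
  cases l with
  | nil =>
    refine Runs.ite_else rfl (Runs.weaken (Runs.snd _) ?_)
    unfold esize; omega
  | cons a l =>
    refine Runs.ite_then (by simp [enc_pair, enc_cons, Data.fst]) ?_
    have := Runs.comp (g := Prog.fst) (κ := fun y => PMF.pure y.fst) (t := esize (a :: l, b))
      (Runs.fst (enc (a :: l, b))) (by
        intro y hy
        simp only [PMF.mem_support_pure_iff] at hy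
        subst hy
        exact Runs.weaken (Runs.fst _) (Data.size_fst _))
    rw [PMF.pure_bind] at this
    exact this

/-! ### Folds -/

/-- Sequential composition of random steps along a list. -/
noncomputable def foldP {α σ : Type*} (f : σ → α → PMF σ) : σ → List α → PMF σ
  | s, [] => PMF.pure s
  | s, a :: l => (f s a).bind fun s' => foldP f s' l

theorem foldP_pure {α σ : Type*} (f : σ → α → σ) (s : σ) (l : List α) :
    foldP (fun s a => PMF.pure (f s a)) s l = PMF.pure (l.foldl f s) := by
  induction l generalizing s with
  | nil => rfl
  | cons a l ih => rw [foldP, PMF.pure_bind, ih]; rfl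

/-- Iterating a polynomial-time step can blow up the state exponentially. The invariant `I` serves
to bound the state by `g` throughout, and then every pass of the loop costs a fixed power of one
bound. -/
theorem CompOn.fold {l : α → List β} {s₀ : α → σ} {f : α → σ → β → PMF σ}
    (hl : CompOn S V fun a => PMF.pure (l a)) (hs : CompOn S V fun a => PMF.pure (s₀ a))
    (hf : Poly fun p : α × σ × β => f p.1 p.2.1 p.2.2) (I : α → ℕ → σ → Prop)
    (h0 : ∀ x ∈ S, I x 0 (s₀ x))
    (hstep : ∀ x ∈ S, ∀ i s, ∀ b ∈ l x, i < (l x).length → I x i s →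
      ∀ s' ∈ (f x s b).support, I x (i + 1) s')
    (g : α → ℕ) (hg : PBd S V g) (hI : ∀ x ∈ S, ∀ i s, i ≤ (l x).length → I x i s → esize s ≤ g x) :
    CompOn S V fun a => foldP (f a) (s₀ a) (l a) := by
  -- The loop body reads the head of the list with a default `b₀`; if there is no such element,
  -- every list is empty.
  rcases isEmpty_or_nonempty β with hβ | ⟨⟨b₀⟩⟩
  · have : (fun a => foldP (f a) (s₀ a) (l a)) = fun a => PMF.pure (s₀ a) := by
      funext a
      rw [Subsingleton.elim (l a) []]; rfl
    rwa [this]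
  have hV := hl.1
  have h2 := hl.two_le
  have hbody : Poly fun z : List β × α × σ =>
      (f z.2.1 z.2.2 (z.1.headD b₀)).map fun s' => (z.1.tail, z.2.1, s') := by
    refine Poly.map (f := fun z : List β × α × σ => f z.2.1 z.2.2 (z.1.headD b₀)) ?_ (by fun_prop)
    exact Poly.compF (f := fun z : List β × α × σ => (z.2.1, z.2.2, z.1.headD b₀)) hf (by fun_prop)
  obtain ⟨p, c, hp⟩ := hbody.2
  obtain ⟨u, hu, hlu⟩ := hl.esize_bound
  have hlu : ∀ x ∈ S, esize (l x) ≤ u x := fun x hx => hlu x hx _ (by simp)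
  have one := PBd.const h2 1
  have hV' := PBd.self (S := S) (V := V)
  -- The exponent `c + 1` instead of `c` makes the bound at least its base, which pays for the last
  -- test of the loop even if `c = 0`.
  have hτ : PBd S V fun x => (u x + (V x + g x + 1) + 1 + 1) ^ (c + 1) :=
    ((((hu.add h2 ((hV'.add h2 hg).add h2 one)).add h2 one).add h2 one)).pow _
  have hloop : CompOn S V fun x => (foldP (f x) (s₀ x) (l x)).map
      fun s' => (([] : List β), x, s') := by
    obtain ⟨q, t, ht, hq⟩ := (hl.pair ((Poly.compOn PF.id hV).pair hs)).exists_runs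
    refine CompOn.of_runs hV ((ht.add h2 ((hu.add h2 one).mul (hτ.add h2 one))).add h2 one)
      (Prog.comp (Prog.loop p) q) fun x hx => ?_
    have h1 := hq x hx
    simp only [PMF.pure_bind, PMF.pure_map] at h1
    have hz : ∀ i s, i ≤ (l x).length → I x i s → ∀ l', l' <:+ l x →
        esize (l', x, s) ≤ u x + (V x + g x + 1) + 1 := by
      intro i s hi hs l' hl'
      have e1 := hlu x hx
      have e2 := hV x hx
      have e3 := hI x hx i s hi hs
      have e4 : esize l' ≤ esize (l x) := by
        obtain ⟨l'', h⟩ := hl'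
        rw [← h]
        have := esize_append l'' l'
        have := esize_pos l''
        omega
      simp only [esize_pair]
      omega
    have h3 := TRuns.loop (p := p) (f := f) (x := x)
      (τ := (u x + (V x + g x + 1) + 1 + 1) ^ (c + 1)) (l x)
      (fun i s => i ≤ (l x).length ∧ I x i s) (s₀ x) 0 ⟨Nat.zero_le _, h0 x hx⟩ ?_ ?_
      (foldP := fun x s l => foldP (f x) s l) (fun _ => rfl) (fun _ _ _ => rfl)
    · have := h1.comp (q := Prog.loop p)
        (κ := fun _ => (foldP (f x) (s₀ x) (l x)).map fun s' => (([] : List β), x, s'))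
        (t := (u x + 1) * ((u x + (V x + g x + 1) + 1 + 1) ^ (c + 1) + 1)) ?_
      · rw [PMF.pure_bind] at this
        exact this
      intro z hz
      simp only [PMF.mem_support_pure_iff] at hz
      subst hz
      exact h3.mono (Nat.mul_le_mul_right _ (Nat.succ_le_succ ((length_le_esize _).trans (hlu x hx))))
    · intro b l' j s hl' hj ⟨hj1, hjs⟩
      simp only [zero_add] at hj
      constructor
      · refine (hp (b :: l', x, s) trivial).mono ?_
        have := hz j s hj1 hjs _ hl'
        exact (Nat.pow_le_pow_left (Nat.succ_le_succ this) c).trans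
          (Nat.pow_le_pow_right (Nat.succ_pos _) (Nat.le_succ c))
      · exact fun s' hs' => ⟨by omega, hstep x hx j s b (hl'.subset (by simp)) (by omega) hjs s' hs'⟩
    · intro s ⟨hi, his⟩
      rw [zero_add] at hi his
      have := hz _ s hi his [] (List.nil_suffix)
      refine (this.trans (Nat.le_succ _)).trans (Nat.le_self_pow (Nat.succ_ne_zero c) _)
  have := CompOn.comp (g := fun z : List β × α × σ => PMF.pure z.2.2) (by
    change PF fun z : List β × α × σ => z.2.2
    fun_prop) hloop
  simpa [PMF.bind_map, Function.comp_def] using this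

end Comp
end Trapdoor

namespace Trapdoor
open Enc (enc)

/-! ### Polynomial-time functions on lists and unary numbers -/

section Functions

variable {α β γ δ χ σ : Type*} [Enc α] [Enc β] [Enc γ] [Enc δ] [Enc χ] [Enc σ]

theorem Poly.fold {l : χ → List β} {s₀ : χ → σ} {f : χ → σ → β → PMF σ}
    (hl : PF l) (hs : PF s₀)
    (hf : Poly fun p : χ × σ × β => f p.1 p.2.1 p.2.2) (I : χ → ℕ → σ → Prop)
    (h0 : ∀ x, I x 0 (s₀ x))
    (hstep : ∀ x i s, ∀ b ∈ l x, i < (l x).length → I x i s →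
      ∀ s' ∈ (f x s b).support, I x (i + 1) s')
    (g : χ → ℕ) (hg : PB g) (hI : ∀ x i s, i ≤ (l x).length → I x i s → esize s ≤ g x) :
    Poly fun a => foldP (f a) (s₀ a) (l a) :=
  CompOn.fold hl hs hf I (fun x _ => h0 x) (fun x _ => hstep x) g hg fun x _ => hI x

theorem PF.foldl {l : χ → List β} {s₀ : χ → σ} {f : χ → σ → β → σ}
    (hl : PF l) (hs : PF s₀)
    (hf : PF fun p : χ × σ × β => f p.1 p.2.1 p.2.2) (I : χ → ℕ → σ → Prop)
    (h0 : ∀ x, I x 0 (s₀ x))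
    (hstep : ∀ x i s, ∀ b ∈ l x, i < (l x).length → I x i s → I x (i + 1) (f x s b))
    (g : χ → ℕ) (hg : PB g) (hI : ∀ x i s, i ≤ (l x).length → I x i s → esize s ≤ g x) :
    PF fun a => (l a).foldl (f a) (s₀ a) := by
  have := Poly.fold (f := fun x s b => PMF.pure (f x s b)) hl hs hf I h0
    (fun x i s b hb hi h s' hs' => by
      rw [(PMF.mem_support_pure_iff _ _).1 hs']; exact hstep x i s b hb hi h) g hg hI
  simp only [foldP_pure] at this
  exact this

/-- Growth by a bounded amount in each step keeps the state polynomial. -/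
theorem PF.foldl_of_add {l : χ → List β} {s₀ : χ → σ} {f : χ → σ → β → σ}
    (hl : PF l) (hs : PF s₀) (hf : PF fun p : χ × σ × β => f p.1 p.2.1 p.2.2)
    (D : χ → ℕ) (hD : PB D) (h : ∀ x s, ∀ b ∈ l x, esize (f x s b) ≤ esize s + D x) :
    PF fun a => (l a).foldl (f a) (s₀ a) :=
  PF.foldl hl hs hf (fun x i s => esize s ≤ esize (s₀ x) + i * D x) (fun x => by simp)
    (fun x i s b hb _ hi => by
      have := h x s b hb
      rw [Nat.succ_mul]; omega)
    (fun x => esize (s₀ x) + (l x).length * D x) (hs.pb.add (hl.pb_length.mul hD))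
    fun x i s hi hs => hs.trans (Nat.add_le_add_left (Nat.mul_le_mul_right _ hi) _)

/-- A program sees only encodings. Constructors that are encoded as tuples, such as `cons`,
successor and gates, are thereby computable at no extra work. -/
theorem PF.of_enc_eq {f : χ → β} {g : χ → γ} (hf : PF f) (h : ∀ x, enc (f x) = enc (g x)) :
    PF g := by
  obtain ⟨h1, p, c, hp⟩ := hf
  exact ⟨h1, p, c, fun x hx => by
    have := hp x hx
    unfold TRuns at this ⊢
    rwa [PMF.pure_map, h, ← PMF.pure_map] at this⟩

@[fun_prop]
theorem PF.cons {f : χ → β} {g : χ → List β} (hf : PF f) (hg : PF g) :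
    PF fun x => f x :: g x :=
  (hf.prodMk hg).of_enc_eq fun _ => rfl

@[fun_prop]
theorem PF.reverse {f : χ → List β} (hf : PF f) : PF fun x => (f x).reverse := by
  have : PF fun x => (f x).foldl (fun s b => b :: s) [] :=
    PF.foldl_of_add hf (by fun_prop) (by fun_prop) (fun x => esize (f x) + 1) (hf.pb.add (PB.const 1))
      fun x s b hb => by rw [esize_cons]; have := esize_le_of_mem hb; omega
  simpa using this

@[fun_prop]
theorem PF.append {f g : χ → List β} (hf : PF f) (hg : PF g) : PF fun x => f x ++ g x := by
  have : PF fun x => (f x).reverse.foldl (fun s b => b :: s) (g x) :=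
    PF.foldl_of_add (by fun_prop) hg (by fun_prop) (fun x => esize (f x) + 1)
      (hf.pb.add (PB.const 1)) fun x s b hb => by
        rw [esize_cons]; have := esize_le_of_mem (List.mem_reverse.1 hb); omega
  simpa using this

@[fun_prop]
theorem PF.map {l : χ → List β} {f : χ → β → γ} (hl : PF l) (hf : PF fun p : χ × β => f p.1 p.2) :
    PF fun x => (l x).map (f x) := by
  obtain ⟨c, hc⟩ := hf.pb
  have : PF fun x => ((l x).foldl (fun s b => f x b :: s) []).reverse := by
    refine PF.reverse (PF.foldl_of_add (f := fun x s b => f x b :: s) hl (by fun_prop) ?_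
      (fun x => (esize x + esize (l x) + 1 + 1) ^ c + 1)
      ((((PB.esize_self.add hl.pb).add (PB.const 1)).add (PB.const 1)).pow c |>.add (PB.const 1))
      fun x s b hb => ?_)
    · exact PF.cons (PF.comp (g := fun p : χ × β => f p.1 p.2)
        (f := fun p : χ × List γ × β => (p.1, p.2.2)) hf (by fun_prop)) (by fun_prop)
    · rw [esize_cons]
      have h1 := hc (x, b) trivial
      have h2 := esize_le_of_mem hb
      have h3 := Nat.pow_le_pow_left (show esize (x, b) + 1 ≤ esize x + esize (l x) + 1 + 1 by
        rw [esize_pair]; omega) c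
      simp only at h1
      omega
  convert this using 2 with x
  have : ∀ s : List γ, (l x).foldl (fun s b => f x b :: s) s = ((l x).map (f x)).reverse ++ s := by
    intro s
    induction l x generalizing s with
    | nil => rfl
    | cons b l ih => simp [ih]
  rw [this]; simp

@[fun_prop]
theorem PF.succ {f : χ → ℕ} (hf : PF f) : PF fun x => f x + 1 :=
  ((PF.const (α := χ) Data.nil).prodMk hf).of_enc_eq fun _ => rfl

/-- A unary number literally is a list of that length, so the identity program turns a counter into
a list to fold over. -/
theorem enc_replicate (n : ℕ) : enc (List.replicate n Data.nil) = enc n := by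
  induction n with
  | zero => rfl
  | succ n ih => rw [List.replicate_succ, enc_cons, ih]; rfl

@[fun_prop]
theorem PF.unary {f : χ → ℕ} (hf : PF f) : PF fun x => List.replicate (f x) Data.nil :=
  PF.comp (g := fun n => List.replicate n Data.nil)
    (Poly.of_data Prog.id _ PB.esize_self fun n => by rw [enc_replicate]; exact Runs.id _) hf

@[fun_prop]
theorem PF.length {f : χ → List β} (hf : PF f) : PF fun x => (f x).length := by
  have : PF fun x => (f x).foldl (fun s _ => s + 1) 0 :=
    PF.foldl_of_add hf (by fun_prop) (by fun_prop) (fun x => 2) (PB.const 2)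
      fun x s b hb => by simp only [esize_nat]; omega
  convert this using 2 with x
  have : ∀ n, (f x).foldl (fun s _ => s + 1) n = n + (f x).length := by
    intro n
    induction f x generalizing n with
    | nil => rfl
    | cons b l ih => rw [List.foldl_cons, ih, List.length_cons]; omega
  rw [this, zero_add]

theorem foldl_replicate_iterate {α β : Type*} (f : α → α) (a : α) (b : β) (n : ℕ) :
    (List.replicate n b).foldl (fun s _ => f s) a = f^[n] a := by
  induction n generalizing a with
  | zero => rfl
  | succ n ih => rw [List.replicate_succ, List.foldl_cons, ih, Function.iterate_succ_apply]

theorem PF.iterate {n : χ → ℕ} {s₀ : χ → σ} {f : χ → σ → σ} (hn : PF n) (hs : PF s₀)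
    (hf : PF fun p : χ × σ => f p.1 p.2) (g : χ → ℕ) (hg : PB g)
    (h : ∀ x, ∀ i ≤ n x, esize ((f x)^[i] (s₀ x)) ≤ g x) : PF fun x => (f x)^[n x] (s₀ x) := by
  have : PF fun x => (List.replicate (n x) Data.nil).foldl (fun s _ => f x s) (s₀ x) := by
    refine PF.foldl (by fun_prop) hs (PF.comp (g := fun p : χ × σ => f p.1 p.2)
        (f := fun p : χ × σ × Data => (p.1, p.2.1)) hf (by fun_prop))
      (fun x i s => s = (f x)^[i] (s₀ x)) (fun x => rfl) (fun x i s b _ _ hi => ?_) g hg ?_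
    · rw [hi, Function.iterate_succ_apply']
    · rintro x i s hi rfl
      exact h x i (by simpa using hi)
  simpa only [foldl_replicate_iterate] using this

@[fun_prop]
theorem PF.add {f g : χ → ℕ} (hf : PF f) (hg : PF g) : PF fun x => f x + g x := by
  have h (n a : ℕ) : (fun s => s + 1)^[n] a = a + n := by
    induction n generalizing a with
    | zero => rfl
    | succ n ih => rw [Function.iterate_succ_apply, ih]; omega
  have := PF.iterate (f := fun _ s => s + 1) hg hf (by fun_prop)
    (fun x => esize (f x) + esize (g x)) (hf.pb.add hg.pb) fun x i hi => by
      simp only [h, esize_nat]; omega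
  simpa only [h] using this

@[fun_prop]
theorem PF.pred {f : χ → ℕ} (hf : PF f) : PF fun x => f x - 1 :=
  PF.comp (g := fun n => n - 1) (Poly.of_data Prog.snd _ PB.esize_self fun n => by
    have := Runs.snd (enc n)
    cases n <;> exact this) hf

@[fun_prop]
theorem PF.sub {f g : χ → ℕ} (hf : PF f) (hg : PF g) : PF fun x => f x - g x := by
  have h (n a : ℕ) : (fun s => s - 1)^[n] a = a - n := by
    induction n generalizing a with
    | zero => rfl
    | succ n ih => rw [Function.iterate_succ_apply, ih]; omega
  have := PF.iterate (f := fun _ s => s - 1) hg hf (by fun_prop)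
    (fun x => esize (f x)) hf.pb fun x i hi => by
      simp only [h, esize_nat]; omega
  simpa only [h] using this

@[fun_prop]
theorem PF.mul {f g : χ → ℕ} (hf : PF f) (hg : PF g) : PF fun x => f x * g x := by
  have h (a n b : ℕ) : (fun s => s + a)^[n] b = b + a * n := by
    induction n generalizing b with
    | zero => rfl
    | succ n ih => rw [Function.iterate_succ_apply, ih]; ring
  have := PF.iterate (f := fun x s => s + f x) hg (PF.const 0)
    (PF.add (by fun_prop) (PF.comp hf (by fun_prop)))
    (fun x => 2 * (f x * g x) + 1) (((PB.const 2).mul (hf.pb_nat.mul hg.pb_nat)).add (PB.const 1))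
    fun x i hi => by
      simp only [h, esize_nat]
      have := Nat.mul_le_mul_left (f x) hi
      omega
  simpa only [h, zero_add] using this

@[fun_prop]
theorem PF.pow {f : χ → ℕ} (hf : PF f) (c : ℕ) : PF fun x => f x ^ c := by
  induction c with
  | zero => simpa using PF.const 1
  | succ c ih => simp only [pow_succ]; fun_prop

@[fun_prop]
theorem PF.isZero {f : χ → ℕ} (hf : PF f) : PF fun x => decide (f x = 0) := by
  refine PF.comp (g := fun n => decide (n = 0)) ?_ hf
  have h1 : PF fun n : ℕ => (List.replicate n Data.nil, Data.nil) := by fun_prop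
  have h2 : PF fun n : ℕ => ((List.replicate n true).headD false : Bool) := by
    refine PF.headD ?_ (by fun_prop)
    have : PF fun n : ℕ => (List.replicate n Data.nil).map fun _ => true := by fun_prop
    simpa using this
  have h3 : PF fun n : ℕ => bif (List.replicate n true).headD false then false else true := by
    fun_prop
  convert h3 using 2 with n
  cases n <;> simp [List.replicate_succ]

@[fun_prop]
theorem PF.le {f g : χ → ℕ} (hf : PF f) (hg : PF g) : PF fun x => decide (f x ≤ g x) := by
  have : PF fun x => decide (f x - g x = 0) := by fun_prop
  simpa only [Nat.sub_eq_zero_iff_le] using this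

@[fun_prop]
theorem PF.lt {f g : χ → ℕ} (hf : PF f) (hg : PF g) : PF fun x => decide (f x < g x) := by
  have : PF fun x => decide (f x + 1 ≤ g x) := by fun_prop
  exact this

@[fun_prop]
theorem PF.and {f g : χ → Prop} [DecidablePred f] [DecidablePred g] (hf : PF fun x => decide (f x))
    (hg : PF fun x => decide (g x)) : PF fun x => decide (f x ∧ g x) := by
  have : PF fun x => bif decide (f x) then decide (g x) else false := by fun_prop
  convert this using 2 with x
  by_cases f x <;> simp [*]

@[fun_prop]
theorem PF.range {f : χ → ℕ} (hf : PF f) : PF fun x => List.range (f x) := by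
  have h (n : ℕ) : (fun s : List ℕ => s.length :: s)^[n] [] = (List.range n).reverse := by
    induction n with
    | zero => rfl
    | succ n ih => rw [Function.iterate_succ_apply', ih, List.range_succ]; simp
  have : PF fun x => (fun s : List ℕ => s.length :: s)^[f x] [] :=
    PF.iterate (f := fun _ s => s.length :: s) hf (PF.const []) (by fun_prop)
      (fun x => f x * (2 * f x + 1 + 1) + 1)
      ((hf.pb_nat.mul ((((PB.const 2).mul hf.pb_nat).add (PB.const 1)).add (PB.const 1))).add
        (PB.const 1)) fun x i hi => by
        rw [h]
        refine esize_list_le (by simpa using hi) fun a ha => ?_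
        simp only [List.mem_reverse, List.mem_range] at ha
        rw [esize_nat]; omega
  have := this.reverse
  simpa only [h, List.reverse_reverse] using this

@[fun_prop]
theorem PF.drop {f : χ → List β} {n : χ → ℕ} (hf : PF f) (hn : PF n) :
    PF fun x => (f x).drop (n x) := by
  have h (n : ℕ) (l : List β) : List.tail^[n] l = l.drop n := by
    induction n generalizing l with
    | zero => rfl
    | succ n ih => rw [Function.iterate_succ_apply, ih, List.drop_tail]
  have := PF.iterate (f := fun _ s => List.tail s) hn hf (by fun_prop)
    (fun x => esize (f x)) hf.pb fun x i hi => by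
      rw [h]
      have := esize_append ((f x).take i) ((f x).drop i)
      rw [List.take_append_drop] at this
      have := esize_pos ((f x).take i)
      omega
  simpa only [h] using this

@[fun_prop]
theorem PF.getD {f : χ → List β} {n : χ → ℕ} {d : χ → β} (hf : PF f) (hn : PF n) (hd : PF d) :
    PF fun x => (f x).getD (n x) (d x) := by
  have h : PF fun x => ((f x).drop (n x)).headD (d x) := by fun_prop
  convert h using 2 with x
  simp [List.headD_eq_head?_getD, List.head?_drop, List.getD_eq_getElem?_getD]

@[fun_prop]
theorem PF.replicate {n : χ → ℕ} {b : χ → β} (hn : PF n) (hb : PF b) :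
    PF fun x => List.replicate (n x) (b x) := by
  have : PF fun x => (List.range (n x)).map fun _ => b x := by fun_prop
  simpa using this

@[fun_prop]
theorem PF.flatMap {l : χ → List β} {f : χ → β → List γ} (hl : PF l)
    (hf : PF fun p : χ × β => f p.1 p.2) : PF fun x => (l x).flatMap (f x) := by
  obtain ⟨c, hc⟩ := hf.pb
  have : PF fun x => (l x).foldl (fun s b => s ++ f x b) [] := by
    refine PF.foldl_of_add (f := fun x s b => s ++ f x b) hl (by fun_prop) ?_
      (fun x => (esize x + esize (l x) + 1 + 1) ^ c)
      ((((PB.esize_self.add hl.pb).add (PB.const 1)).add (PB.const 1)).pow c)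
      fun x s b hb => ?_
    · exact PF.append (by fun_prop) (PF.comp (g := fun p : χ × β => f p.1 p.2)
        (f := fun p : χ × List γ × β => (p.1, p.2.2)) hf (by fun_prop))
    · have h0 := esize_append s (f x b)
      have h1 := hc (x, b) trivial
      have h2 := esize_le_of_mem hb
      have h3 := Nat.pow_le_pow_left (show esize (x, b) + 1 ≤ esize x + esize (l x) + 1 + 1 by
        rw [esize_pair]; omega) c
      simp only at h1
      omega
  convert this using 2 with x
  rw [List.flatMap_eq_foldl]

/-- The greatest `t ≤ b x` with a decidable property. -/
theorem PF.findGreatest {b : χ → ℕ} {P : χ → ℕ → Prop} [∀ x, DecidablePred (P x)] (hb : PF b)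
    (hP : PF fun p : χ × ℕ => decide (P p.1 p.2)) : PF fun x => Nat.findGreatest (P x) (b x) := by
  have h : ∀ x n, (List.range n).foldl (fun s i => if P x (i + 1) then i + 1 else s) 0 =
      Nat.findGreatest (P x) n := by
    intro x n
    induction n with
    | zero => rfl
    | succ n ih => rw [List.range_succ, List.foldl_append, ih]; simp [Nat.findGreatest]
  have : PF fun x => (List.range (b x)).foldl (fun s i => if P x (i + 1) then i + 1 else s) 0 := by
    refine PF.foldl (f := fun x s i => if P x (i + 1) then i + 1 else s) (by fun_prop) (by fun_prop)
      (PF.ite (PF.comp (g := fun p : χ × ℕ => decide (P p.1 p.2))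
        (f := fun p : χ × ℕ × ℕ => (p.1, p.2.2 + 1)) hP (by fun_prop)) (by fun_prop) (by fun_prop))
      (fun x _ s => s ≤ b x) (fun x => Nat.zero_le _) (fun x i s a ha _ hs => ?_)
      (fun x => 2 * b x + 1) (((PB.const 2).mul hb.pb_nat).add (PB.const 1))
      fun x i s _ hs => by rw [esize_nat]; omega
    have := List.mem_range.1 ha
    split_ifs <;> omega
  simpa only [h] using this

theorem Nat.div_eq_findGreatest (a b : ℕ) :
    (if b = 0 then 0 else Nat.findGreatest (fun t => t * b ≤ a) a) = a / b := by
  split_ifs with h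
  · simp [h]
  · rw [Nat.findGreatest_eq_iff]
    have hb : 0 < b := Nat.pos_of_ne_zero h
    refine ⟨Nat.div_le_self _ _, fun _ => Nat.div_mul_le_self _ _, fun n hn _ h2 => ?_⟩
    exact absurd ((Nat.le_div_iff_mul_le hb).2 h2) (by omega)

@[fun_prop]
theorem PF.div {f g : χ → ℕ} (hf : PF f) (hg : PF g) : PF fun x => f x / g x := by
  have : PF fun x => if g x = 0 then 0 else Nat.findGreatest (fun t => t * g x ≤ f x) (f x) :=
    PF.ite (by fun_prop) (by fun_prop) (PF.findGreatest hf (by fun_prop))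
  simpa only [Nat.div_eq_findGreatest] using this

/-! ### Random functions -/

/-- A uniformly random element of `{0, …, m - 1}`. -/
noncomputable def randNat : ℕ → PMF ℕ
  | 0 => PMF.pure 0
  | m + 1 => (PMF.uniformOfFintype (Fin (m + 1))).map Fin.val

theorem Poly.randNat : Poly randNat := by
  refine Poly.of_runs PB.esize_self Prog.rand fun n => ?_
  refine Runs.weaken (t := esize n) (?_ : Runs _ _ _ (enc n).size) le_rfl
  convert Runs.rand (enc n) using 1
  cases n with
  | zero => simp [Trapdoor.randNat, PMF.pure_map, enc_zero, randDist]
  | succ n =>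
    rw [enc_succ, randDist_cons]
    change _ = ((PMF.uniformOfFintype (Fin ((Data.ofNat n).length + 1))).map Fin.val).map Data.ofNat
    rw [Data.length_ofNat]
    rfl

/-- Independent random steps for the elements of a list. -/
noncomputable def mapP {α β : Type*} (f : α → PMF β) : List α → PMF (List β)
  | [] => PMF.pure []
  | a :: l => (f a).bind fun b => (mapP f l).map fun l' => b :: l'

theorem foldP_append_eq_mapP {α β : Type*} (f : α → PMF β) (l : List α) (s : List β) :
    foldP (fun s a => (f a).map fun b => b :: s) s l =
      (mapP f l).map fun l' => l'.reverse ++ s := by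
  induction l generalizing s with
  | nil => simp [foldP, mapP, PMF.pure_map]
  | cons a l ih =>
    rw [foldP, mapP, PMF.bind_map, PMF.map_bind]
    congr 1
    funext b
    simp only [Function.comp_apply, ih, PMF.map_comp]
    congr 1
    funext l'
    simp

theorem Poly.mapP {l : χ → List β} {f : χ → β → PMF γ} (hl : PF l)
    (hf : Poly fun p : χ × β => f p.1 p.2) : Poly fun x => mapP (f x) (l x) := by
  obtain ⟨g, ⟨c, hc⟩, hg⟩ := hf.esize_bound
  have : Poly fun x => foldP (fun s b => (f x b).map fun y => y :: s) [] (l x) := by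
    have hD : PB fun x => (esize x + esize (l x) + 1 + 1) ^ c + 1 :=
      (((PB.esize_self.add hl.pb).add (PB.const 1)).add (PB.const 1)).pow c |>.add (PB.const 1)
    refine Poly.fold (f := fun x s b => (f x b).map fun y => y :: s) hl (by fun_prop)
      (Poly.map (Poly.compF (g := fun p : χ × β => f p.1 p.2)
        (f := fun p : χ × List γ × β => (p.1, p.2.2)) hf (by fun_prop)) (by fun_prop))
      (fun x i s => esize s ≤ i * ((esize x + esize (l x) + 1 + 1) ^ c + 1) + 1)
      (fun x => by simp [esize_nil]) ?_
      (fun x => (l x).length * ((esize x + esize (l x) + 1 + 1) ^ c + 1) + 1)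
      ((hl.pb_length.mul hD).add (PB.const 1))
      fun x i s hi hs => hs.trans (Nat.succ_le_succ (Nat.mul_le_mul_right _ hi))
    intro x i s b hb _ hi s' hs'
    obtain ⟨y, hy, rfl⟩ := (PMF.mem_support_map_iff _ _ _).1 hs'
    rw [esize_cons]
    have h1 := (hg (x, b) y hy).trans (hc (x, b) trivial)
    have h2 := esize_le_of_mem hb
    have h3 := Nat.pow_le_pow_left (show esize (x, b) + 1 ≤ esize x + esize (l x) + 1 + 1 by
      rw [esize_pair]; omega) c
    simp only at h1
    rw [Nat.succ_mul]
    omega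
  have := Poly.map (g := fun _ s => s.reverse) this (by fun_prop)
  simp only [foldP_append_eq_mapP, PMF.map_comp, Function.comp_def, List.append_nil,
    List.reverse_reverse] at this
  simpa only [← Function.id_def, PMF.map_id] using this

/-- Independent samples. -/
noncomputable def iid {α : Type*} (n : ℕ) (μ : PMF α) : PMF (List α) :=
  mapP (fun _ => μ) (List.range n)

theorem Poly.iid {n : χ → ℕ} {f : χ → PMF β} (hn : PF n) (hf : Poly f) :
    Poly fun x => iid (n x) (f x) :=
  Poly.mapP (f := fun x _ => f x) (by fun_prop)
    (Poly.compF (f := fun p : χ × ℕ => p.1) hf (by fun_prop))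

end Functions
end Trapdoor

namespace Trapdoor
open Enc (enc)

/-! ### Logarithms, powers of two and random rearrangements -/

section Arithmetic

variable {α β γ χ : Type*} [Enc α] [Enc β] [Enc γ] [Enc χ]

@[fun_prop]
theorem PF.take {f : χ → List β} {n : χ → ℕ} (hf : PF f) (hn : PF n) :
    PF fun x => (f x).take (n x) := by
  have : PF fun x => ((f x).reverse.drop ((f x).length - n x)).reverse := by fun_prop
  convert this using 2 with x
  rw [List.drop_reverse, List.reverse_reverse]
  rcases le_total (n x) (f x).length with h | h
  · rw [Nat.sub_sub_self h]
  · rw [Nat.sub_eq_zero_of_le h, Nat.sub_zero, List.take_of_length_le h, List.take_length]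

/-- Doubling stalls as soon as the next power would exceed `x`. The state therefore never gets
larger than `x`, although the number of iterations is not tuned to the logarithm. -/
theorem iterate_log (x i : ℕ) :
    (fun s : ℕ × ℕ => if 2 * s.2 ≤ x then (s.1 + 1, 2 * s.2) else s)^[i] (0, 1) =
      (min i (Nat.log 2 x), 2 ^ min i (Nat.log 2 x)) := by
  induction i with
  | zero => simp
  | succ i ih =>
    rw [Function.iterate_succ_apply', ih]
    simp only [← pow_succ']
    rcases Nat.eq_zero_or_pos x with rfl | hx
    · simp
    rcases Nat.lt_or_ge i (Nat.log 2 x) with h | h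
    · rw [min_eq_left h.le, min_eq_left (Nat.succ_le_of_lt h), if_pos]
      exact (Nat.le_log_iff_pow_le (by norm_num) hx.ne').1 h
    · rw [min_eq_right h, min_eq_right (h.trans (Nat.le_succ _)), if_neg]
      rw [← Nat.le_log_iff_pow_le (by norm_num) hx.ne']
      omega

theorem PF.log_pow {f : χ → ℕ} (hf : PF f) :
    PF fun x => (Nat.log 2 (f x), 2 ^ Nat.log 2 (f x)) := by
  have := PF.iterate (f := fun x (s : ℕ × ℕ) => if 2 * s.2 ≤ f x then (s.1 + 1, 2 * s.2) else s)
    hf (PF.const (0, 1))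
    (PF.ite (PF.le (by fun_prop) (PF.comp hf (by fun_prop))) (by fun_prop) (by fun_prop))
    (fun x => 4 * f x + 20) (((PB.const 4).mul hf.pb_nat).add (PB.const 20)) fun x i hi => by
      rw [iterate_log, esize_pair, esize_nat, esize_nat]
      have h1 := Nat.log_le_self 2 (f x)
      rcases Nat.eq_zero_or_pos (f x) with h | h
      · simp [h]
      have h2 := (Nat.pow_le_pow_right (n := 2) (by norm_num)
        (min_le_right i (Nat.log 2 (f x)))).trans (Nat.pow_log_le_self 2 h.ne')
      have h3 := min_le_right i (Nat.log 2 (f x))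
      omega
  simp only [iterate_log] at this
  -- `f x` iterations are enough because the logarithm is at most its argument.
  simpa only [min_eq_right (Nat.log_le_self 2 _)] using this

@[fun_prop]
theorem PF.log {f : χ → ℕ} (hf : PF f) : PF fun x => Nat.log 2 (f x) := hf.log_pow.fst

@[fun_prop]
theorem PF.pow_log {f : χ → ℕ} (hf : PF f) : PF fun x => 2 ^ Nat.log 2 (f x) := hf.log_pow.snd

/-- A power of two between `k / 4` and `k / 2`. -/
def halfPow (k : ℕ) : ℕ := 2 ^ (Nat.log 2 k - 1)

@[fun_prop]
theorem PF.halfPow {f : χ → ℕ} (hf : PF f) : PF fun x => halfPow (f x) := by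
  have : PF fun x => if Nat.log 2 (f x) = 0 then 1 else 2 ^ Nat.log 2 (f x) / 2 := by fun_prop
  convert this using 2 with x
  unfold Trapdoor.halfPow
  split_ifs with h
  · simp [h]
  · obtain ⟨m, hm⟩ := Nat.exists_eq_succ_of_ne_zero h
    rw [hm, pow_succ]; simp

/-- Insertion at a uniformly random position. -/
noncomputable def insertRand {α : Type*} (s : List α) (a : α) : PMF (List α) :=
  (randNat (s.length + 1)).map fun i => s.take i ++ a :: s.drop i

/-- A uniformly random rearrangement of a list. -/
noncomputable def shuffle {α : Type*} (l : List α) : PMF (List α) := foldP insertRand [] l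

theorem Poly.shuffle {f : χ → List β} (hf : PF f) : Poly fun x => shuffle (f x) := by
  refine Poly.fold (f := fun _ s a => insertRand s a) hf (by fun_prop)
    (Poly.map (Poly.compF Poly.randNat (by fun_prop)) (by fun_prop))
    (fun x i s => esize s ≤ i * (esize (f x) + 1) + 1) (fun x => by simp [esize_nil]) ?_
    (fun x => (f x).length * (esize (f x) + 1) + 1)
    ((hf.pb_length.mul (hf.pb.add (PB.const 1))).add (PB.const 1))
    fun x i s hi hs => hs.trans (Nat.succ_le_succ (Nat.mul_le_mul_right _ hi))
  intro x i s b hb _ hi s' hs'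
  obtain ⟨j, -, rfl⟩ := (PMF.mem_support_map_iff _ _ _).1 hs'
  have h1 := esize_append (s.take j) (b :: s.drop j)
  have h2 := esize_append (s.take j) (s.drop j)
  rw [List.take_append_drop] at h2
  have h3 := esize_le_of_mem hb
  rw [esize_cons] at h1
  rw [Nat.succ_mul]
  omega

end Arithmetic

/-! ### Field elements and gates -/

section FieldElements

variable {F : Type*} [Field F] [Finite F] {β χ : Type*} [Enc β] [Enc χ]

noncomputable instance instEncField {F : Type*} [Field F] [Finite F] : Enc F :=
  ⟨encElem, Data.ofNat_injective.comp (Fin.val_injective.comp (Finite.equivFin F).injective)⟩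

noncomputable instance instEncGate {F : Type*} [Field F] [Finite F] : Enc (Gate F) :=
  ⟨encGate, fun a b h => by
    have he : ∀ a b : F, encElem a = encElem b → a = b := fun a b h => Enc.inj (α := F) h
    have hn : ∀ a b : ℕ, Data.ofNat a = Data.ofNat b → a = b := fun a b h => Data.ofNat_injective h
    cases a <;> cases b <;> simp only [encGate, Data.cons.injEq] at h
    · rw [he _ _ h.2]
    · exact absurd (hn _ _ h.1) (by norm_num)
    · exact absurd (hn _ _ h.1) (by norm_num)
    · exact absurd (hn _ _ h.1) (by norm_num)
    · rw [hn _ _ h.2.1, hn _ _ h.2.2]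
    · exact absurd (hn _ _ h.1) (by norm_num)
    · exact absurd (hn _ _ h.1) (by norm_num)
    · exact absurd (hn _ _ h.1) (by norm_num)
    · rw [hn _ _ h.2.1, hn _ _ h.2.2]⟩

theorem esize_field_le (a : F) : esize a ≤ 2 * Nat.card F + 1 := by
  have : esize a = esize ((Finite.equivFin F a : Fin _) : ℕ) := rfl
  rw [this, esize_nat]
  have := (Finite.equivFin F a).2
  omega

theorem PF.index {f : χ → F} (hf : PF f) : PF fun x => ((Finite.equivFin F (f x) : Fin _) : ℕ) :=
  hf.of_enc_eq fun _ => rfl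

/-- The field is finite and fixed, so every function on it is a constant table indexed by the
enumeration. -/
theorem PF.of_field {g : χ → F} (hg : PF g) (f : F → β) : PF fun x => f (g x) := by
  have : PF fun x => (List.ofFn fun i => f ((Finite.equivFin F).symm i)).getD
      ((Finite.equivFin F (g x) : Fin _) : ℕ) (f 0) :=
    PF.getD (PF.const _) hg.index (PF.const _)
  convert this using 2 with x
  rw [List.getD_eq_getElem _ _ (by simp)]
  simp

theorem PF.of_field₂ {g h : χ → F} (hg : PF g) (hh : PF h) (f : F → F → β) :
    PF fun x => f (g x) (h x) := by
  have : PF fun x => ((List.ofFn fun i => f (g x) ((Finite.equivFin F).symm i))).getD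
      ((Finite.equivFin F (h x) : Fin _) : ℕ) (f (g x) 0) :=
    PF.getD (hg.of_field fun a => List.ofFn fun i => f a ((Finite.equivFin F).symm i)) hh.index
      (hg.of_field fun a => f a 0)
  convert this using 2 with x
  rw [List.getD_eq_getElem _ _ (by simp)]
  simp

@[fun_prop]
theorem PF.field_mul {g h : χ → F} (hg : PF g) (hh : PF h) : PF fun x => g x * h x :=
  hg.of_field₂ hh (· * ·)

@[fun_prop]
theorem PF.field_add {g h : χ → F} (hg : PF g) (hh : PF h) : PF fun x => g x + h x :=
  hg.of_field₂ hh (· + ·)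

@[fun_prop]
theorem PF.field_sum {l : χ → List F} (hl : PF l) : PF fun x => (l x).sum := by
  have : PF fun x => (l x).foldl (fun s a => s + a) 0 :=
    PF.foldl (f := fun _ s a => s + a) hl (PF.const 0) (by fun_prop) (fun _ _ _ => True)
      (fun _ => trivial) (fun _ _ _ _ _ _ _ => trivial) _ (PB.const (2 * Nat.card F + 1))
      fun _ _ _ _ _ => esize_field_le _
  simpa only [List.sum_eq_foldl] using this

theorem uniform_apply {α : Type*} [Finite α] [Nonempty α] (a : α) :
    uniform α a = (Nat.card α : ENNReal)⁻¹ := by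
  simp only [uniform, PMF.uniformOfFintype_apply]
  rw [@Nat.card_eq_fintype_card _ (Fintype.ofFinite α)]

theorem uniform_map_equiv {α β : Type*} [Finite α] [Nonempty α] [Finite β] [Nonempty β]
    (e : α ≃ β) : (uniform α).map e = uniform β := by
  ext b
  rw [PMF.map_apply, uniform_apply, tsum_eq_single (e.symm b)]
  · rw [uniform_apply, Nat.card_congr e]; simp
  · intro a ha
    rw [if_neg]
    rintro rfl
    simp at ha

theorem randNat_eq_uniform (n : ℕ) : randNat (n + 1) = (uniform (Fin (n + 1))).map Fin.val := by
  change (PMF.uniformOfFintype (Fin (n + 1))).map Fin.val = _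
  congr 1
  ext a
  rw [uniform_apply]
  simp

/-- A field element is encoded by its index, so the program that draws a uniform index already draws
a uniform field element. -/
theorem Poly.uniform_field : Poly fun _ : χ => uniform F := by
  have hc : Nat.card F ≠ 0 := Nat.card_pos.ne'
  have : Poly fun _ : χ => Trapdoor.randNat (Nat.card F) := Poly.compF Poly.randNat (PF.const _)
  obtain ⟨h1, p, c, hp⟩ := this
  refine ⟨h1, p, c, fun x hx => ?_⟩
  have h := hp x hx
  unfold TRuns at h ⊢
  convert h using 1
  obtain ⟨n, hn⟩ := Nat.exists_eq_succ_of_ne_zero hc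
  have e : F ≃ Fin (n + 1) := (Finite.equivFin F).trans (finCongr hn)
  have he : (enc : F → Data) = (enc : ℕ → Data) ∘ Fin.val ∘
    ((Finite.equivFin F).trans (finCongr hn)) := rfl
  rw [he, ← PMF.map_comp, ← PMF.map_comp, uniform_map_equiv, hn, ← randNat_eq_uniform]

/-! ### Gates -/

/-- Redirect the inputs of a gate. -/
def rewire (W : List ℕ) (z : ℕ) : Gate F → Gate F
  | Gate.const a => Gate.const a
  | Gate.add i j => Gate.add (W.getD i z) (W.getD j z)
  | Gate.mul i j => Gate.mul (W.getD i z) (W.getD j z)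

@[fun_prop]
theorem PF.gateConst {f : χ → F} (hf : PF f) : PF fun x => Gate.const (f x) :=
  ((PF.const (0 : ℕ)).prodMk hf).of_enc_eq fun _ => rfl

@[fun_prop]
theorem PF.gateAdd {f g : χ → ℕ} (hf : PF f) (hg : PF g) :
    PF fun x => (Gate.add (f x) (g x) : Gate F) :=
  ((PF.const (1 : ℕ)).prodMk (hf.prodMk hg)).of_enc_eq fun _ => rfl

@[fun_prop]
theorem PF.gateMul {f g : χ → ℕ} (hf : PF f) (hg : PF g) :
    PF fun x => (Gate.mul (f x) (g x) : Gate F) :=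
  ((PF.const (2 : ℕ)).prodMk (hf.prodMk hg)).of_enc_eq fun _ => rfl

/-- The number of the kind of a gate and its operands. -/
noncomputable def gateParts : Gate F → ℕ × ℕ × ℕ
  | Gate.const a => (0, 0, (Finite.equivFin F a : ℕ) - 1)
  | Gate.add i j => (1, i, j)
  | Gate.mul i j => (2, i, j)

@[fun_prop]
theorem PF.data_fst {f : χ → Data} (hf : PF f) : PF fun x => (f x).fst :=
  PF.comp (Poly.of_data Prog.fst _ PB.esize_self fun _ => Runs.fst _) hf

@[fun_prop]
theorem PF.data_snd {f : χ → Data} (hf : PF f) : PF fun x => (f x).snd :=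
  PF.comp (Poly.of_data Prog.snd _ PB.esize_self fun _ => Runs.snd _) hf

@[fun_prop]
theorem PF.enc {f : χ → β} (hf : PF f) : PF fun x => enc (f x) :=
  hf.of_enc_eq fun _ => rfl

theorem PF.gateParts {f : χ → Gate F} (hf : PF f) : PF fun x => gateParts (f x) := by
  have : PF fun x => ((Enc.enc (f x)).fst, (Enc.enc (f x)).snd.fst, (Enc.enc (f x)).snd.snd) := by
    fun_prop
  refine this.of_enc_eq fun x => ?_
  cases h : f x with
  | const a =>
    -- Read as a pair, the unary numeral `i` is `(0, i - 1)`. This explains the truncated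
    -- predecessor in `gateParts`; `rewire` leaves constant gates alone and never needs it.
    have : Enc.enc (Gate.const a) = Data.cons Data.nil (Enc.enc (Finite.equivFin F a : ℕ)) := rfl
    rw [this]
    simp only [Trapdoor.gateParts]
    rcases Nat.eq_zero_or_pos (Finite.equivFin F a : ℕ) with h | h
    · rw [h]; rfl
    · obtain ⟨m, hm⟩ := Nat.exists_eq_succ_of_ne_zero h.ne'
      rw [hm]; rfl
  | add i j => rfl
  | mul i j => rfl

@[fun_prop]
theorem PF.rewire {W : χ → List ℕ} {z : χ → ℕ} {g : χ → Gate F} (hW : PF W) (hz : PF z)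
    (hg : PF g) : PF fun x => rewire (W x) (z x) (g x) := by
  have hp := hg.gateParts
  have : PF fun x => bif decide ((Trapdoor.gateParts (g x)).1 = 0) then Enc.enc (g x) else
      Enc.enc ((Trapdoor.gateParts (g x)).1, (W x).getD (Trapdoor.gateParts (g x)).2.1 (z x),
        (W x).getD (Trapdoor.gateParts (g x)).2.2 (z x)) := by
    fun_prop
  refine this.of_enc_eq fun x => ?_
  cases g x <;> rfl

end FieldElements

/-! ### Code families in list form -/

section Codes

variable {F : Type*} [Field F] [Finite F] {χ : Type*} [Enc χ]

/-- The rows of a matrix. -/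
def rowsOf {m n : ℕ} (M : Matrix (Fin m) (Fin n) F) : List (List F) :=
  List.ofFn fun i => List.ofFn fun j => M i j

theorem enc_rowsOf {m n : ℕ} (M : Matrix (Fin m) (Fin n) F) : enc (rowsOf M) = encMatrix M := by
  unfold rowsOf encMatrix
  change Data.ofList _ = _
  rw [List.map_ofFn]
  congr 2
  funext i
  change Data.ofList _ = _
  rw [List.map_ofFn]
  rfl

/-- The gates and the outputs of a circuit. -/
abbrev Code (F : Type*) : Type _ := List (Gate F) × List ℕ

/-- The gates and the outputs of a circuit. -/
def codeOf {m n : ℕ} (C : Circuit F m n) : Code F := (C.gates, List.ofFn C.outputs)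

theorem enc_codeOf {m n : ℕ} (C : Circuit F m n) : enc (codeOf C) = encCircuit C := by
  unfold codeOf encCircuit
  rw [enc_pair]
  congr 1
  change Data.ofList _ = _
  rw [List.map_ofFn]
  rfl

/-- A generator matrix and its encoding circuit in list form. -/
noncomputable def CodeFamily.sample (K : CodeFamily F) (m : ℕ) : PMF (List (List F) × Code F) :=
  (K.gen.dist m).map fun MC => (rowsOf MC.1, codeOf MC.2)

theorem CodeFamily.poly_sample (K : CodeFamily F) : Poly K.sample := by
  obtain ⟨p, a, h⟩ := K.gen.samplable
  have hb : PB fun n : ℕ => n ^ a + a := (PF.id.pb_nat.pow a).add (PB.const a)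
  refine Poly.of_runs hb p fun n => ?_
  have := h n
  unfold TRuns CodeFamily.sample
  rw [PMF.map_comp]
  have he : (enc ∘ fun MC : Matrix (Fin n) (Fin (K.dim n)) F × Circuit F (K.dim n) n =>
      (rowsOf MC.1, codeOf MC.2)) = fun MC => Data.cons (encMatrix MC.1) (encCircuit MC.2) := by
    funext MC
    simp only [Function.comp_apply, enc_pair, enc_rowsOf, enc_codeOf]
  rw [he]
  exact this

/-- Full rank excludes a positive dimension in length zero. The case matters because the dimension
will be read off the first row, and here there is none. -/
theorem CodeFamily.dim_zero (K : CodeFamily F) : K.dim 0 = 0 := by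
  obtain ⟨MC, h⟩ := (K.gen.dist 0).support_nonempty
  have hi := K.fullRank 0 MC h
  by_contra hd
  have : NeZero (K.dim 0) := ⟨hd⟩
  have h1 : (fun _ => 0 : Fin (K.dim 0) → F) = fun _ => 1 :=
    hi (Subsingleton.elim _ _)
  exact zero_ne_one (congrFun h1 0)

-- The dimension function is computable because the sampler of the family outputs a matrix whose
-- rows have that length, whatever its random choices.
@[fun_prop]
theorem CodeFamily.pf_dim (K : CodeFamily F) {f : χ → ℕ} (hf : PF f) : PF fun x => K.dim (f x) := by
  refine PF.comp (g := K.dim) ?_ hf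
  have : Poly fun m => (K.sample m).map fun g => (g.1.headD []).length :=
    Poly.map K.poly_sample (by fun_prop)
  unfold PF
  convert this using 2 with m
  unfold CodeFamily.sample
  rw [PMF.map_comp]
  have : ((fun g : List (List F) × Code F => (g.1.headD []).length) ∘
      fun MC : Matrix (Fin m) (Fin (K.dim m)) F × Circuit F (K.dim m) m =>
        (rowsOf MC.1, codeOf MC.2)) = Function.const _ (K.dim m) := by
    funext MC
    cases m with
    | zero => simp [rowsOf, K.dim_zero]
    | succ m => simp [rowsOf, List.ofFn_succ]
  rw [this, PMF.map_const]

end Codes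
end Trapdoor

namespace Trapdoor
open Enc (enc)

/-! ### The sampler and its running time -/

section Sampler

variable {F : Type*} [Field F] [Finite F] {χ : Type*} [Enc χ]

/-- Sum of the products of the entries of two lists. -/
def dot (r c : List F) : F := ((List.range r.length).map fun i => r.getD i 0 * c.getD i 0).sum

@[fun_prop]
theorem PF.dot {f g : χ → List F} (hf : PF f) (hg : PF g) : PF fun x => dot (f x) (g x) := by
  unfold Trapdoor.dot
  refine PF.field_sum (PF.map (PF.range (PF.length hf)) ?_)
  have h1 : PF fun p : χ × ℕ => f p.1 := PF.comp hf (by fun_prop)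
  have h2 : PF fun p : χ × ℕ => g p.1 := PF.comp hg (by fun_prop)
  fun_prop

/-- The rows of a matrix, each with an output wire. -/
def pairUp (rows : List (List F)) (outs : List ℕ) : List (List F × ℕ) :=
  (List.range rows.length).map fun i => (rows.getD i [], outs.getD i 0)

@[fun_prop]
theorem PF.pairUp {f : χ → List (List F)} {g : χ → List ℕ} (hf : PF f) (hg : PF g) :
    PF fun x => pairUp (f x) (g x) := by
  unfold Trapdoor.pairUp
  refine PF.map (PF.range (PF.length hf)) ?_
  have h1 : PF fun p : χ × ℕ => f p.1 := PF.comp hf (by fun_prop)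
  have h2 : PF fun p : χ × ℕ => g p.1 := PF.comp hg (by fun_prop)
  fun_prop

/-- Multiply columns by a randomly permuted generator matrix of length `m`; the code is the
permuted encoding circuit. -/
noncomputable def encodeBlock (K : CodeFamily F) (m : ℕ) (cols : List (List F)) :
    PMF (List (List F) × Code F) :=
  (K.sample m).bind fun g => (shuffle (pairUp g.1 g.2.2)).map fun z =>
    (cols.map fun c => z.map fun r => dot r.1 c, (g.2.1, z.map Prod.snd))

theorem Poly.encodeBlock (K : CodeFamily F) :
    Poly fun p : ℕ × List (List F) => encodeBlock K p.1 p.2 := by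
  unfold Trapdoor.encodeBlock
  refine Poly.bind (Poly.compF K.poly_sample (by fun_prop)) ?_
  refine Poly.map (Poly.shuffle (by fun_prop)) ?_
  refine PF.prodMk (PF.map (by fun_prop) (PF.map (by fun_prop) ?_)) (by fun_prop)
  exact PF.dot (by fun_prop) (by fun_prop)

/-- The `i`-th group of `w` elements of a list of columns. -/
def chunk (w : ℕ) (cols : List (List F)) (i : ℕ) : List (List F) :=
  (List.range w).map fun j => cols.getD (i * w + j) []

/-- Encode `q` groups of `w` columns. -/
noncomputable def encodeBlocks (K : CodeFamily F) (m w q : ℕ) (cols : List (List F)) :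
    PMF (List (List (List F) × Code F)) :=
  mapP (fun i => encodeBlock K m (chunk w cols i)) (List.range q)

theorem Poly.encodeBlocks (K : CodeFamily F) {m w q : χ → ℕ} {cols : χ → List (List F)}
    (hm : PF m) (hw : PF w) (hq : PF q) (hc : PF cols) :
    Poly fun x => encodeBlocks K (m x) (w x) (q x) (cols x) := by
  unfold Trapdoor.encodeBlocks
  refine Poly.mapP (f := fun x i => Trapdoor.encodeBlock K (m x) (chunk (w x) (cols x) i))
    (PF.range hq) ?_
  refine Poly.compF (f := fun p : χ × ℕ => (m p.1, chunk (w p.1) (cols p.1) p.2))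
    (Poly.encodeBlock K) (PF.prodMk (PF.comp hm (by fun_prop)) ?_)
  unfold chunk
  refine PF.map (PF.range (PF.comp hw (by fun_prop))) ?_
  have h1 : PF fun p : (χ × ℕ) × ℕ => w p.1.1 := PF.comp hw (by fun_prop)
  have h2 : PF fun p : (χ × ℕ) × ℕ => cols p.1.1 := PF.comp hc (by fun_prop)
  fun_prop

/-- Instructions for the circuit builder: add two blocks, or encode a block. -/
abbrev Instr (F : Type*) : Type _ := Bool × Code F

/-- One level of the sampler, which passes to matrices with `m` rows.  The state consists of the
columns, the instructions issued so far and the number of blocks. -/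
noncomputable def level (K : CodeFamily F) (N : ℕ) (st : List (List F) × List (Instr F) × ℕ)
    (m : ℕ) : PMF (List (List F) × List (Instr F) × ℕ) :=
  (encodeBlocks K m (halfPow (K.dim m)) (N / halfPow (K.dim m)) st.1).map fun res =>
    (res.flatMap Prod.fst,
      st.2.1 ++ (List.replicate (st.2.2 - N / halfPow (K.dim m)) (true, [], []) ++
        res.map fun x => (false, x.2)),
      N / halfPow (K.dim m))

theorem Poly.level (K : CodeFamily F) :
    Poly fun p : ℕ × (List (List F) × List (Instr F) × ℕ) × ℕ => level K p.1 p.2.1 p.2.2 := by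
  unfold Trapdoor.level
  refine Poly.map (Poly.encodeBlocks K (by fun_prop) (by fun_prop) (by fun_prop) (by fun_prop)) ?_
  fun_prop

theorem mem_support_mapP {α β : Type*} {f : α → PMF β} {l : List α} {r : List β} :
    r ∈ (mapP f l).support ↔ List.Forall₂ (fun a b => b ∈ (f a).support) l r := by
  induction l generalizing r with
  | nil => simp [mapP]
  | cons a l ih =>
    simp only [mapP, PMF.mem_support_bind_iff, PMF.mem_support_map_iff, ih,
      List.forall₂_cons_left_iff]
    constructor
    · rintro ⟨b, hb, r', hr', rfl⟩
      exact ⟨b, r', hb, hr', rfl⟩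
    · rintro ⟨b, r', hb, hr', rfl⟩
      exact ⟨b, hb, r', hr', rfl⟩

theorem length_of_mem_mapP {α β : Type*} {f : α → PMF β} {l : List α} {r : List β}
    (h : r ∈ (mapP f l).support) : r.length = l.length :=
  (mem_support_mapP.1 h).length_eq.symm

theorem exists_of_mem_mapP {α β : Type*} {f : α → PMF β} {l : List α} {r : List β}
    (h : r ∈ (mapP f l).support) {b : β} (hb : b ∈ r) : ∃ a ∈ l, b ∈ (f a).support := by
  have h := mem_support_mapP.1 h
  induction h with
  | nil => simp at hb
  | cons h1 _ ih =>
    rcases List.mem_cons.1 hb with rfl | hb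
    · exact ⟨_, by simp, h1⟩
    · obtain ⟨a, ha, h⟩ := ih (mem_support_mapP.2 ‹_›) hb
      exact ⟨a, by simp [ha], h⟩

theorem perm_of_mem_shuffle {α : Type*} {l z : List α} (h : z ∈ (shuffle l).support) :
    z.Perm l := by
  have : ∀ s, z ∈ (foldP insertRand s l).support → z.Perm (l ++ s) := by
    clear h
    induction l with
    | nil => intro s h; simp only [foldP, PMF.mem_support_pure_iff] at h; simp [h]
    | cons a l ih =>
      intro s h
      simp only [foldP, PMF.mem_support_bind_iff] at h
      obtain ⟨s', hs', h⟩ := h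
      refine (ih s' h).trans ?_
      obtain ⟨i, -, rfl⟩ := (PMF.mem_support_map_iff _ _ _).1 hs'
      refine (List.Perm.append_left l (List.perm_middle)).trans ?_
      rw [List.take_append_drop]
      exact List.perm_middle
  simpa using this [] h

theorem mem_support_sample {K : CodeFamily F} {m : ℕ} {g : List (List F) × Code F}
    (h : g ∈ (K.sample m).support) : ∃ MC ∈ (K.gen.dist m).support,
      g = (rowsOf MC.1, codeOf MC.2) := by
  obtain ⟨MC, hMC, rfl⟩ := (PMF.mem_support_map_iff _ _ _).1 h
  exact ⟨MC, hMC, rfl⟩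

theorem length_rowsOf {m n : ℕ} (M : Matrix (Fin m) (Fin n) F) : (rowsOf M).length = m := by
  simp [rowsOf]

theorem shape_of_mem_encodeBlock {K : CodeFamily F} {m : ℕ} {cols : List (List F)}
    {x : List (List F) × Code F} (h : x ∈ (encodeBlock K m cols).support) :
    x.1.length = cols.length ∧ ∀ c ∈ x.1, c.length = m := by
  simp only [encodeBlock, PMF.mem_support_bind_iff, PMF.mem_support_map_iff] at h
  obtain ⟨g, hg, z, hz, rfl⟩ := h
  obtain ⟨MC, -, rfl⟩ := mem_support_sample hg
  have := (perm_of_mem_shuffle hz).length_eq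
  simp only [pairUp, List.length_map, List.length_range, length_rowsOf] at this
  refine ⟨by simp, fun c hc => ?_⟩
  obtain ⟨c', -, rfl⟩ := List.mem_map.1 hc
  simpa using this

/-- The circuit does not depend on the columns, so the time bound for an empty list of columns
bounds its size in terms of `m` alone. The estimate hence does not compound from level to level. -/
theorem exists_code_bound (K : CodeFamily F) : ∃ c : ℕ, ∀ (m : ℕ) (cols : List (List F)),
    ∀ x ∈ (encodeBlock K m cols).support, esize x.2 ≤ (esize m + 3) ^ c := by
  obtain ⟨g, ⟨c, hc⟩, hg⟩ := (Poly.encodeBlock K).esize_bound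
  refine ⟨c, fun m cols x hx => ?_⟩
  have : (([], x.2) : List (List F) × Code F) ∈ (encodeBlock K m []).support := by
    simp only [encodeBlock, PMF.mem_support_bind_iff, PMF.mem_support_map_iff] at hx ⊢
    obtain ⟨g, hg, z, hz, rfl⟩ := hx
    exact ⟨g, hg, z, hz, rfl⟩
  have h1 := (hg (m, []) _ this).trans (hc (m, []) trivial)
  have h2 : esize (m, ([] : List (List F))) + 1 = esize m + 3 := by rw [esize_pair, esize_nil]
  simp only [h2] at h1
  refine le_trans ?_ h1
  rw [esize_mk (([] : List (List F)), x.2)]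
  exact Nat.le_succ_of_le (Nat.le_add_left _ _)

theorem esize_col_le (c : List F) : esize c ≤ c.length * (2 * Nat.card F + 2) + 1 :=
  esize_list_le le_rfl fun a _ => esize_field_le a

/-- A level replaces the columns by at most `N` columns of length `m` and issues at most `N`
additions and `N` encodings, each of a size controlled by `m`. -/
theorem level_bounds {K : CodeFamily F} {d : ℕ} (hd : ∀ (m : ℕ) (cols : List (List F)),
    ∀ x ∈ (encodeBlock K m cols).support, esize x.2 ≤ (esize m + 3) ^ d) {N m : ℕ}
    {st st' : List (List F) × List (Instr F) × ℕ} (h3 : st.2.2 ≤ N)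
    (hst' : st' ∈ (level K N st m).support) :
    st'.1.length ≤ N ∧ (∀ c ∈ st'.1, c.length = m) ∧
      esize st'.2.1 ≤ esize st.2.1 + (N + N) * ((esize m + 3) ^ d + 10) ∧ st'.2.2 ≤ N := by
  obtain ⟨res, hres, rfl⟩ := (PMF.mem_support_map_iff _ _ _).1 hst'
  generalize halfPow (K.dim m) = w at hres
  have hlen : res.length = N / w := by simpa using length_of_mem_mapP hres
  have hqw : N / w * w ≤ N := Nat.div_mul_le_self _ _
  have hq : N / w ≤ N := Nat.div_le_self _ _
  have hsh : ∀ a ∈ res, a.1.length = w ∧ (∀ c ∈ a.1, c.length = m) ∧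
      esize a.2 ≤ (esize m + 3) ^ d := by
    intro a ha
    obtain ⟨i, -, h⟩ := exists_of_mem_mapP hres ha
    refine ⟨?_, (shape_of_mem_encodeBlock h).2, hd m _ a h⟩
    rw [(shape_of_mem_encodeBlock h).1]
    simp [chunk]
  refine ⟨?_, ?_, ?_, hq⟩
  · rw [List.length_flatMap]
    have : (res.map fun a => a.1.length) = List.replicate (N / w) w := by
      rw [List.eq_replicate_iff]
      refine ⟨by simpa using hlen, ?_⟩
      simp only [List.mem_map]
      rintro _ ⟨a, ha, rfl⟩
      exact (hsh a ha).1
    rw [this, List.sum_replicate, smul_eq_mul]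
    exact hqw
  · intro c hc
    obtain ⟨a, ha, hc⟩ := List.mem_flatMap.1 hc
    exact (hsh a ha).2.1 c hc
  · generalize (esize m + 3) ^ d = b at hsh
    have e1 := esize_append st.2.1 (List.replicate (st.2.2 - N / w) ((true, [], []) : Instr F) ++
      res.map fun x => ((false, x.2) : Instr F))
    have e2 : esize (List.replicate (st.2.2 - N / w) ((true, [], []) : Instr F) ++
      res.map fun x => ((false, x.2) : Instr F)) ≤ (N + N) * (b + 10) + 1 := by
      refine esize_list_le (B := b + 9) ?_ ?_
      · simp only [List.length_append, List.length_replicate, List.length_map, hlen]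
        omega
      · intro a ha
        rcases List.mem_append.1 ha with ha | ha
        · rw [List.eq_of_mem_replicate ha]
          simp only [esize_pair, esize_nil]
          have := esize_bool true
          omega
        · obtain ⟨y, hy, rfl⟩ := List.mem_map.1 ha
          have h1 := (hsh y hy).2.2
          have := esize_bool false
          rw [esize_mk (false, y.2)]
          simp only
          omega
    simp only
    omega

theorem Poly.levels (K : CodeFamily F) : Poly fun x : ℕ × List ℕ × List (List F) =>
    foldP (Trapdoor.level K x.1) (x.2.2, [], x.1) x.2.1 := by
  obtain ⟨d, hd⟩ := exists_code_bound K
  have hX : PB fun x : ℕ × List ℕ × List (List F) => esize x := PB.esize_self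
  have hXN : ∀ x : ℕ × List ℕ × List (List F), x.1 ≤ esize x ∧ esize x.2.1 ≤ esize x ∧
      esize x.2.2 ≤ esize x := fun x => by
    have h1 := esize_mk x
    have h2 := esize_mk x.2
    rw [esize_nat] at h1; omega
  obtain ⟨D, hD, hDdef⟩ : ∃ D : ℕ × List ℕ × List (List F) → ℕ, PB D ∧
      ∀ x, (esize x + esize x) * ((esize x + 3) ^ d + 10) = D x :=
    ⟨_, (hX.add hX).mul (((hX.add (PB.const 3)).pow d).add (PB.const 10)), fun _ => rfl⟩
  obtain ⟨E, hE, hEdef⟩ : ∃ E : ℕ × List ℕ × List (List F) → ℕ, PB E ∧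
      ∀ x, esize x * (esize x * (2 * Nat.card F + 2) + 1 + 1) + 1 = E x :=
    ⟨_, (hX.mul (((hX.mul (PB.const _)).add (PB.const 1)).add (PB.const 1))).add (PB.const 1),
      fun _ => rfl⟩
  have hstep : Poly fun p : (ℕ × List ℕ × List (List F)) ×
      (List (List F) × List (Instr F) × ℕ) × ℕ => Trapdoor.level K p.1.1 p.2.1 p.2.2 :=
    Poly.compF (f := fun p : (ℕ × List ℕ × List (List F)) ×
      (List (List F) × List (Instr F) × ℕ) × ℕ => (p.1.1, p.2.1, p.2.2)) (Poly.level K)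
      (by fun_prop)
  have hl : PF fun x : ℕ × List ℕ × List (List F) => x.2.1 := by fun_prop
  have hs : PF fun x : ℕ × List ℕ × List (List F) => (x.2.2, ([] : List (Instr F)), x.1) := by
    fun_prop
  have h := fun I => Poly.fold (f := fun x st m => Trapdoor.level K x.1 st m) hl hs hstep I
  -- The bound on the columns does not depend on `i`, since they are replaced at each level (`esize
  -- x` covers the initial ones); only the list of instructions accumulates.
  refine h (fun x i st => esize st.1 ≤ E x + esize x ∧ esize st.2.1 ≤ i * D x + 1 ∧ st.2.2 ≤ x.1) ?_ ?_
    (fun x => E x + esize x + (esize x * D x + 1 + (2 * esize x + 1) + 1) + 1)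
    (((hE.add hX).add ((((hX.mul hD).add (PB.const 1)).add
      (((PB.const 2).mul hX).add (PB.const 1))).add (PB.const 1))).add (PB.const 1)) ?_
  · intro x
    exact ⟨(hXN x).2.2.trans (Nat.le_add_left _ _), by simp [esize_nil], le_rfl⟩
  · rintro x i st m hm hi ⟨-, h2, h3⟩ st' hst'
    obtain ⟨b1, b2, b3, b4⟩ := level_bounds hd h3 hst'
    have hmX : esize m ≤ esize x := (esize_le_of_mem hm).trans (hXN x).2.1
    have hmX' : m ≤ esize x := le_trans (by rw [esize_nat]; omega) hmX
    refine ⟨?_, ?_, b4⟩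
    · refine le_trans (esize_list_le (b1.trans (hXN x).1)
        (B := esize x * (2 * Nat.card F + 2) + 1) fun c hc => ?_) (hEdef x ▸ Nat.le_add_right _ _)
      refine (esize_col_le c).trans ?_
      rw [b2 c hc]
      exact Nat.succ_le_succ (Nat.mul_le_mul_right _ hmX')
    · have e1 : (x.1 + x.1) * ((esize m + 3) ^ d + 10) ≤ D x := by
        rw [← hDdef]
        exact Nat.mul_le_mul (Nat.add_le_add (hXN x).1 (hXN x).1)
          (Nat.add_le_add_right (Nat.pow_le_pow_left (Nat.add_le_add_right hmX 3) d) 10)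
      rw [Nat.succ_mul]
      omega
  · rintro x i st hi ⟨h1, h2, h3⟩
    rw [esize_mk, esize_mk st.2, esize_nat]
    have hl : x.2.1.length ≤ esize x := (length_le_esize _).trans (hXN x).2.1
    have := Nat.mul_le_mul_right (D x) (hi.trans hl)
    have := (hXN x).1
    omega

/-! ### The chain of dimensions -/

theorem CodeFamily.dim_le (K : CodeFamily F) (m : ℕ) : K.dim m ≤ m := by
  obtain ⟨MC, h⟩ := (K.gen.dist m).support_nonempty
  have := LinearMap.finrank_le_finrank_of_injective (f := Matrix.mulVecLin MC.1)
    (K.fullRank m MC h)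
  simpa using this

/-- One step in the chain of dimensions. -/
def chainStep (K : CodeFamily F) (th : ℕ) (s : List ℕ × ℕ) : List ℕ × ℕ :=
  if th < s.2 then (s.2 :: s.1, K.dim s.2) else s

/-- The chain `n, k(n), k(k(n)), …` of the numbers above `th`, in increasing order, and the first
number that is not above `th`. -/
def chain (K : CodeFamily F) (th n : ℕ) : List ℕ × ℕ := (chainStep K th)^[n] ([], n)

theorem iterate_chainStep_le (K : CodeFamily F) (th n i : ℕ) :
    ((chainStep K th)^[i] ([], n)).1.length ≤ i ∧ ((chainStep K th)^[i] ([], n)).2 ≤ n ∧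
      ∀ m ∈ ((chainStep K th)^[i] ([], n)).1, m ≤ n := by
  induction i with
  | zero => simp
  | succ i ih =>
    rw [Function.iterate_succ_apply']
    generalize (chainStep K th)^[i] ([], n) = s at ih
    obtain ⟨h1, h2, h3⟩ := ih
    unfold chainStep
    split_ifs
    · refine ⟨by simpa using h1, (K.dim_le _).trans h2, ?_⟩
      simpa using ⟨h2, h3⟩
    · exact ⟨h1.trans (Nat.le_succ i), h2, h3⟩

@[fun_prop]
theorem PF.chain (K : CodeFamily F) {th n : χ → ℕ} (hth : PF th) (hn : PF n) :
    PF fun x => chain K (th x) (n x) := by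
  unfold Trapdoor.chain
  have h : PF fun p : χ × List ℕ × ℕ => th p.1 := PF.comp hth (by fun_prop)
  refine PF.iterate (f := fun x s => chainStep K (th x) s) hn (PF.prodMk (PF.const []) hn)
    (PF.ite (by fun_prop) (by fun_prop) (by fun_prop))
    (fun x => n x * (2 * n x + 1 + 1) + 1 + (2 * n x + 1) + 1)
    ((((hn.pb_nat.mul ((((PB.const 2).mul hn.pb_nat).add (PB.const 1)).add (PB.const 1))).add
      (PB.const 1)).add (((PB.const 2).mul hn.pb_nat).add (PB.const 1))).add (PB.const 1))
    fun x i hi => ?_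
  obtain ⟨h1, h2, h3⟩ := iterate_chainStep_le K (th x) (n x) i
  have := esize_list_le (L := n x) (B := 2 * n x + 1) (h1.trans hi) fun a ha => by
    rw [esize_nat]; have := h3 a ha; omega
  change esize ((chainStep K (th x))^[i] ([], n x)) ≤ _
  rw [esize_mk, esize_nat]
  omega

/-- The number of columns. -/
def width (n : ℕ) : ℕ := 2 * 2 ^ Nat.log 2 n

@[fun_prop]
theorem PF.width {f : χ → ℕ} (hf : PF f) : PF fun x => width (f x) := by
  unfold Trapdoor.width
  fun_prop

/-- Uniformly random columns. -/
noncomputable def randCols (F : Type*) [Field F] [Finite F] (N r : ℕ) : PMF (List (List F)) :=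
  iid N (iid r (uniform F))

theorem Poly.randCols {N r : χ → ℕ} (hN : PF N) (hr : PF r) :
    Poly fun x => randCols F (N x) (r x) :=
  Poly.iid hN (Poly.iid hr Poly.uniform_field)

/-- The initial columns, and the final state of the sampler. -/
noncomputable def sampleCols (K : CodeFamily F) (s : ℕ → ℕ) (n : ℕ) :
    PMF (List (List F) × List (List F) × List (Instr F) × ℕ) :=
  (randCols F (width n) (chain K (s n) n).2).bind fun cols =>
    (foldP (level K (width n)) (cols, [], width n) (chain K (s n) n).1).map fun st => (cols, st)

theorem Poly.sampleCols (K : CodeFamily F) {s : ℕ → ℕ} (hs : PF s) : Poly (sampleCols K s) := by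
  have h : PF fun n => Trapdoor.chain K (s n) n := by fun_prop
  refine Poly.bind (Poly.randCols (by fun_prop) (by fun_prop)) ?_
  refine Poly.map (f := fun p : ℕ × List (List F) =>
    foldP (Trapdoor.level K (Trapdoor.width p.1)) (p.2, [], Trapdoor.width p.1)
      (Trapdoor.chain K (s p.1) p.1).1) ?_ (by fun_prop)
  have h' : PF fun p : ℕ × List (List F) => Trapdoor.chain K (s p.1) p.1 :=
    PF.comp h (by fun_prop)
  exact Poly.compF (f := fun p : ℕ × List (List F) => (Trapdoor.width p.1,
    (Trapdoor.chain K (s p.1) p.1).1, p.2)) (Poly.levels K) (by fun_prop)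

end Sampler
end Trapdoor

namespace Trapdoor
open Enc (enc)

/-! ### The circuit builder and its running time -/

section Builder

variable {F : Type*} [Field F] [Finite F] {χ : Type*} [Enc χ]

/-- The wires of the next `t` gates. -/
def nextWires (n t : ℕ) (gates : List (Gate F)) : List ℕ :=
  (List.range t).map fun i => n + gates.length + i

/-- The state of the circuit builder: the gates and a queue of blocks of wires. -/
abbrev Builder (F : Type*) : Type _ := List (Gate F) × List (List ℕ)

/-- Replace the first two blocks of the queue by their sum, at the end. -/
def addStep (n : ℕ) (s : Builder F) : Builder F :=
  (s.1 ++ (List.range (s.2.headD []).length).map fun i =>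
      Gate.add ((s.2.headD []).getD i n) ((s.2.tail.headD []).getD i n),
    s.2.tail.tail ++ [nextWires n (s.2.headD []).length s.1])

/-- Replace the first block of the queue by its encoding, at the end. -/
def encodeStep (n : ℕ) (s : Builder F) (C : Code F) : Builder F :=
  (s.1 ++ C.1.map (rewire (s.2.headD [] ++ nextWires n C.1.length s.1) n),
    s.2.tail ++ [C.2.map fun o => (s.2.headD [] ++ nextWires n C.1.length s.1).getD o n])

/-- Execute an instruction. -/
def buildStep (n : ℕ) (s : Builder F) (ins : Instr F) : Builder F :=
  bif ins.1 then addStep n s else encodeStep n s ins.2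

@[fun_prop]
theorem PF.nextWires {n t : χ → ℕ} {g : χ → List (Gate F)} (hn : PF n) (ht : PF t) (hg : PF g) :
    PF fun x => nextWires (n x) (t x) (g x) := by
  unfold Trapdoor.nextWires
  have h1 : PF fun p : χ × ℕ => n p.1 := PF.comp hn (by fun_prop)
  have h2 : PF fun p : χ × ℕ => g p.1 := PF.comp hg (by fun_prop)
  exact PF.map (by fun_prop) (by fun_prop)

theorem PF.buildStep : PF fun p : ℕ × Builder F × Instr F => buildStep p.1 p.2.1 p.2.2 := by
  unfold Trapdoor.buildStep
  refine PF.cond (by fun_prop) ?_ ?_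
  · exact PF.prodMk (PF.append (by fun_prop) (PF.map (by fun_prop)
      (PF.gateAdd (by fun_prop) (by fun_prop)))) (by fun_prop)
  · exact PF.prodMk (PF.append (by fun_prop) (PF.map (by fun_prop) (by fun_prop)))
      (PF.append (by fun_prop) (PF.cons (PF.map (by fun_prop) (by fun_prop)) (by fun_prop)))

theorem esize_gateAdd (i j : ℕ) : esize (Gate.add i j : Gate F) = 2 * i + 2 * j + 7 := by
  change ((Data.ofNat 1).size + ((Data.ofNat i).size + (Data.ofNat j).size + 1) + 1) = _
  simp only [Data.size_ofNat]; omega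

theorem esize_gateMul (i j : ℕ) : esize (Gate.mul i j : Gate F) = 2 * i + 2 * j + 9 := by
  change ((Data.ofNat 2).size + ((Data.ofNat i).size + (Data.ofNat j).size + 1) + 1) = _
  simp only [Data.size_ofNat]; omega

theorem getD_le {W : List ℕ} {z M : ℕ} (hW : ∀ a ∈ W, a ≤ M) (hz : z ≤ M) (i : ℕ) :
    W.getD i z ≤ M := by
  rcases Nat.lt_or_ge i W.length with h | h
  · rw [List.getD_eq_getElem _ _ h]; exact hW _ (List.getElem_mem h)
  · rw [List.getD_eq_default _ _ h]; exact hz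

theorem esize_rewire_le {W : List ℕ} {z M : ℕ} (hW : ∀ a ∈ W, a ≤ M) (hz : z ≤ M) (g : Gate F) :
    esize (rewire W z g) ≤ esize g + 4 * M + 9 := by
  cases g with
  | const a => simp only [rewire]; omega
  | add i j =>
    simp only [rewire, esize_gateAdd]
    have := getD_le hW hz i
    have := getD_le hW hz j
    omega
  | mul i j =>
    simp only [rewire, esize_gateMul]
    have := getD_le hW hz i
    have := getD_le hW hz j
    omega

/-- Bounds for the size of the state of the builder. -/
structure Builder.Bounded (X M : ℕ) (s : Builder F) : Prop where
  length_gates : s.1.length + 2 * X ≤ M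
  gates : ∀ g ∈ s.1, esize g ≤ X + 4 * M + 9
  length_queue : s.2.length ≤ X
  length_block : ∀ a ∈ s.2, a.length ≤ X
  wires : ∀ a ∈ s.2, ∀ i ∈ a, i ≤ M

theorem Builder.Bounded.esize_le {X M : ℕ} {s : Builder F} (h : s.Bounded X M) :
    esize s ≤ M * (X + 4 * M + 9 + 1) + 1 + (X * (X * (2 * M + 1 + 1) + 1 + 1) + 1) + 1 := by
  rw [esize_mk]
  have h1 := esize_list_le ((Nat.le_add_right _ _).trans h.length_gates) h.gates
  have h2 := esize_list_le h.length_queue fun a ha =>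
    esize_list_le (h.length_block a ha) (B := 2 * M + 1) fun i hi => by
      rw [esize_nat]; have := h.wires a ha i hi; omega
  omega

theorem headD_mem_or {α : Type*} (l : List (List α)) : l.headD [] ∈ l ∨ l.headD [] = [] := by
  cases l <;> simp

/-- An instruction of size at most `X` adds at most `X` gates, hence `M` grows by `X`. The slack `2
* X` in `length_gates` keeps the new wires `n + s.1.length + i` below the old `M`. -/
theorem Builder.Bounded.step {X M n : ℕ} {s : Builder F} {ins : Instr F} (h : s.Bounded X M)
    (hn : n ≤ X) (hins : esize ins ≤ X) (hX : 1 ≤ X) :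
    (buildStep n s ins).Bounded X (M + X) := by
  obtain ⟨h1, h2, h3, h4, h5⟩ := h
  have hg : ∀ g ∈ s.1, esize g ≤ X + 4 * (M + X) + 9 := fun g hg => (h2 g hg).trans (by omega)
  have ha : (s.2.headD []).length ≤ X ∧ ∀ i ∈ s.2.headD [], i ≤ M := by
    rcases headD_mem_or s.2 with h | h
    · exact ⟨h4 _ h, h5 _ h⟩
    · rw [h]; simp
  have ha' : ∀ i ∈ s.2.tail.headD [], i ≤ M := by
    rcases headD_mem_or s.2.tail with h | h
    · exact h5 _ (List.mem_of_mem_tail h)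
    · rw [h]; simp
  have hnext : ∀ t ≤ X, ∀ i ∈ nextWires n t s.1, i ≤ M := by
    intro t ht i hi
    simp only [nextWires, List.mem_map, List.mem_range] at hi
    obtain ⟨j, hj, rfl⟩ := hi
    omega
  unfold buildStep
  cases hb : ins.1 with
  | true =>
    simp only [cond_true, addStep]
    refine ⟨by simp only [List.length_append, List.length_map, List.length_range]; omega, ?_,
      by simp only [List.length_append, List.length_tail, List.length_singleton]; omega, ?_, ?_⟩
    · intro g hg'
      rcases List.mem_append.1 hg' with hg' | hg'
      · exact hg g hg'
      · obtain ⟨i, -, rfl⟩ := List.mem_map.1 hg'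
        rw [esize_gateAdd]
        have := getD_le ha.2 (show n ≤ M by omega) i
        have := getD_le ha' (show n ≤ M by omega) i
        omega
    · intro a hmem
      rcases List.mem_append.1 hmem with hmem | hmem
      · exact h4 _ (List.mem_of_mem_tail (List.mem_of_mem_tail hmem))
      · rw [List.mem_singleton.1 hmem]
        simpa [nextWires] using ha.1
    · intro a hmem i hi
      rcases List.mem_append.1 hmem with hmem | hmem
      · exact (h5 _ (List.mem_of_mem_tail (List.mem_of_mem_tail hmem)) i hi).trans (by omega)
      · rw [List.mem_singleton.1 hmem] at hi
        exact (hnext _ ha.1 i hi).trans (by omega)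
  | false =>
    have e1 := esize_mk ins
    have e2 := esize_mk ins.2
    have e3 := length_le_esize ins.2.1
    have e4 := length_le_esize ins.2.2
    have hW : ∀ i ∈ s.2.headD [] ++ nextWires n ins.2.1.length s.1, i ≤ M := by
      intro i hi
      rcases List.mem_append.1 hi with hi | hi
      · exact ha.2 i hi
      · exact hnext _ (by omega) i hi
    simp only [cond_false, encodeStep]
    refine ⟨by simp only [List.length_append, List.length_map]; omega, ?_,
      by simp only [List.length_append, List.length_tail, List.length_singleton]; omega, ?_, ?_⟩
    · intro g hg'
      rcases List.mem_append.1 hg' with hg' | hg'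
      · exact hg g hg'
      · obtain ⟨g₀, hg₀, rfl⟩ := List.mem_map.1 hg'
        have := esize_rewire_le hW (show n ≤ M by omega) g₀
        have := esize_le_of_mem hg₀
        omega
    · intro a hmem
      rcases List.mem_append.1 hmem with hmem | hmem
      · exact h4 _ (List.mem_of_mem_tail hmem)
      · rw [List.mem_singleton.1 hmem]
        simp only [List.length_map]
        omega
    · intro a hmem i hi
      rcases List.mem_append.1 hmem with hmem | hmem
      · exact (h5 _ (List.mem_of_mem_tail hmem) i hi).trans (by omega)
      · rw [List.mem_singleton.1 hmem] at hi
        obtain ⟨o, -, rfl⟩ := List.mem_map.1 hi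
        exact (getD_le hW (by omega) o).trans (by omega)

theorem PF.build {n : χ → ℕ} {s : χ → Builder F} {l : χ → List (Instr F)} (hn : PF n) (hs : PF s)
    (hl : PF l) : PF fun x => (l x).foldl (Trapdoor.buildStep (n x)) (s x) := by
  have hX : PB fun x => esize (n x) + esize (s x) + esize (l x) :=
    (hn.pb.add hs.pb).add hl.pb
  have hstep : PF fun p : χ × Builder F × Instr F => Trapdoor.buildStep (n p.1) p.2.1 p.2.2 :=
    PF.comp (f := fun p : χ × Builder F × Instr F => (n p.1, p.2.1, p.2.2)) PF.buildStep
      (PF.prodMk (PF.comp hn (by fun_prop)) (by fun_prop))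
  have h := fun I => PF.foldl (f := fun x s i => Trapdoor.buildStep (n x) s i) hl hs hstep I
  obtain ⟨X, hX, hXdef⟩ : ∃ X : χ → ℕ, PB X ∧ ∀ x, esize (n x) + esize (s x) + esize (l x) = X x :=
    ⟨_, hX, fun _ => rfl⟩
  obtain ⟨Y, hY, hYdef⟩ : ∃ Y : χ → ℕ, PB Y ∧ ∀ x, (3 * X x + X x * X x) = Y x :=
    ⟨_, ((PB.const 3).mul hX).add (hX.mul hX), fun _ => rfl⟩
  -- `3 * X` is `X` for the initial gates and `2 * X` for the slack; each instruction adds another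
  -- `X`.
  refine h (fun x i s => s.Bounded (X x) (3 * X x + i * X x)) ?_ ?_
    (fun x => Y x * (X x + 4 * Y x + 9 + 1) + 1 + (X x * (X x * (2 * Y x + 1 + 1) + 1 + 1) + 1) + 1)
    ((((hY.mul (((hX.add ((PB.const 4).mul hY)).add (PB.const 9)).add (PB.const 1))).add
      (PB.const 1)).add ((hX.mul (((hX.mul ((((PB.const 2).mul hY).add (PB.const 1)).add
        (PB.const 1))).add (PB.const 1)).add (PB.const 1))).add (PB.const 1))).add (PB.const 1)) ?_
  · intro x
    have e1 := esize_mk (s x)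
    have e2 := hXdef x
    have e3 := length_le_esize (s x).1
    have e4 := length_le_esize (s x).2
    refine ⟨by omega, fun g hg => ?_, by omega, fun a ha => ?_, fun a ha i hi => ?_⟩
    · have := esize_le_of_mem hg; omega
    · have := esize_le_of_mem ha
      have := length_le_esize a
      omega
    · have := esize_le_of_mem ha
      have := esize_le_of_mem hi
      rw [esize_nat] at this
      omega
  · intro x i st ins hins hi hst
    have e2 := hXdef x
    have e1 := esize_nat (n x)
    have := hst.step (n := n x) (by omega) ((esize_le_of_mem hins).trans (by omega))
      (by have := esize_pos (n x); omega)
    rwa [show 3 * X x + (i + 1) * X x = 3 * X x + i * X x + X x by ring]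
  · intro x i st hi hst
    have e2 := hXdef x
    have e4 := length_le_esize (l x)
    have : 3 * X x + i * X x ≤ Y x := by
      rw [← hYdef]
      exact Nat.add_le_add_left (Nat.mul_le_mul_right _ (by omega)) _
    exact hst.esize_le.trans (by gcongr)

/-! ### The initial state -/

/-- The first of the wires that belong to the column `c`. -/
def baseWire (n r c : ℕ) : ℕ := n + 1 + c * (2 * r)

/-- The gates that multiply the entries of the column number `c` by the `c`-th input. -/
def columnGates (n r c : ℕ) (col : List F) : List (Gate F) :=
  (List.range r).map (fun i => Gate.const (col.getD i 0)) ++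
    (List.range r).map fun i => Gate.mul (baseWire n r c + i) (if c < n then c else n)

/-- The state of the builder before the first instruction; the wire `n` has the value zero. -/
def buildInit (n r : ℕ) (cols : List (List F)) : Builder F :=
  (Gate.const 0 :: (List.range cols.length).flatMap fun c => columnGates n r c (cols.getD c []),
    (List.range cols.length).map fun c => (List.range r).map fun i => baseWire n r c + r + i)

theorem PF.buildInit {n r : χ → ℕ} {cols : χ → List (List F)} (hn : PF n) (hr : PF r)
    (hc : PF cols) : PF fun x => Trapdoor.buildInit (n x) (r x) (cols x) := by
  refine PF.comp (f := fun x => (n x, r x, cols x)) (g := fun y : ℕ × ℕ × List (List F) =>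
    Trapdoor.buildInit y.1 y.2.1 y.2.2) ?_ (by fun_prop)
  unfold Trapdoor.buildInit columnGates baseWire
  refine PF.prodMk (PF.cons (PF.const _) (PF.flatMap (by fun_prop) (PF.append ?_ ?_)))
    (PF.map (by fun_prop) (PF.map (by fun_prop) (by fun_prop)))
  · exact PF.map (by fun_prop) (PF.gateConst (PF.getD (by fun_prop) (by fun_prop) (PF.const _)))
  · exact PF.map (by fun_prop) (PF.gateMul (by fun_prop)
      (PF.ite (by fun_prop) (by fun_prop) (by fun_prop)))

/-- The circuit described by instructions, from `N` columns of length `r`, with `q` blocks at the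
end. -/
def buildCode (n r : ℕ) (cols : List (List F)) (ins : List (Instr F)) (q : ℕ) : Code F :=
  let s := (ins ++ List.replicate (q - 1) (true, [], [])).foldl (buildStep n) (buildInit n r cols)
  (s.1, (List.range n).map fun i => (s.2.headD []).getD i n)

theorem PF.buildCode {n r q : χ → ℕ} {cols : χ → List (List F)} {ins : χ → List (Instr F)}
    (hn : PF n) (hr : PF r) (hq : PF q) (hc : PF cols) (hi : PF ins) :
    PF fun x => Trapdoor.buildCode (n x) (r x) (cols x) (ins x) (q x) := by
  unfold Trapdoor.buildCode
  have h : PF fun x => (ins x ++ List.replicate (q x - 1)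
      ((true, [], []) : Instr F)).foldl (Trapdoor.buildStep (n x))
      (Trapdoor.buildInit (n x) (r x) (cols x)) :=
    PF.build hn (PF.buildInit hn hr hc) (by fun_prop)
  refine PF.prodMk h.fst (PF.map (PF.range hn) ?_)
  have h1 : PF fun p : χ × ℕ => n p.1 := PF.comp hn (by fun_prop)
  have h2 := PF.comp (f := fun p : χ × ℕ => p.1) h (by fun_prop)
  fun_prop

/-- The matrix with given columns. -/
def colsToMatrix (n : ℕ) (cols : List (List F)) : Matrix (Fin n) (Fin n) F :=
  Matrix.of fun i j => (cols.getD j []).getD i 0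

/-- The rows of the matrix with given columns. -/
def colsToRows (n : ℕ) (cols : List (List F)) : List (List F) :=
  (List.range n).map fun i => (List.range n).map fun j => (cols.getD j []).getD i 0

theorem map_range_eq_ofFn {α : Type*} (n : ℕ) (f : ℕ → α) :
    (List.range n).map f = List.ofFn fun i : Fin n => f i := by
  refine List.ext_getElem (by simp) fun i h1 h2 => by simp

theorem colsToRows_eq (n : ℕ) (cols : List (List F)) :
    colsToRows n cols = rowsOf (colsToMatrix n cols) := by
  simp only [colsToRows, rowsOf, map_range_eq_ofFn, colsToMatrix, Matrix.of_apply]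

theorem PF.colsToRows {n : χ → ℕ} {cols : χ → List (List F)} (hn : PF n) (hc : PF cols) :
    PF fun x => Trapdoor.colsToRows (n x) (cols x) := by
  refine PF.comp (f := fun x => (n x, cols x)) (g := fun y : ℕ × List (List F) =>
    Trapdoor.colsToRows y.1 y.2) ?_ (by fun_prop)
  unfold Trapdoor.colsToRows
  refine PF.map (by fun_prop) (PF.map (by fun_prop) (PF.getD ?_ (by fun_prop) (PF.const _)))
  fun_prop

/-- The circuit built for a state of the sampler. -/
def stateCode (K : CodeFamily F) (s : ℕ → ℕ) (n : ℕ)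
    (st : List (List F) × List (List F) × List (Instr F) × ℕ) : Code F :=
  buildCode n (chain K (s n) n).2 st.1 st.2.2.1 st.2.2.2

/-- The circuit with given gates and outputs. -/
def codeToCircuit (n : ℕ) (C : Code F) : Circuit F n n := ⟨C.1, fun i => C.2.getD i 0⟩

/-- The distribution of the sampled matrices with their circuits. -/
noncomputable def sampleDist (K : CodeFamily F) (s : ℕ → ℕ) (n : ℕ) :
    PMF (Matrix (Fin n) (Fin n) F × Circuit F n n) :=
  (sampleCols K s n).map fun st =>
    (colsToMatrix n st.2.1, codeToCircuit n (stateCode K s n st))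

theorem exists_sampleDist_prog (K : CodeFamily F) {s : ℕ → ℕ} (hs : PF s) :
    ∃ (p : Prog) (a : ℕ), ∀ n, Runs p (Data.ofNat n)
      ((sampleDist K s n).map fun MC => Data.cons (encMatrix MC.1) (encCircuit MC.2))
        (n ^ a + a) := by
  have h : Poly fun n => (sampleCols K s n).map fun st =>
      (colsToRows n st.2.1, stateCode K s n st) := by
    refine Poly.map (Poly.sampleCols K hs) (PF.prodMk (PF.colsToRows (by fun_prop) (by fun_prop)) ?_)
    have hs' : PF fun p : ℕ × List (List F) × List (List F) × List (Instr F) × ℕ =>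
      chain K (s p.1) p.1 := PF.chain K (PF.comp hs (by fun_prop)) (by fun_prop)
    exact PF.buildCode (by fun_prop) (by fun_prop) (by fun_prop) (by fun_prop) (by fun_prop)
  obtain ⟨-, p, c, h⟩ := h
  -- The time is `(2n + 2) ^ c`. For `n ≥ 2` it is at most `n ^ (3c)`, as `2n + 2 ≤ n ^ 3`; for `n <
  -- 2` it is at most `4 ^ c`, covered by the additive constant.
  refine ⟨p, (c + 1) * (c + 4) + 4 ^ (c + 1), fun n => ?_⟩
  have := h n trivial
  unfold TRuns at this
  rw [PMF.map_comp] at this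
  unfold sampleDist
  rw [PMF.map_comp]
  have he : (enc ∘ fun st : List (List F) × List (List F) × List (Instr F) × ℕ =>
      (colsToRows n st.2.1, stateCode K s n st)) =
      ((fun MC => Data.cons (encMatrix MC.1) (encCircuit MC.2)) ∘
      fun st => (colsToMatrix n st.2.1, codeToCircuit n (stateCode K s n st))) := by
    funext st
    simp only [Function.comp_apply, enc_pair, colsToRows_eq, enc_rowsOf, ← enc_codeOf]
    rw [codeToCircuit, codeOf, show ∀ p : Code F, enc p = Data.cons (enc p.1) (enc p.2) from
      fun _ => rfl, enc_pair]
    congr 2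
    simp only [stateCode, buildCode]
    rw [← map_range_eq_ofFn n fun i => List.getD _ i 0]
    refine congrArg enc (List.map_congr_left fun i hi => ?_)
    rw [List.getD_eq_getElem _ 0 (by simpa using hi)]
    simp
  rw [he] at this
  refine Runs.weaken this ?_
  simp only [esize_nat]
  set a := (c + 1) * (c + 4) + 4 ^ (c + 1)
  have h4 : 4 ^ (c + 1) ≤ a := Nat.le_add_left _ _
  rcases Nat.lt_or_ge n 2 with hn | hn
  · refine le_trans ?_ (Nat.le_add_left _ _)
    refine le_trans ?_ h4
    refine (Nat.pow_le_pow_left (show 2 * n + 1 + 1 ≤ 4 by omega) c).trans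
      (Nat.pow_le_pow_right (by norm_num) (Nat.le_succ c))
  · refine le_trans ?_ (Nat.le_add_right _ _)
    refine (Nat.pow_le_pow_left (show 2 * n + 1 + 1 ≤ n ^ 3 by nlinarith [sq_nonneg (n - 2 : ℤ), Nat.mul_le_mul hn hn]) c).trans ?_
    rw [← pow_mul]
    refine Nat.pow_le_pow_right (by omega) (le_trans ?_ (Nat.le_add_right _ _))
    nlinarith

end Builder
end Trapdoor

namespace Trapdoor

/-! ### Evaluation of gates and of spliced circuits -/

section Evaluation

variable {F : Type*} [Field F]

/-- Evaluation of gates on top of given wires. -/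
def evalGates (gates : List (Gate F)) (w : List F) : List F :=
  gates.foldl (fun w g => w ++ [g.eval w]) w

theorem evalGates_append (g₁ g₂ : List (Gate F)) (w : List F) :
    evalGates (g₁ ++ g₂) w = evalGates g₂ (evalGates g₁ w) := by
  simp [evalGates]

theorem evalGates_cons (g : Gate F) (gs : List (Gate F)) (w : List F) :
    evalGates (g :: gs) w = evalGates gs (w ++ [g.eval w]) := rfl

theorem length_evalGates (gates : List (Gate F)) (w : List F) :
    (evalGates gates w).length = w.length + gates.length := by
  induction gates generalizing w with
  | nil => rfl
  | cons g gs ih => rw [evalGates_cons, ih]; simp; omega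

theorem prefix_evalGates (gates : List (Gate F)) (w : List F) : w <+: evalGates gates w := by
  induction gates generalizing w with
  | nil => exact List.prefix_refl _
  | cons g gs ih => exact (List.prefix_append _ _).trans (ih _)

theorem getD_evalGates {gates : List (Gate F)} {w : List F} {i : ℕ} (h : i < w.length) :
    (evalGates gates w).getD i 0 = w.getD i 0 := by
  obtain ⟨t, ht⟩ := prefix_evalGates gates w
  rw [← ht, List.getD_append _ _ _ _ h]

/-- The hypothesis says that the new gates do not read one another, so they can all be evaluated on
the old wires. -/
theorem evalGates_eq_append {gs : List (Gate F)} {w : List F}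
    (h : ∀ g ∈ gs, ∀ w', g.eval (w ++ w') = g.eval w) :
    evalGates gs w = w ++ gs.map (Gate.eval w) := by
  have : ∀ w', evalGates gs (w ++ w') = w ++ w' ++ gs.map (Gate.eval w) := by
    induction gs with
    | nil => intro w'; simp [evalGates]
    | cons g gs ih =>
      intro w'
      rw [evalGates_cons, h g (by simp), List.append_assoc w, ih (fun g hg => h g (by simp [hg]))]
      simp
  simpa using this []

theorem eval_add_append {w : List F} {i j : ℕ} (hi : i < w.length) (hj : j < w.length)
    (w' : List F) : (Gate.add i j).eval (w ++ w') = (Gate.add i j).eval w := by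
  simp only [Gate.eval, List.getD_append _ _ _ _ hi, List.getD_append _ _ _ _ hj]

theorem eval_rewire (W : List ℕ) (z : ℕ) (g : Gate F) {G L : List F}
    (h : ∀ i, G.getD (W.getD i z) 0 = L.getD i 0) : (rewire W z g).eval G = g.eval L := by
  cases g <;> simp only [rewire, Gate.eval, h]

/-- Evaluation of a spliced circuit. -/
theorem evalGates_rewire {W : List ℕ} {n k b T : ℕ} (hW : W.length = k + T)
    (hWa : ∀ i < k, W.getD i n < b) (hWb : ∀ t < T, W.getD (k + t) n = b + t) (hn : n < b)
    (gs : List (Gate F)) (G L : List F) (t : ℕ) (ht : t + gs.length = T) (hG : G.length = b + t)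
    (hL : L.length = k + t) (hz : G.getD n 0 = 0) (h : ∀ i, G.getD (W.getD i n) 0 = L.getD i 0) :
    ∀ i, (evalGates (gs.map (rewire W n)) G).getD (W.getD i n) 0 = (evalGates gs L).getD i 0 := by
  induction gs generalizing G L t with
  | nil => exact h
  | cons g gs ih =>
    rw [List.map_cons, evalGates_cons, evalGates_cons, eval_rewire W n g h]
    simp only [List.length_cons] at ht
    refine ih _ _ (t + 1) (by omega) (by simp [hG]; omega) (by simp [hL]; omega) ?_ ?_
    · rw [List.getD_append _ _ _ _ (by omega), hz]
    intro i
    -- An existing wire keeps its value, the new gate sits at its assigned wire, and a later wire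
    -- reads zero on both sides: it is either not there yet or redirected to the wire `n`, whose
    -- value is zero.
    rcases lt_trichotomy i L.length with hi | hi | hi
    · rw [List.getD_append L _ _ _ hi, ← h i, List.getD_append]
      rcases Nat.lt_or_ge i k with hk | hk
      · have := hWa i hk; omega
      · obtain ⟨t', rfl⟩ := Nat.exists_eq_add_of_le hk
        rw [hWb t' (by omega)]; omega
    · rw [hi, hL, hWb t (by omega), ← hG, ← hL]
      simp
    · rw [List.getD_eq_default (L ++ _) _ (by simp; omega)]
      rcases Nat.lt_or_ge i (k + T) with hk | hk
      · obtain ⟨t', rfl⟩ := Nat.exists_eq_add_of_le (show k ≤ i by omega)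
        rw [hWb t' (by omega), List.getD_eq_default _ _ (by simp; omega)]
      · rw [List.getD_eq_default W _ (by omega), List.getD_append _ _ _ _ (by omega), hz]

end Evaluation

/-! ### Semantics of the instructions of the builder -/

section Simulation

variable {F : Type*} [Field F] [Finite F] {n : ℕ} {v : Fin n → F}

/-- The values of all wires on the input `v`. -/
def wireVals (v : Fin n → F) (gates : List (Gate F)) : List F := evalGates gates (List.ofFn v)

theorem length_wireVals (v : Fin n → F) (gates : List (Gate F)) :
    (wireVals v gates).length = n + gates.length := by
  simp [wireVals, length_evalGates]

theorem wireVals_append (v : Fin n → F) (g₁ g₂ : List (Gate F)) :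
    wireVals v (g₁ ++ g₂) = evalGates g₂ (wireVals v g₁) := evalGates_append _ _ _

/-- The wires have the given values. -/
def Represents (v : Fin n → F) (gates : List (Gate F)) (wires : List ℕ) (val : List F) : Prop :=
  (∀ i ∈ wires, i < n + gates.length) ∧ wires.map (fun i => (wireVals v gates).getD i 0) = val

theorem Represents.append {gates : List (Gate F)} {wires : List ℕ} {val : List F}
    (h : Represents v gates wires val) (g : List (Gate F)) :
    Represents v (gates ++ g) wires val := by
  refine ⟨fun i hi => (h.1 i hi).trans_le (by simp), ?_⟩
  rw [← h.2]
  refine List.map_congr_left fun i hi => ?_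
  rw [wireVals_append, getD_evalGates]
  rw [length_wireVals]
  exact h.1 i hi

theorem Represents.length {gates : List (Gate F)} {wires : List ℕ} {val : List F}
    (h : Represents v gates wires val) : wires.length = val.length := by
  rw [← h.2, List.length_map]

theorem Represents.getD {gates : List (Gate F)} {wires : List ℕ} {val : List F}
    (h : Represents v gates wires val) {i : ℕ} (hi : i < val.length) (d : ℕ) :
    wires.getD i d < n + gates.length ∧
      (wireVals v gates).getD (wires.getD i d) 0 = val.getD i 0 := by
  have hl := h.length
  obtain ⟨h1, rfl⟩ := h
  rw [List.getD_eq_getElem wires _ (by omega)]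
  refine ⟨h1 _ (List.getElem_mem _), ?_⟩
  rw [List.getD_eq_getElem (List.map _ _) 0 hi]
  simp

/-- The blocks in the queue of the builder have the given values, and the wire `n` is zero. -/
structure Sim (v : Fin n → F) (s : Builder F) (q : List (List F)) : Prop where
  pos : 0 < s.1.length
  zero : (wireVals v s.1).getD n 0 = 0
  queue : List.Forall₂ (Represents v s.1) s.2 q

theorem nextWires_represents {gates g : List (Gate F)} {val : List F}
    (h : wireVals v (gates ++ g) = wireVals v gates ++ val) :
    Represents v (gates ++ g) (nextWires n val.length gates) val := by
  have hl : val.length = g.length := by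
    have := congrArg List.length h
    simp only [length_wireVals, List.length_append] at this
    omega
  refine ⟨fun i hi => ?_, ?_⟩
  · obtain ⟨j, hj, rfl⟩ := List.mem_map.1 hi
    have := List.mem_range.1 hj
    simp only [List.length_append]
    omega
  · rw [h]
    refine List.ext_getElem (by simp [nextWires]) fun i h1 h2 => ?_
    simp only [nextWires, List.map_map, List.getElem_map, List.getElem_range, Function.comp_apply]
    rw [List.getD_append_right _ _ _ _ (by rw [length_wireVals]; omega), length_wireVals,
      Nat.add_sub_cancel_left, List.getD_eq_getElem _ _ h2]

theorem Sim.zero_append {s : Builder F} {q : List (List F)} (h : Sim v s q) (g : List (Gate F)) :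
    (wireVals v (s.1 ++ g)).getD n 0 = 0 := by
  rw [wireVals_append, getD_evalGates, h.zero]
  have := h.pos
  rw [length_wireVals]; omega

theorem Sim.addStep {s : Builder F} {a b : List F} {q : List (List F)} (h : Sim v s (a :: b :: q))
    (hab : a.length = b.length) :
    Sim v (addStep n s) (q ++ [List.zipWith (· + ·) a b]) ∧
      (Trapdoor.addStep n s).1.length = s.1.length + a.length := by
  obtain ⟨g, Q⟩ := s
  have h0 := h
  obtain ⟨hpos, hzero, hq⟩ := h
  simp only at hpos hzero hq
  obtain ⟨wa, Q', ha, hq', rfl⟩ := List.forall₂_cons_right_iff.1 hq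
  obtain ⟨wb, Q'', hb, hq'', rfl⟩ := List.forall₂_cons_right_iff.1 hq'
  have hla := ha.length
  refine ⟨⟨?_, h0.zero_append _, ?_⟩, ?_⟩
  · simp [Trapdoor.addStep]; omega
  · simp only [Trapdoor.addStep, List.tail_cons, List.headD_cons]
    refine List.rel_append (List.Forall₂.imp (fun _ _ h => h.append _) hq'')
      (List.Forall₂.cons ?_ List.Forall₂.nil)
    rw [show wa.length = (List.zipWith (· + ·) a b).length by simp [hla, hab]]
    refine nextWires_represents ?_
    rw [wireVals_append, evalGates_eq_append]
    · congr 1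
      refine List.ext_getElem (by simp) fun i h1 h2 => ?_
      simp only [List.length_zipWith] at h2
      simp only [List.map_map, List.getElem_map, List.getElem_range, Function.comp_apply,
        Gate.eval, List.getElem_zipWith]
      rw [(ha.getD (by omega) n).2, (hb.getD (by omega) n).2, List.getD_eq_getElem a 0 (by omega),
        List.getD_eq_getElem b 0 (by omega)]
    · intro gt hgt w'
      obtain ⟨i, hi, rfl⟩ := List.mem_map.1 hgt
      simp only [List.length_zipWith, List.mem_range] at hi
      refine eval_add_append ?_ ?_ w'
      · rw [length_wireVals]; exact (ha.getD (by omega) n).1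
      · rw [length_wireVals]; exact (hb.getD (by omega) n).1
  · simp [Trapdoor.addStep, hla]

theorem Sim.encodeStep {s : Builder F} {a : List F} {q : List (List F)} (h : Sim v s (a :: q))
    (C : Code F) :
    Sim v (encodeStep n s C) (q ++ [C.2.map fun o => (evalGates C.1 a).getD o 0]) ∧
      (Trapdoor.encodeStep n s C).1.length = s.1.length + C.1.length := by
  obtain ⟨g, Q⟩ := s
  have h0 := h
  obtain ⟨hpos, hzero, hq⟩ := h
  simp only at hpos hzero hq
  obtain ⟨wa, Q', ha, hq', rfl⟩ := List.forall₂_cons_right_iff.1 hq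
  have hla := ha.length
  refine ⟨⟨?_, h0.zero_append _, ?_⟩, ?_⟩
  · simp [Trapdoor.encodeStep]; omega
  · simp only [Trapdoor.encodeStep, List.tail_cons, List.headD_cons]
    refine List.rel_append (List.Forall₂.imp (fun _ _ h => h.append _) hq')
      (List.Forall₂.cons ?_ List.Forall₂.nil)
    set W := wa ++ nextWires n C.1.length g with hW
    have hWl : W.length = wa.length + C.1.length := by simp [hW, nextWires]
    have hWa : ∀ i < wa.length, W.getD i n < n + g.length := fun i hi => by
      rw [hW, List.getD_append _ _ _ _ hi]
      exact (ha.getD (by omega) n).1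
    have hWb : ∀ t < C.1.length, W.getD (wa.length + t) n = n + g.length + t := fun t ht => by
      rw [hW, List.getD_append_right _ _ _ _ (by omega), Nat.add_sub_cancel_left,
        List.getD_eq_getElem _ _ (by simpa [nextWires] using ht)]
      simp [nextWires]
    have key := evalGates_rewire hWl hWa hWb (by omega) C.1 (wireVals v g) a 0 (by omega)
      (length_wireVals v g) (by omega) hzero ?_
    · refine ⟨fun i hi => ?_, ?_⟩
      · obtain ⟨o, -, rfl⟩ := List.mem_map.1 hi
        simp only [List.length_append, List.length_map]
        rcases Nat.lt_or_ge o wa.length with ho | ho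
        · have := hWa o ho; omega
        · obtain ⟨t, rfl⟩ := Nat.exists_eq_add_of_le ho
          rcases Nat.lt_or_ge t C.1.length with ht | ht
          · rw [hWb t ht]; omega
          · rw [List.getD_eq_default _ _ (by omega)]; omega
      · rw [List.map_map]
        refine List.map_congr_left fun o _ => ?_
        rw [Function.comp_apply, wireVals_append]
        exact key o
    -- Before any spliced gate is evaluated, the first wires carry `a`. All others read zero, in
    -- agreement with the convention that a missing wire is zero.
    · intro i
      rcases Nat.lt_or_ge i wa.length with hi | hi
      · rw [hW, List.getD_append _ _ _ _ hi]
        exact (ha.getD (by omega) n).2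
      · rw [List.getD_eq_default a _ (by omega)]
        obtain ⟨t, rfl⟩ := Nat.exists_eq_add_of_le hi
        rcases Nat.lt_or_ge t C.1.length with ht | ht
        · rw [hWb t ht, List.getD_eq_default _ _ (by rw [length_wireVals]; omega)]
        · rw [List.getD_eq_default W _ (by omega)]; exact hzero
  · simp [Trapdoor.encodeStep]

end Simulation
end Trapdoor

namespace Trapdoor

/-! ### Products of groups of columns, through additions and encodings -/

section Correctness

variable {F : Type*} [Field F] [Finite F] {n : ℕ} {v : Fin n → F}

/-- The input `v`, continued by zero. -/
def inputVal (v : Fin n → F) (c : ℕ) : F := (List.ofFn v).getD c 0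

/-- The product of the `i`-th group of `w` columns, of length `r`, with the inputs. -/
def blockVal (v : Fin n → F) (r w : ℕ) (cols : List (List F)) (i : ℕ) : List F :=
  (List.range r).map fun x =>
    ∑ j ∈ Finset.range w, (cols.getD (i * w + j) []).getD x 0 * inputVal v (i * w + j)

theorem length_blockVal (r w : ℕ) (cols : List (List F)) (i : ℕ) :
    (blockVal v r w cols i).length = r := by simp [blockVal]

/-- Neighbouring groups `2i` and `2i + 1` of width `w` together are the group `i` of width `2w`. -/
theorem zipWith_blockVal (r w : ℕ) (cols : List (List F)) (i : ℕ) :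
    List.zipWith (· + ·) (blockVal v r w cols (2 * i)) (blockVal v r w cols (2 * i + 1)) =
      blockVal v r (2 * w) cols i := by
  refine List.ext_getElem (by simp [blockVal]) fun x h1 h2 => ?_
  simp only [blockVal, List.getElem_zipWith, List.getElem_map, List.getElem_range]
  rw [two_mul w, Finset.sum_range_add]
  congr 1
  · refine Finset.sum_congr rfl fun j _ => ?_
    rw [show 2 * i * w + j = i * (w + w) + j by ring]
  · refine Finset.sum_congr rfl fun j _ => ?_
    rw [show (2 * i + 1) * w + j = i * (w + w) + (w + j) by ring]

/-- The queue of the builder holds the products of the `q` groups of `w` columns. -/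
def SimBlocks (v : Fin n → F) (s : Builder F) (r w q : ℕ) (cols : List (List F)) : Prop :=
  Sim v s ((List.range q).map (blockVal v r w cols))

/-- The state after `t` additions. -/
theorem Sim.adds {s : Builder F} {r w h : ℕ} {cols : List (List F)}
    (hs : SimBlocks v s r w (2 * h) cols) (t : ℕ) (ht : t ≤ h) :
    Sim v ((List.replicate t ((true, [], []) : Instr F)).foldl (buildStep n) s)
      ((List.range' (2 * t) (2 * (h - t))).map (blockVal v r w cols) ++
        (List.range t).map (blockVal v r (2 * w) cols)) ∧
    ((List.replicate t ((true, [], []) : Instr F)).foldl (buildStep n) s).1.length =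
      s.1.length + t * r := by
  induction t with
  | zero =>
    refine ⟨?_, by simp⟩
    simpa [SimBlocks, List.range_eq_range'] using hs
  | succ t ih =>
    obtain ⟨ih1, ih2⟩ := ih (by omega)
    rw [List.replicate_succ', List.foldl_append]
    simp only [List.foldl_cons, List.foldl_nil, buildStep, cond_true]
    rw [show 2 * (h - t) = 2 * (h - (t + 1)) + 1 + 1 by omega, List.range'_succ,
      List.range'_succ, List.map_cons, List.map_cons, List.cons_append, List.cons_append] at ih1
    have := ih1.addStep (by simp only [length_blockVal])
    refine ⟨?_, ?_⟩
    · convert this.1 using 1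
      rw [zipWith_blockVal, List.range_succ, List.map_append, List.append_assoc]
      rfl
    · rw [this.2, ih2, length_blockVal]; ring

/-- One pass through the queue halves the number of blocks and doubles their width. However many
passes there are, an addition removes exactly one block, which fixes the number of instructions. -/
theorem SimBlocks.adds_pow (a : ℕ) {s : Builder F} {r w q : ℕ} {cols : List (List F)}
    (hs : SimBlocks v s r w (2 ^ a * q) cols) :
    SimBlocks v ((List.replicate (2 ^ a * q - q) ((true, [], []) : Instr F)).foldl (buildStep n) s)
      r (2 ^ a * w) q cols ∧
    ((List.replicate (2 ^ a * q - q) ((true, [], []) : Instr F)).foldl (buildStep n) s).1.length =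
      s.1.length + (2 ^ a * q - q) * r := by
  induction a generalizing s w with
  | zero => simpa using hs
  | succ a ih =>
    have h1 : 2 ^ (a + 1) * q = 2 * (2 ^ a * q) := by ring
    rw [h1] at hs ⊢
    have h2 := Sim.adds hs (2 ^ a * q) le_rfl
    have h3 : q ≤ 2 ^ a * q := Nat.le_mul_of_pos_left _ (by positivity)
    rw [show 2 * (2 ^ a * q) - q = 2 ^ a * q + (2 ^ a * q - q) by omega, List.replicate_add,
      List.foldl_append]
    obtain ⟨h4, h5⟩ := ih (s := (List.replicate (2 ^ a * q) (true, [], [])).foldl (buildStep n) s)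
      (w := 2 * w) (by simpa [SimBlocks] using h2.1)
    refine ⟨?_, ?_⟩
    · rwa [show 2 ^ (a + 1) * w = 2 ^ a * (2 * w) by ring]
    · rw [h5, h2.2]; ring

theorem dot_eq_sum (r c : List F) :
    dot r c = ∑ y ∈ Finset.range r.length, r.getD y 0 * c.getD y 0 := by
  unfold dot
  induction r.length with
  | zero => simp
  | succ n ih => rw [List.range_succ, List.map_append, List.sum_append, ih, Finset.sum_range_succ]; simp

theorem evalGates_codeOf {K : CodeFamily F} {m : ℕ}
    {MC : Matrix (Fin m) (Fin (K.dim m)) F × Circuit F (K.dim m) m}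
    (h : MC ∈ (K.gen.dist m).support) {a : List F} (ha : a.length = K.dim m) (x : Fin m) :
    (evalGates MC.2.gates a).getD (MC.2.outputs x) 0 = dot (List.ofFn fun j => MC.1 x j) a := by
  have := congrFun (K.gen.correct m MC h fun j => a.getD j 0) x
  have hofn : List.ofFn (fun j : Fin (K.dim m) => a.getD j 0) = a := by
    refine List.ext_getElem (by simp [ha]) fun i h1 h2 => by simp [h2]
  rw [Circuit.eval, hofn] at this
  rw [evalGates, this, dot_eq_sum, List.length_ofFn, Finset.sum_range, Matrix.mulVec, dotProduct]
  refine Finset.sum_congr rfl fun j _ => ?_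
  simp

theorem mem_encodeBlock {K : CodeFamily F} {m : ℕ} {cols : List (List F)}
    {x : List (List F) × Code F} (h : x ∈ (encodeBlock K m cols).support) :
    ∃ MC ∈ (K.gen.dist m).support, ∃ z : List (List F × ℕ), z.length = m ∧
      (∀ y ∈ z, ∃ i : Fin m, y = (List.ofFn fun j => MC.1 i j, MC.2.outputs i)) ∧
      x = (cols.map fun c => z.map fun r => dot r.1 c, (MC.2.gates, z.map Prod.snd)) := by
  simp only [encodeBlock, PMF.mem_support_bind_iff, PMF.mem_support_map_iff] at h
  obtain ⟨g, hg, z, hz, rfl⟩ := h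
  obtain ⟨MC, hMC, rfl⟩ := mem_support_sample hg
  have hp := perm_of_mem_shuffle hz
  refine ⟨MC, hMC, z, ?_, ?_, rfl⟩
  · have := hp.length_eq
    simpa [pairUp, length_rowsOf] using this
  · intro y hy
    have := hp.mem_iff.1 hy
    simp only [pairUp, List.mem_map, List.mem_range, length_rowsOf] at this
    obtain ⟨i, hi, rfl⟩ := this
    refine ⟨⟨i, hi⟩, ?_⟩
    simp [rowsOf, codeOf, hi]

theorem getD_flatMap {α : Type*} {l : List α} {f : α → List (List F)} {w : ℕ}
    (h : ∀ a ∈ l, (f a).length = w) {i j : ℕ} (hi : i < l.length) (hj : j < w) :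
    (l.flatMap f).getD (i * w + j) [] = (f l[i]).getD j [] := by
  induction l generalizing i with
  | nil => simp at hi
  | cons a l ih =>
    rw [List.flatMap_cons]
    have ha := h a (by simp)
    cases i with
    | zero =>
      rw [zero_mul, zero_add, List.getD_append _ _ _ _ (by omega)]; rfl
    | succ i =>
      rw [List.getD_append_right _ _ _ _ (by rw [ha, Nat.succ_mul]; omega), ha,
        show (i + 1) * w + j - w = i * w + j by rw [Nat.succ_mul]; omega,
        ih (fun a ha => h a (by simp [ha])) (by simpa using hi)]
      rfl

/-- The encoding of the value of a group of columns is the value of the encoded columns. -/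
theorem map_dot_blockVal {k m w : ℕ} (cols cols' : List (List F)) (i i' : ℕ) (rows : List (List F))
    (hr : rows.length = m) (hk : ∀ r ∈ rows, r.length = k)
    (hc : ∀ j < w, cols'.getD (i' * w + j) [] = rows.map fun r => dot r (cols.getD (i * w + j) []))
    (hv : ∀ j < w, inputVal v (i' * w + j) = inputVal v (i * w + j)) :
    rows.map (fun r => dot r (blockVal v k w cols i)) = blockVal v m w cols' i' := by
  refine List.ext_getElem (by simp [blockVal, hr]) fun x h1 h2 => ?_
  simp only [List.length_map] at h1
  simp only [List.getElem_map, blockVal, List.getElem_range]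
  rw [dot_eq_sum, hk _ (List.getElem_mem h1)]
  have : ∀ j ∈ Finset.range w, (cols'.getD (i' * w + j) []).getD x 0 * inputVal v (i' * w + j) =
      ∑ y ∈ Finset.range k, (rows[x].getD y 0 * (cols.getD (i * w + j) []).getD y 0) *
        inputVal v (i * w + j) := by
    intro j hj
    have hj := Finset.mem_range.1 hj
    rw [hc j hj, hv j hj, List.getD_eq_getElem _ 0 (by simpa using h1), List.getElem_map,
      dot_eq_sum, hk _ (List.getElem_mem h1), Finset.sum_mul]
  -- Exchanging the two sums is the associativity `(GS)x = G(Sx)`.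
  rw [Finset.sum_congr rfl this, Finset.sum_comm]
  refine Finset.sum_congr rfl fun y hy => ?_
  rw [List.getD_eq_getElem (List.map _ _) 0 (by simpa using hy)]
  simp only [List.getElem_map, List.getElem_range, Finset.mul_sum, mul_assoc]

theorem SimBlocks.encode {K : CodeFamily F} {s : Builder F} {m w q E : ℕ} {cols : List (List F)}
    (hs : SimBlocks v s (K.dim m) w q cols)
    (hE : ∀ MC ∈ (K.gen.dist m).support, MC.2.gates.length ≤ E)
    {res : List (List (List F) × Code F)} (hres : res ∈ (encodeBlocks K m w q cols).support) :
    SimBlocks v ((res.map fun x => ((false, x.2) : Instr F)).foldl (buildStep n) s) m w q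
      (res.flatMap Prod.fst) ∧
    ((res.map fun x => ((false, x.2) : Instr F)).foldl (buildStep n) s).1.length ≤
      s.1.length + q * E := by
  have hres' := mem_support_mapP.1 hres
  have hlen : res.length = q := by simpa using hres'.length_eq.symm
  have hblk : ∀ i (hi : i < res.length), res[i] ∈ (encodeBlock K m (chunk w cols i)).support := by
    intro i hi
    have := List.Forall₂.get hres' (by simpa using hi.trans_eq hlen) hi
    simpa using this
  have hw : ∀ x ∈ res, x.1.length = w := by
    intro x hx
    obtain ⟨i, -, h⟩ := exists_of_mem_mapP hres hx
    rw [(shape_of_mem_encodeBlock h).1]; simp [chunk]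
  -- Midway, the queue holds the blocks still to be encoded, followed by those already encoded;
  -- after `q` steps it is in order again.
  have key : ∀ t ≤ q,
      Sim v (((res.take t).map fun x => ((false, x.2) : Instr F)).foldl (buildStep n) s)
        ((List.range' t (q - t)).map (blockVal v (K.dim m) w cols) ++
          (List.range t).map (blockVal v m w (res.flatMap Prod.fst))) ∧
      (((res.take t).map fun x => ((false, x.2) : Instr F)).foldl (buildStep n) s).1.length ≤
        s.1.length + t * E := by
    intro t ht
    induction t with
    | zero =>
      refine ⟨?_, by simp⟩
      simpa [SimBlocks, List.range_eq_range'] using hs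
    | succ t ih =>
      obtain ⟨ih1, ih2⟩ := ih (by omega)
      have htl : t < res.length := by omega
      rw [List.take_succ_eq_append_getElem htl, List.map_append, List.foldl_append]
      simp only [List.map_cons, List.map_nil, List.foldl_cons, List.foldl_nil, buildStep,
        cond_false]
      rw [show q - t = q - (t + 1) + 1 by omega, List.range'_succ, List.map_cons,
        List.cons_append] at ih1
      obtain ⟨h1, h2⟩ := ih1.encodeStep res[t].2
      obtain ⟨MC, hMC, z, hz1, hz2, hz⟩ := mem_encodeBlock (hblk t htl)
      refine ⟨?_, ?_⟩
      · convert h1 using 1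
        rw [List.range_succ, List.map_append, List.append_assoc]
        congr 2
        simp only [List.map_cons, List.map_nil]
        congr 1
        symm
        rw [← map_dot_blockVal (k := K.dim m) cols (res.flatMap Prod.fst) t t (z.map Prod.fst) (by simpa using hz1)
          ?_ ?_ (fun _ _ => rfl), hz]
        rotate_right 2
        · intro r hr
          obtain ⟨y, hy, rfl⟩ := List.mem_map.1 hr
          obtain ⟨i, rfl⟩ := hz2 y hy
          simp
        · intro j hj
          rw [getD_flatMap hw htl hj, hz]
          simp [chunk, hj, Function.comp_def]
        simp only [List.map_map]
        refine List.map_congr_left fun y hy => ?_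
        obtain ⟨i, rfl⟩ := hz2 y hy
        exact evalGates_codeOf hMC (length_blockVal _ _ _ _) i
      · have h3 : res[t].2.1.length ≤ E := by rw [hz]; exact hE MC hMC
        rw [h2, Nat.succ_mul]
        omega
  have := key q le_rfl
  rw [← hlen, List.take_length, hlen] at this
  simpa [SimBlocks] using this

end Correctness
end Trapdoor

namespace Trapdoor

/-! ### Correctness and size of the whole circuit -/

section Correctness

variable {F : Type*} [Field F] [Finite F] {n : ℕ} {v : Fin n → F}

/-- There are more columns than inputs. A column without an input is multiplied by the wire `n`,
which carries zero. -/
theorem columnGates_represents {r c : ℕ} {g : List (Gate F)} (col : List F)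
    (hlen : n + g.length = baseWire n r c) (hpos : 0 < g.length)
    (hz : (wireVals v g).getD n 0 = 0) :
    Represents v (g ++ columnGates n r c col) ((List.range r).map fun i => baseWire n r c + r + i)
      ((List.range r).map fun x => col.getD x 0 * inputVal v c) := by
  set g₁ := g ++ (List.range r).map (fun i => (Gate.const (col.getD i 0) : Gate F)) with hg₁
  have hv₁ : wireVals v g₁ = wireVals v g ++ (List.range r).map fun i => col.getD i 0 := by
    rw [hg₁, wireVals_append, evalGates_eq_append]
    · simp [Gate.eval, Function.comp_def]
    · intro g hg w'
      obtain ⟨i, -, rfl⟩ := List.mem_map.1 hg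
      rfl
  have hl₁ : g₁.length = g.length + r := by simp [hg₁]
  have hin : (if c < n then c else n) < (wireVals v g).length ∧
      (wireVals v g).getD (if c < n then c else n) 0 = inputVal v c := by
    rw [length_wireVals]
    split_ifs with hc
    · refine ⟨by omega, ?_⟩
      rw [wireVals, getD_evalGates (by simpa using hc), inputVal]
    · refine ⟨by omega, ?_⟩
      rw [hz, inputVal, List.getD_eq_default _ _ (by simpa using hc)]
  have h2 : wireVals v (g₁ ++ (List.range r).map fun i =>
      Gate.mul (baseWire n r c + i) (if c < n then c else n)) =
      wireVals v g₁ ++ (List.range r).map fun x => col.getD x 0 * inputVal v c := by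
    rw [wireVals_append, evalGates_eq_append]
    · rw [List.map_map]
      congr 1
      refine List.map_congr_left fun i hi => ?_
      have hi := List.mem_range.1 hi
      simp only [Function.comp_apply, Gate.eval]
      rw [hv₁, List.getD_append _ _ _ _ hin.1, hin.2,
        List.getD_append_right _ _ _ _ (by rw [length_wireVals]; omega), length_wireVals, hlen,
        Nat.add_sub_cancel_left, List.getD_eq_getElem (List.map _ _) 0 (by simpa using hi)]
      simp
    · intro gt hgt w'
      obtain ⟨i, hi, rfl⟩ := List.mem_map.1 hgt
      have hi := List.mem_range.1 hi
      have h3 := hin.1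
      simp only [Gate.eval]
      rw [List.getD_append, List.getD_append]
      · rw [hv₁, List.length_append]; omega
      · rw [length_wireVals, hl₁]; omega
  have := nextWires_represents h2
  convert this using 1
  · simp only [hg₁, columnGates, List.append_assoc]
  · simp only [nextWires, List.length_map, List.length_range, hl₁]
    refine List.map_congr_left fun i _ => ?_
    omega

theorem length_columnGates (n r c : ℕ) (col : List F) : (columnGates n r c col).length = 2 * r := by
  simp [columnGates]; omega

theorem length_flatMap_columnGates (n r t : ℕ) (cols : List (List F)) :
    ((List.range t).flatMap fun c => columnGates n r c (cols.getD c [])).length = t * (2 * r) := by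
  induction t with
  | zero => simp
  | succ t ih => simp [List.range_succ, length_columnGates, Nat.succ_mul]

theorem simBlocks_buildInit (v : Fin n → F) (r : ℕ) (cols : List (List F)) :
    SimBlocks v (buildInit n r cols) r 1 cols.length cols ∧
      (buildInit n r cols).1.length = 1 + cols.length * (2 * r) := by
  have key : ∀ t, Sim v (Gate.const 0 :: (List.range t).flatMap fun c =>
      columnGates n r c (cols.getD c []),
      (List.range t).map fun c => (List.range r).map fun i => baseWire n r c + r + i)
      ((List.range t).map (blockVal v r 1 cols)) := by
    intro t
    induction t with
    | zero =>
      refine ⟨by simp, ?_, by simp⟩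
      simp [wireVals, evalGates, Gate.eval]
    | succ t ih =>
      have hl := length_flatMap_columnGates n r t cols
      simp only [List.range_succ, List.flatMap_append, List.flatMap_singleton, List.map_append,
        List.map_cons, List.map_nil]
      refine ⟨by simp, ih.zero_append (columnGates n r t (cols.getD t [])), ?_⟩
      refine List.rel_append (List.Forall₂.imp (fun _ _ h => h.append _) ih.queue)
        (List.Forall₂.cons ?_ List.Forall₂.nil)
      have := columnGates_represents (v := v) (c := t) (r := r) (cols.getD t []) (g := Gate.const 0 ::
        (List.range t).flatMap fun c => columnGates n r c (cols.getD c []))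
        (by simp only [List.length_cons, hl, baseWire]; omega) (by simp) ih.zero
      have e : blockVal v r 1 cols t =
          (List.range r).map fun x => (cols.getD t []).getD x 0 * inputVal v t := by
        unfold blockVal
        simp only [Finset.sum_range_one, mul_one, add_zero]
      rw [e, ← List.cons_append]
      exact this
  refine ⟨key _, ?_⟩
  simp only [buildInit, List.length_cons, length_flatMap_columnGates]
  omega

/-- `acc` is the sequence of numbers above `th` in the chain of dimensions from `n` to `r`. -/
def IsChain (K : CodeFamily F) (th n : ℕ) : ℕ → List ℕ → Prop
  | r, [] => r = n
  | r, m :: up => r = K.dim m ∧ th < m ∧ IsChain K th n m up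

theorem isChain_iterate (K : CodeFamily F) (th n i : ℕ) :
    IsChain K th n ((chainStep K th)^[i] ([], n)).2 ((chainStep K th)^[i] ([], n)).1 := by
  induction i with
  | zero => rfl
  | succ i ih =>
    rw [Function.iterate_succ_apply', chainStep]
    split_ifs with h
    · exact ⟨rfl, h, ih⟩
    · exact ih

theorem isChain_chain (K : CodeFamily F) (th n : ℕ) :
    IsChain K th n (chain K th n).2 (chain K th n).1 := isChain_iterate K th n n

theorem IsChain.le {K : CodeFamily F} {th n r : ℕ} {acc : List ℕ} (h : IsChain K th n r acc) :
    r ≤ n := by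
  induction acc generalizing r with
  | nil => exact le_of_eq (show r = n from h)
  | cons m up ih => rw [h.1]; exact (K.dim_le m).trans (ih h.2.2)

/-- A bound for the number of gates that encode the levels. -/
def levelCost (K : CodeFamily F) (E : ℕ → ℕ) (N : ℕ) (acc : List ℕ) : ℕ :=
  (acc.map fun m => N / halfPow (K.dim m) * (E m + m)).sum

/-- The state of the sampler and the builder agree on the input `v`. -/
structure Good (v : Fin n → F) (s₀ : Builder F) (r L e : ℕ)
    (st : List (List F) × List (Instr F) × ℕ) : Prop where
  count : st.2.2 * 2 ^ e = width n
  exp : e ≤ Nat.log 2 r - 1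
  sim : SimBlocks v (st.2.1.foldl (buildStep n) s₀) r (2 ^ e) st.2.2 st.1
  cost : (st.2.1.foldl (buildStep n) s₀).1.length + st.2.2 * r ≤ L

theorem width_eq (n : ℕ) : width n = 2 ^ (Nat.log 2 n + 1) := by rw [width, pow_succ]; ring

theorem count_eq {q e E : ℕ} (h : q * 2 ^ e = 2 ^ E) (he : e ≤ E) : q = 2 ^ (E - e) := by
  refine Nat.eq_of_mul_eq_mul_right (pow_pos two_pos e) ?_
  rw [h, ← pow_add, Nat.sub_add_cancel he]

/-- The field `cost` holds a reserve of one gate for each entry of each block. Merging `q` blocks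
into `q'` takes `(q - q') * K.dim m` additions and is paid from the reserve; the level itself is
charged for `q'` encodings and a new reserve `q' * m`. The field `exp` guarantees that the old
groups are no wider than the new ones, so that groups only have to be merged. -/
theorem Good.level {K : CodeFamily F} {s₀ : Builder F} {r L e m E : ℕ}
    {st st' : List (List F) × List (Instr F) × ℕ} (h : Good v s₀ r L e st) (hr : r = K.dim m)
    (hm : m ≤ n) (hE : ∀ MC ∈ (K.gen.dist m).support, MC.2.gates.length ≤ E)
    (hst' : st' ∈ (level K (width n) st m).support) :
    ∃ e', Good v s₀ m (L + width n / halfPow (K.dim m) * (E + m)) e' st' := by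
  subst hr
  obtain ⟨cols, ins, q⟩ := st
  obtain ⟨h1, h2, h3, h4⟩ := h
  obtain ⟨res, hres, rfl⟩ := (PMF.mem_support_map_iff _ _ _).1 hst'
  simp only at h1 h2 h3 h4 hres ⊢
  set e' := Nat.log 2 (K.dim m) - 1 with he'
  have hw : halfPow (K.dim m) = 2 ^ e' := rfl
  rw [width_eq] at h1 hres
  rw [width_eq]
  rw [hw] at hres ⊢
  set N := Nat.log 2 n + 1
  have heN : e' ≤ N := by
    have := Nat.log_mono_right (b := 2) ((K.dim_le m).trans hm)
    omega
  have hq := count_eq h1 (h2.trans heN)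
  rw [Nat.pow_div heN two_pos] at hres ⊢
  set q' := 2 ^ (N - e')
  have hqq : q = 2 ^ (e' - e) * q' := by rw [hq, ← pow_add]; congr 1; omega
  rw [hqq] at h3
  obtain ⟨a1, a2⟩ := h3.adds_pow
  rw [← hqq, ← pow_add, Nat.sub_add_cancel h2] at a1
  rw [← hqq] at a2
  obtain ⟨b1, b2⟩ := a1.encode hE hres
  refine ⟨e', ?_, ?_, ?_, ?_⟩
  · simp only
    rw [width_eq, ← pow_add, Nat.sub_add_cancel heN]
  · exact Nat.sub_le_sub_right (Nat.log_mono_right (K.dim_le m)) 1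
  · simp only [List.foldl_append]
    exact b1
  · simp only [List.foldl_append]
    have hle : q' ≤ q := by rw [hqq]; exact Nat.le_mul_of_pos_left _ (by positivity)
    have h5 : (q - q') * K.dim m ≤ q * K.dim m := Nat.mul_le_mul_right _ (Nat.sub_le _ _)
    rw [a2] at b2
    rw [Nat.mul_add]
    omega

theorem Good.levels {K : CodeFamily F} {s₀ : Builder F} {th : ℕ} {E : ℕ → ℕ}
    (hE : ∀ m, th < m → ∀ MC ∈ (K.gen.dist m).support, MC.2.gates.length ≤ E m)
    {acc : List ℕ} {r L e : ℕ} {st st' : List (List F) × List (Instr F) × ℕ}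
    (h : Good v s₀ r L e st) (hc : IsChain K th n r acc)
    (hst' : st' ∈ (foldP (Trapdoor.level K (width n)) st acc).support) :
    ∃ e', Good v s₀ n (L + levelCost K E (width n) acc) e' st' := by
  induction acc generalizing r L e st with
  | nil =>
    rw [foldP, PMF.mem_support_pure_iff] at hst'
    subst hst'
    obtain rfl : r = n := hc
    exact ⟨e, by simpa [levelCost] using h⟩
  | cons m up ih =>
    rw [foldP, PMF.mem_support_bind_iff] at hst'
    obtain ⟨st₁, hst₁, hst'⟩ := hst'
    obtain ⟨e₁, h₁⟩ := h.level hc.1 hc.2.2.le (hE m hc.2.1) hst₁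
    obtain ⟨e₂, h₂⟩ := ih h₁ hc.2.2 hst'
    refine ⟨e₂, ?_⟩
    rw [levelCost, List.map_cons, List.sum_cons, ← add_assoc]
    exact h₂

theorem lt_width (n : ℕ) : n < width n := by
  rw [width_eq]; exact Nat.lt_pow_succ_log_self (by norm_num) n

theorem width_le {n : ℕ} (hn : n ≠ 0) : width n ≤ 2 * n :=
  Nat.mul_le_mul_left 2 (Nat.pow_log_le_self 2 hn)

theorem length_of_mem_iid {α : Type*} {μ : PMF α} {n : ℕ} {l : List α}
    (h : l ∈ (iid n μ).support) : l.length = n := by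
  simpa using length_of_mem_mapP h

/-- The remaining blocks are merged into one of full width, which is the product of all columns with
the zero-padded input. The reserve in `cost` pays for these additions as well. -/
theorem stateCode_correct {K : CodeFamily F} {s : ℕ → ℕ} {n : ℕ} {E : ℕ → ℕ}
    (hE : ∀ m, s n < m → ∀ MC ∈ (K.gen.dist m).support, MC.2.gates.length ≤ E m)
    {st : List (List F) × List (List F) × List (Instr F) × ℕ}
    (hst : st ∈ (sampleCols K s n).support) (v : Fin n → F) :
    (codeToCircuit n (stateCode K s n st)).eval v = (colsToMatrix n st.2.1).mulVec v ∧
    (codeToCircuit n (stateCode K s n st)).gates.length ≤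
      1 + 3 * (width n * (chain K (s n) n).2) + levelCost K E (width n) (chain K (s n) n).1 := by
  simp only [sampleCols, PMF.mem_support_bind_iff, PMF.mem_support_map_iff] at hst
  obtain ⟨cols₀, hcols, st, hst, rfl⟩ := hst
  set r := (chain K (s n) n).2 with hr
  have hlen : cols₀.length = width n := length_of_mem_iid hcols
  obtain ⟨i1, i2⟩ := simBlocks_buildInit v r cols₀
  rw [hlen] at i1 i2
  -- The initial state has `1 + 2 * N * r` gates, and its `N` blocks of length `r` need a reserve of
  -- `N * r`.
  have hgood : Good v (buildInit n r cols₀) r (1 + 3 * (width n * r)) 0 (cols₀, [], width n) :=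
    ⟨by simp, Nat.zero_le _, by simpa using i1, by
      simp only [List.foldl_nil, i2]
      apply le_of_eq
      ring⟩
  obtain ⟨e, h1, h2, h3, h4⟩ := hgood.levels hE (isChain_chain K (s n) n) hst
  obtain ⟨cols, ins, q⟩ := st
  simp only at h1 h2 h3 h4 ⊢
  rw [width_eq] at h1
  have heN : e ≤ Nat.log 2 n + 1 := by omega
  have hq := count_eq h1 heN
  -- The factor `1` is the number of blocks wanted at the end, in the form expected by `adds_pow`.
  rw [← mul_one (2 ^ _)] at hq
  rw [hq] at h3
  obtain ⟨a1, a2⟩ := h3.adds_pow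
  rw [← hq, ← pow_add, Nat.sub_add_cancel heN, ← width_eq] at a1
  rw [← hq] at a2
  rw [← List.foldl_append] at a1 a2
  set sf := (ins ++ List.replicate (q - 1) (true, [], [])).foldl (buildStep n) (buildInit n r cols₀)
    with hsf
  have hcode : stateCode K s n (cols₀, cols, ins, q) =
      (sf.1, (List.range n).map fun i => (sf.2.headD []).getD i n) := rfl
  constructor
  · have hqueue := a1.queue
    simp only [List.range_one, List.map_cons, List.map_nil] at hqueue
    obtain ⟨wires, Q, hw, -, hQ⟩ := List.forall₂_cons_right_iff.1 hqueue
    funext i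
    rw [hcode, codeToCircuit]
    simp only [Circuit.eval, hQ, List.headD_cons]
    change (wireVals v sf.1).getD _ 0 = _
    rw [List.getD_eq_getElem (List.map _ _) 0 (by simp), List.getElem_map, List.getElem_range,
      (hw.getD (by rw [length_blockVal]; exact i.2) n).2, blockVal,
      List.getD_eq_getElem (List.map _ _) 0 (by simp), List.getElem_map, List.getElem_range,
      Matrix.mulVec, dotProduct]
    -- Columns with an index from `n` on do not contribute, as their inputs are zero.
    rw [← Finset.sum_subset (Finset.range_subset_range.2 (lt_width n).le), Finset.sum_range]
    · refine Finset.sum_congr rfl fun j _ => ?_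
      simp [colsToMatrix, inputVal]
    · intro j _ hj
      have : n ≤ j := by simpa using hj
      rw [zero_mul, zero_add, show inputVal v j = 0 from
        List.getD_eq_default _ _ (by simpa using this), mul_zero]
  · rw [hcode, codeToCircuit]
    simp only
    rw [a2]
    have : (q - 1) * n ≤ q * n := Nat.mul_le_mul_right _ (Nat.sub_le _ _)
    omega

/-- Correctness needs no particular bound on the encoding circuits, only some bound; the running
time of the sampler provides one. -/
theorem exists_gates_bound (K : CodeFamily F) : ∃ E : ℕ → ℕ, ∀ m,
    ∀ MC ∈ (K.gen.dist m).support, MC.2.gates.length ≤ E m := by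
  obtain ⟨g, -, hg⟩ := K.poly_sample.esize_bound
  refine ⟨g, fun m MC hMC => ?_⟩
  have h1 := hg m (rowsOf MC.1, codeOf MC.2) ((PMF.mem_support_map_iff _ _ _).2 ⟨MC, hMC, rfl⟩)
  rw [esize_pair, esize_mk (codeOf MC.2)] at h1
  have h2 := length_le_esize MC.2.gates
  have : (codeOf MC.2).1 = MC.2.gates := rfl
  rw [this] at h1
  omega

/-- The family of trapdoored matrices built from codes. -/
noncomputable def trapdooredOfCodes (K : CodeFamily F) (s : ℕ → ℕ) (hs : PF s) :
    TrapdooredFamily F (fun n => n) (fun n => n) where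
  dist := sampleDist K s
  correct := by
    intro n MC hMC v
    obtain ⟨st, hst, rfl⟩ := (PMF.mem_support_map_iff _ _ _).1 hMC
    obtain ⟨E, hE⟩ := exists_gates_bound K
    exact (stateCode_correct (fun m _ => hE m) hst v).1
  samplable := exists_sampleDist_prog K hs

theorem trapdooredOfCodes_size {K : CodeFamily F} {s : ℕ → ℕ} (hs : PF s) {n : ℕ} {E : ℕ → ℕ}
    (hE : ∀ m, s n < m → ∀ MC ∈ (K.gen.dist m).support, MC.2.gates.length ≤ E m)
    {MC : Matrix (Fin n) (Fin n) F × Circuit F n n}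
    (h : MC ∈ ((trapdooredOfCodes K s hs).dist n).support) :
    MC.2.size ≤ 2 * n + 1 + 3 * (width n * (chain K (s n) n).2) +
      levelCost K E (width n) (chain K (s n) n).1 := by
  obtain ⟨st, hst, rfl⟩ := (PMF.mem_support_map_iff _ _ _).1 h
  have := (stateCode_correct hE hst 0).2
  simp only [Circuit.size]
  omega

end Correctness
end Trapdoor

namespace Trapdoor

/-! ### Independent samples -/

section Independent

variable {α β γ : Type*}

theorem mapP_map (f : α → PMF β) (g : β → γ) (l : List α) :
    (mapP f l).map (List.map g) = mapP (fun a => (f a).map g) l := by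
  induction l with
  | nil => simp [mapP, PMF.pure_map]
  | cons a l ih =>
    simp only [mapP, PMF.map_bind, PMF.bind_map, ← ih, PMF.map_comp]
    rfl

theorem mapP_comp (f : β → PMF γ) (g : α → β) (l : List α) :
    mapP f (l.map g) = mapP (fun a => f (g a)) l := by
  induction l with
  | nil => rfl
  | cons a l ih => simp only [List.map_cons, mapP, ih]

theorem iid_zero (μ : PMF α) : iid 0 μ = PMF.pure [] := rfl

theorem iid_succ (n : ℕ) (μ : PMF α) :
    iid (n + 1) μ = μ.bind fun a => (iid n μ).map fun l => a :: l := by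
  rw [iid, List.range_succ_eq_map, mapP, mapP_comp]
  rfl

theorem iid_add (m n : ℕ) (μ : PMF α) :
    iid (m + n) μ = (iid m μ).bind fun l => (iid n μ).map fun l' => l ++ l' := by
  induction m with
  | zero =>
    simp only [zero_add, iid_zero, PMF.pure_bind, List.nil_append]
    exact (PMF.map_id _).symm
  | succ m ih =>
    rw [Nat.succ_add, iid_succ, ih, iid_succ]
    simp only [PMF.bind_bind, PMF.map_bind, PMF.bind_map, PMF.map_comp]
    rfl

theorem iid_map (n : ℕ) (μ : PMF α) (f : α → β) : (iid n μ).map (List.map f) = iid n (μ.map f) :=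
  mapP_map _ _ _

theorem bind_congr_support {μ : PMF α} {f g : α → PMF β} (h : ∀ a ∈ μ.support, f a = g a) :
    μ.bind f = μ.bind g := by
  ext b
  rw [PMF.bind_apply, PMF.bind_apply]
  refine tsum_congr fun a => ?_
  by_cases ha : a ∈ μ.support
  · rw [h a ha]
  · rw [PMF.mem_support_iff, not_not] at ha
    rw [ha, zero_mul, zero_mul]

theorem iid_map_take (w t : ℕ) (μ : PMF α) : (iid (w + t) μ).map (List.take w) = iid w μ := by
  rw [iid_add, PMF.map_bind]
  conv_rhs => rw [← PMF.bind_pure (iid w μ)]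
  refine bind_congr_support fun l hl => ?_
  have : List.take w ∘ (fun l' => l ++ l') = Function.const _ l := by
    funext l'
    simp [← length_of_mem_iid hl]
  rw [PMF.map_comp, this, PMF.map_const]

/-- Cutting independent columns into consecutive groups gives independent groups, so a level applied
to random columns produces independent encoded blocks. -/
theorem iid_bind_mapP {F : Type*} [Field F] [Finite F] (q w : ℕ) (μ : PMF (List F))
    (κ : List (List F) → PMF β) :
    ((iid (q * w) μ).bind fun l => mapP (fun i => κ (chunk w l i)) (List.range q)) =
      iid q ((iid w μ).bind κ) := by
  induction q with
  | zero => rw [zero_mul, iid_zero, PMF.pure_bind]; rfl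
  | succ q ih =>
    rw [Nat.succ_mul, add_comm, iid_add, iid_succ, ← ih]
    simp only [PMF.bind_bind, PMF.bind_map, PMF.map_bind]
    refine bind_congr_support fun l hl => ?_
    have hl := length_of_mem_iid hl
    rw [PMF.bind_comm]
    refine congrArg _ (funext fun l' => ?_)
    rw [Function.comp_apply, List.range_succ_eq_map, mapP, mapP_comp]
    have h0 : chunk w (l ++ l') 0 = l := by
      refine List.ext_getElem (by simp [chunk, hl]) fun i h1 h2 => ?_
      simp [chunk, List.getElem?_append_left h2, List.getElem?_eq_getElem h2]
    have h1 : ∀ i, chunk w (l ++ l') (Nat.succ i) = chunk w l' i := by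
      intro i
      unfold chunk
      refine List.map_congr_left fun j _ => ?_
      rw [List.getD_append_right _ _ _ _ (by rw [hl, Nat.succ_mul]; omega), hl, Nat.succ_mul]
      congr 1
      omega
    simp only [h0, h1]

end Independent

/-! ### Uniform matrices and permutations -/

section Uniform

variable {α β : Type*}

theorem uniform_prod [Finite α] [Nonempty α] [Finite β] [Nonempty β] :
    uniform (α × β) = (uniform α).bind fun a => (uniform β).map fun b => (a, b) := by
  classical
  ext ⟨a, b⟩
  rw [PMF.bind_apply, tsum_eq_single a, PMF.map_apply, tsum_eq_single b]
  · simp only [uniform_apply, Nat.card_prod, if_pos]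
    push_cast
    rw [ENNReal.mul_inv (Or.inr (ENNReal.natCast_ne_top _)) (Or.inl (ENNReal.natCast_ne_top _))]
  · intro b' hb'
    rw [if_neg]
    rintro h
    exact hb' (Prod.ext_iff.1 h).2.symm
  · intro a' ha'
    rw [PMF.map_apply, ENNReal.tsum_eq_zero.2, mul_zero]
    intro b'
    rw [if_neg]
    rintro h
    exact ha' (Prod.ext_iff.1 h).1.symm

theorem iid_uniform [Finite α] [Nonempty α] (n : ℕ) :
    iid n (uniform α) = (uniform (Fin n → α)).map List.ofFn := by
  induction n with
  | zero =>
    have : uniform (Fin 0 → α) = PMF.pure Fin.elim0 := by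
      ext a
      rw [uniform_apply, Subsingleton.elim a Fin.elim0]
      simp
    rw [this, PMF.pure_map]
    rfl
  | succ n ih =>
    rw [iid_succ, ih, ← uniform_map_equiv (Fin.consEquiv fun _ : Fin (n + 1) => α), uniform_prod]
    simp only [PMF.map_bind, PMF.map_comp]
    refine congrArg _ (funext fun a => congrArg (fun f => PMF.map f _) (funext fun v => ?_))
    simp [List.ofFn_succ]

theorem iid_iid_uniform (F : Type*) [Field F] [Finite F] (m k : ℕ) :
    iid k (iid m (uniform F)) = (uniform (Matrix (Fin m) (Fin k) F)).map fun C => rowsOf C.transpose := by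
  rw [iid_uniform, ← iid_map, iid_uniform,
    ← uniform_map_equiv (Equiv.piComm fun (_ : Fin m) (_ : Fin k) => F), PMF.map_comp, PMF.map_comp]
  refine congrArg (fun f => PMF.map f _) (funext fun C => ?_)
  simp only [Function.comp_apply, List.map_ofFn, rowsOf]
  rfl

/-- The permutation that sends `i` to the last element and is `π` elsewhere. -/
def insertPerm {n : ℕ} (π : Equiv.Perm (Fin n)) (i : Fin (n + 1)) : Equiv.Perm (Fin (n + 1)) :=
  (finSuccEquiv' i).trans ((Equiv.optionCongr π).trans finSuccEquivLast.symm)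

theorem insertPerm_self {n : ℕ} (π : Equiv.Perm (Fin n)) (i : Fin (n + 1)) :
    insertPerm π i i = Fin.last n := by simp [insertPerm]

theorem insertPerm_succAbove {n : ℕ} (π : Equiv.Perm (Fin n)) (i : Fin (n + 1)) (j : Fin n) :
    insertPerm π i (i.succAbove j) = (π j).castSucc := by simp [insertPerm]

theorem insertPerm_bijective (n : ℕ) : Function.Bijective
    fun p : Equiv.Perm (Fin n) × Fin (n + 1) => insertPerm p.1 p.2 := by
  rw [Fintype.bijective_iff_injective_and_card]
  constructor
  · rintro ⟨π, i⟩ ⟨π', i'⟩ h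
    simp only at h
    have hi : i = i' := by
      refine (insertPerm π i).injective ?_
      rw [insertPerm_self, h, insertPerm_self]
    subst hi
    have : π = π' := by
      ext j
      have := congrArg (fun e : Equiv.Perm (Fin (n + 1)) => e (i.succAbove j)) h
      simp only [insertPerm_succAbove] at this
      exact congrArg Fin.val (Fin.castSucc_injective n this)
    rw [this]
  · simp [Fintype.card_perm, Nat.factorial_succ, mul_comm]

theorem foldP_append {σ : Type*} (f : σ → α → PMF σ) (s : σ) (l l' : List α) :
    foldP f s (l ++ l') = (foldP f s l).bind fun s' => foldP f s' l' := by
  induction l generalizing s with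
  | nil => simp [foldP]
  | cons a l ih => simp [foldP, ih]

/-- Inserting the last element at a uniform position turns a uniform permutation of `n` elements
into one of `n + 1`, because `insertPerm` is a bijection on pairs of a permutation and a position.
-/
theorem shuffle_ofFn {n : ℕ} (f : Fin n → α) :
    shuffle (List.ofFn f) = (uniform (Equiv.Perm (Fin n))).map fun π => List.ofFn fun i => f (π i) := by
  induction n with
  | zero =>
    have : (fun π : Equiv.Perm (Fin 0) => List.ofFn fun i => f (π i)) = Function.const _ [] := by
      funext π; simp
    rw [this, PMF.map_const]
    rfl
  | succ n ih =>
    rw [List.ofFn_succ', List.concat_eq_append, shuffle, foldP_append]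
    change (shuffle (List.ofFn fun i => f i.castSucc)).bind _ = _
    rw [ih, ← uniform_map_equiv (Equiv.ofBijective _ (insertPerm_bijective n)), uniform_prod]
    simp only [PMF.map_bind, PMF.map_comp, PMF.bind_map]
    refine congrArg _ (funext fun π => ?_)
    simp only [Function.comp_apply, foldP, PMF.bind_pure, insertRand, List.length_ofFn]
    rw [randNat_eq_uniform, PMF.map_comp]
    refine congrArg (fun f => PMF.map f _) (funext fun i => ?_)
    simp only [Function.comp_apply, Equiv.ofBijective_apply]
    refine List.ext_getElem ?_ fun j h1 h2 => ?_
    · have := i.2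
      simp only [List.length_append, List.length_take, List.length_cons, List.length_drop,
        List.length_ofFn]
      omega
    · simp only [List.length_ofFn] at h2
      have hi := i.2
      rw [List.getElem_ofFn]
      rcases Fin.eq_self_or_eq_succAbove i ⟨j, h2⟩ with h | ⟨t, ht⟩
      · rw [h, insertPerm_self]
        have hj : j = i := congrArg Fin.val h
        subst hj
        rw [List.getElem_append_right (by simp)]
        simp [Nat.min_eq_left (Nat.lt_succ_iff.1 hi)]
      · rw [ht, insertPerm_succAbove]
        have hj : j = (i.succAbove t : Fin (n + 1)) := congrArg Fin.val ht
        rcases Nat.lt_or_ge t i with hti | hti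
        · have : j = t := by
            rw [hj, Fin.succAbove_of_castSucc_lt _ _ hti]; rfl
          subst this
          rw [List.getElem_append_left (by simp; omega)]
          simp
        · have : j = t + 1 := by
            rw [hj, Fin.succAbove_of_le_castSucc _ _ hti]; rfl
          subst this
          rw [List.getElem_append_right (by simp; omega)]
          have hm : min (i : ℕ) n = i := Nat.min_eq_left (Nat.lt_succ_iff.1 hi)
          simp only [List.length_take, List.length_ofFn, hm]
          rw [List.getElem_cons]
          have : ¬ ((t : ℕ) + 1 - i = 0) := by omega
          simp only [this, dite_false, List.getElem_drop, List.getElem_ofFn]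
          congr 3
          ext
          simp only
          omega

end Uniform
end Trapdoor

namespace Trapdoor

/-! ### Acceptance probabilities -/

section Prob

variable {α β : Type*}

/-- The probability of `true`. -/
noncomputable def prob (μ : PMF Bool) : ℝ := (μ true).toReal

theorem prob_nonneg (μ : PMF Bool) : 0 ≤ prob μ := ENNReal.toReal_nonneg

theorem prob_le_one (μ : PMF Bool) : prob μ ≤ 1 :=
  ENNReal.toReal_le_of_le_ofReal zero_le_one (by simpa using μ.coe_le_one true)

theorem prob_bind (μ : PMF α) (κ : α → PMF Bool) :
    prob (μ.bind κ) = ∑' x, (μ x).toReal * prob (κ x) := by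
  rw [prob, PMF.bind_apply, ENNReal.tsum_toReal_eq]
  · simp only [ENNReal.toReal_mul, prob]
  · exact fun x => ENNReal.mul_ne_top (μ.apply_ne_top x) ((κ x).apply_ne_top _)

theorem hasSum_toReal (μ : PMF α) : HasSum (fun x => (μ x).toReal) 1 := by
  have h := ENNReal.hasSum_toReal (f := μ) (by rw [μ.tsum_coe]; exact ENNReal.one_ne_top)
  rwa [← ENNReal.tsum_toReal_eq μ.apply_ne_top, μ.tsum_coe, ENNReal.toReal_one] at h

theorem summable_prob (μ : PMF α) (κ : α → PMF Bool) :
    Summable fun x => (μ x).toReal * prob (κ x) :=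
  Summable.of_nonneg_of_le (fun _ => mul_nonneg ENNReal.toReal_nonneg (prob_nonneg _))
    (fun _ => mul_le_of_le_one_right ENNReal.toReal_nonneg (prob_le_one _)) (hasSum_toReal μ).summable

theorem map_equiv_apply (μ : PMF α) (e : α ≃ β) (b : β) : (μ.map e) b = μ (e.symm b) := by
  rw [PMF.map_apply, tsum_eq_single (e.symm b)]
  · simp
  · intro a ha
    rw [if_neg]
    rintro rfl
    simp at ha

/-- A distribution that is uniform on a subset is close to the uniform distribution. -/
theorem prob_bind_sub_uniform_le [Fintype α] [Nonempty α] (P : PMF α) (p : α → Prop)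
    [DecidablePred p] (h0 : ∀ v, ¬ p v → P v = 0) (h1 : ∀ u v, p u → p v → P u = P v)
    (κ : α → PMF Bool) : |prob (P.bind κ) - prob ((uniform α).bind κ)| ≤
      1 - (Fintype.card {v // p v} : ℝ) / Fintype.card α := by
  obtain ⟨v₀, hv₀⟩ := P.support_nonempty
  have hp₀ : p v₀ := by
    by_contra h
    exact hv₀ (h0 v₀ h)
  set c := (P v₀).toReal
  set N := (Fintype.card α : ℝ)
  set L := (Fintype.card {v // p v} : ℝ)
  have hN : 0 < N := by simp only [N]; exact_mod_cast Fintype.card_pos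
  have hL : 0 < L := by
    have : Nonempty {v // p v} := ⟨⟨v₀, hp₀⟩⟩
    simp only [L]; exact_mod_cast Fintype.card_pos
  have hLN : L ≤ N := by simp only [L, N]; exact_mod_cast Fintype.card_subtype_le p
  have hP : ∀ v, (P v).toReal = if p v then c else 0 := by
    intro v
    split_ifs with h
    · rw [h1 v v₀ h hp₀]
    · rw [h0 v h, ENNReal.toReal_zero]
  have hcard : ((Finset.univ.filter p).card : ℝ) = L := by
    simp only [L, Fintype.card_subtype]
  have hsum : L * c = 1 := by
    have := (hasSum_toReal P).tsum_eq
    rw [tsum_fintype, Finset.sum_congr rfl fun v _ => hP v, ← Finset.sum_filter, Finset.sum_const,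
      nsmul_eq_mul, hcard] at this
    exact this
  have hc : 1 / N ≤ c := by
    rw [div_le_iff₀ hN, ← hsum, mul_comm]
    exact mul_le_mul_of_nonneg_left hLN ENNReal.toReal_nonneg
  have hU : ∀ v, ((uniform α) v).toReal = 1 / N := by
    intro v
    rw [uniform_apply, Nat.card_eq_fintype_card]
    simp [N]
  have hcard' : ((Finset.univ.filter fun v => ¬ p v).card : ℝ) = N - L := by
    have := Finset.card_filter_add_card_filter_not (s := (Finset.univ : Finset α)) p
    rw [← hcard, eq_sub_iff_add_eq, add_comm]
    simp only [N]
    exact_mod_cast this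
  -- Relative to the uniform weight, `P` has an excess on `p` and a deficit `1 / N` off `p`. Total
  -- excess and total deficit both equal `1 - L / N`.
  rw [prob_bind, prob_bind, tsum_fintype, tsum_fintype, ← Finset.sum_sub_distrib, abs_le]
  constructor
  · have : -(1 - L / N) = ∑ v, if ¬ p v then -(1 / N) else 0 := by
      rw [← Finset.sum_filter, Finset.sum_const, nsmul_eq_mul, hcard']
      field_simp
    rw [this]
    refine Finset.sum_le_sum fun v _ => ?_
    rw [hP, hU]
    have a1 := prob_nonneg (κ v)
    have a2 := prob_le_one (κ v)
    by_cases h : p v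
    · simp only [h, not_true_eq_false, if_false, if_true]
      rw [← sub_mul]
      exact mul_nonneg (by linarith) a1
    · simp only [h, not_false_eq_true, if_true, if_false]
      have : 0 < 1 / N := by positivity
      nlinarith
  · have : 1 - L / N = ∑ v, if p v then c - 1 / N else 0 := by
      rw [← Finset.sum_filter, Finset.sum_const, nsmul_eq_mul, hcard, mul_sub, hsum]
      ring
    rw [this]
    refine Finset.sum_le_sum fun v _ => ?_
    rw [hP, hU]
    have a1 := prob_nonneg (κ v)
    have a2 := prob_le_one (κ v)
    by_cases h : p v
    · simp only [h, if_true]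
      nlinarith
    · simp only [h, if_false]
      have : 0 < 1 / N := by positivity
      nlinarith

end Prob

/-! ### The first columns of the scrambling matrix -/

section Scrambler

variable {F : Type*} [Field F] [Finite F]

/-- The first columns of a matrix. -/
def firstColumns {k w : ℕ} (h : w ≤ k) (S : Matrix (Fin k) (Fin k) F) : Matrix (Fin k) (Fin w) F :=
  S.submatrix id (Fin.castLE h)

theorem exists_linearIndependent_extension {k w : ℕ} (h : w ≤ k) {s : Fin w → Fin k → F}
    (hs : LinearIndependent F s) :
    ∃ t : Fin k → Fin k → F, LinearIndependent F t ∧ ∀ i, t (Fin.castLE h i) = s i := by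
  obtain ⟨d, hd⟩ := Nat.exists_eq_add_of_le h
  induction d generalizing w with
  | zero =>
    obtain rfl : w = k := hd.symm
    exact ⟨s, hs, fun i => rfl⟩
  | succ d ih =>
    obtain ⟨x, hx⟩ := exists_linearIndependent_snoc_of_lt_finrank hs (by simp; omega)
    obtain ⟨t, ht, h2⟩ := ih (w := w + 1) (by omega) hx (by omega)
    refine ⟨t, ht, fun i => ?_⟩
    have := h2 i.castSucc
    rw [Fin.snoc_castSucc] at this
    exact this

theorem exists_unit_firstColumns {k w : ℕ} (h : w ≤ k) {v : Matrix (Fin k) (Fin w) F}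
    (hv : LinearIndependent F v.col) :
    ∃ U : (Matrix (Fin k) (Fin k) F)ˣ, firstColumns h U.1 = v := by
  obtain ⟨t, ht, h2⟩ := exists_linearIndependent_extension h hv
  have : IsUnit (Matrix.of t).transpose := by
    rw [← Matrix.linearIndependent_cols_iff_isUnit]
    exact ht
  obtain ⟨U, hU⟩ := this
  refine ⟨U, ?_⟩
  ext i j
  rw [firstColumns, hU]
  exact congrFun (h2 j) i

theorem one_sub_le_card_linearIndependent [Fintype F] (k w : ℕ) (h : w ≤ k) :
    (1 - (1 / 2 : ℝ) ^ (k - w)) * (Fintype.card F : ℝ) ^ (k * w) ≤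
      Nat.card {s : Fin w → Fin k → F // LinearIndependent F s} := by
  have hq : (2 : ℝ) ≤ Fintype.card F := by exact_mod_cast Fintype.one_lt_card
  set q := (Fintype.card F : ℝ) with hqdef
  have hqk : (0 : ℝ) < q ^ k := by positivity
  rw [card_linearIndependent (by simpa using h)]
  -- The defect `q ^ t / q ^ k` bounds the geometric sum of the `q ^ i / q ^ k` with `i < t`, the
  -- probabilities that the column `i` is dependent on its predecessors.
  have key : ∀ t, t ≤ k → (1 - q ^ t / q ^ k) * q ^ (k * t) ≤
      ((∏ i : Fin t, (Fintype.card F ^ Module.finrank F (Fin k → F) - Fintype.card F ^ i.val) : ℕ) : ℝ) := by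
    intro t
    induction t with
    | zero => intro _; simp; positivity
    | succ t ih =>
      intro ht
      rw [Fin.prod_univ_castSucc, Nat.cast_mul]
      have h1 := ih (by omega)
      simp only [Fin.val_castSucc, Fin.val_last]
      rw [Nat.cast_sub (Nat.pow_le_pow_right Fintype.card_pos (by simp; omega))]
      simp only [Module.finrank_fintype_fun_eq_card, Fintype.card_fin, Nat.cast_pow] at h1 ⊢
      rw [← hqdef]
      have h2 : q ^ t ≤ q ^ k := pow_le_pow_right₀ (by linarith) (by omega)
      refine le_trans ?_ (mul_le_mul_of_nonneg_right h1 (sub_nonneg.2 h2))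
      set x := q ^ t / q ^ k with hx
      have hx0 : 0 ≤ x := by positivity
      have e1 : q ^ (t + 1) / q ^ k = q * x := by rw [hx, pow_succ]; ring
      have e2 : q ^ k - q ^ t = (1 - x) * q ^ k := by rw [hx]; field_simp
      rw [e1, e2, Nat.mul_succ, pow_add]
      -- Here `q ≥ 2` is used.
      have : (1 - q * x) ≤ (1 - x) * (1 - x) := by nlinarith [sq_nonneg x]
      calc (1 - q * x) * (q ^ (k * t) * q ^ k) ≤ (1 - x) * (1 - x) * (q ^ (k * t) * q ^ k) :=
            mul_le_mul_of_nonneg_right this (by positivity)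
        _ = _ := by ring
  refine le_trans (mul_le_mul_of_nonneg_right ?_ (by positivity)) (key w h)
  have e : q ^ w / q ^ k = (1 / q) ^ (k - w) := by
    rw [one_div, inv_pow, div_eq_iff hqk.ne', ← pow_sub_mul_pow q h]
    field_simp
  rw [e]
  have := pow_le_pow_left₀ (by positivity) (one_div_le_one_div_of_le two_pos hq) (k - w)
  linarith

theorem uniform_firstColumns {k w : ℕ} (h : w ≤ k) :
    (uniform (Matrix (Fin k) (Fin k) F)).map (fun S => rowsOf (firstColumns h S).transpose) =
      (uniform (Matrix (Fin k) (Fin w) F)).map fun v => rowsOf v.transpose := by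
  obtain ⟨d, rfl⟩ := Nat.exists_eq_add_of_le h
  rw [← iid_iid_uniform, ← iid_map_take w d, iid_iid_uniform, PMF.map_comp]
  refine congrArg (fun f => PMF.map f _) (funext fun S => ?_)
  refine List.ext_getElem (by simp [rowsOf]) fun i h1 h2 => ?_
  simp [rowsOf, firstColumns]

/-- For invertible `S`, left multiplication by the general linear group preserves the distribution
of the first `w` columns and is transitive on independent families, so this distribution is uniform
on them. Only a fraction of at most `2 ^ (-(k - w))` of all families is dependent. -/
theorem scrambler_dist_le (σ : Scrambler) {k w : ℕ} (h : w ≤ k) (κ : List (List F) → PMF Bool) :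
    |prob ((σ.dist F k).bind fun S => κ (rowsOf (firstColumns h S).transpose)) -
      prob ((iid w (iid k (uniform F))).bind κ)| ≤ (1 / 2 : ℝ) ^ (k - w) := by
  classical
  have := Fintype.ofFinite F
  rw [iid_iid_uniform]
  cases σ with
  | all =>
    rw [← uniform_firstColumns h, PMF.bind_map]
    simp only [Scrambler.dist, Function.comp_def, sub_self, abs_zero]
    positivity
  | invertible =>
    set P : PMF (Matrix (Fin k) (Fin w) F) :=
      (uniform (Matrix (Fin k) (Fin k) F)ˣ).map fun U => firstColumns h U.1 with hP
    have hmul : ∀ (U V : (Matrix (Fin k) (Fin k) F)ˣ),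
        firstColumns h (U * V).1 = U.1 * firstColumns h V.1 := by
      intro U V
      ext i j
      simp [firstColumns, Matrix.mul_apply]
    have h1 := prob_bind_sub_uniform_le P (fun v => LinearIndependent F v.col) ?_ ?_
      fun v => κ (rowsOf v.transpose)
    · rw [hP, PMF.bind_map] at h1
      rw [PMF.bind_map]
      simp only [Scrambler.dist, PMF.bind_map]
      refine h1.trans ?_
      have h2 := one_sub_le_card_linearIndependent (F := F) k w h
      have h3 : Nat.card {s : Fin w → Fin k → F // LinearIndependent F s} =
          Fintype.card {v : Matrix (Fin k) (Fin w) F // LinearIndependent F v.col} := by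
        rw [← Nat.card_eq_fintype_card]
        refine Nat.card_congr (Equiv.subtypeEquiv
          (Equiv.piComm fun (_ : Fin w) (_ : Fin k) => F) fun s => Iff.rfl)
      have h4 : (Fintype.card (Matrix (Fin k) (Fin w) F) : ℝ) = (Fintype.card F : ℝ) ^ (k * w) := by
        have : Fintype.card (Matrix (Fin k) (Fin w) F) = Fintype.card (Fin k → Fin w → F) := rfl
        rw [this, Fintype.card_fun, Fintype.card_fun, Fintype.card_fin, Fintype.card_fin, ← pow_mul,
          mul_comm w]
        push_cast
        rfl
      rw [h3] at h2
      rw [h4]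
      have h5 : (0 : ℝ) < (Fintype.card F : ℝ) ^ (k * w) := by
        have : (0 : ℝ) < Fintype.card F := by exact_mod_cast Fintype.card_pos
        positivity
      rw [← le_div_iff₀ h5] at h2
      linarith
    · intro v hv
      by_contra hne
      obtain ⟨U, -, rfl⟩ := (PMF.mem_support_map_iff _ _ _).1 hne
      refine hv ?_
      have := Matrix.linearIndependent_cols_iff_isUnit.2 U.isUnit
      exact this.comp (Fin.castLE h) (Fin.castLE_injective h)
    · intro u v hu hv
      obtain ⟨A, hA⟩ := exists_unit_firstColumns h hu
      obtain ⟨B, hB⟩ := exists_unit_firstColumns h hv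
      -- `A * B⁻¹` carries `v` to `u`.
      have hinv : P = P.map (fun M => (A * B⁻¹).1 * M) := by
        conv_lhs => rw [hP, ← uniform_map_equiv (Equiv.mulLeft (A * B⁻¹))]
        rw [hP, PMF.map_comp, PMF.map_comp]
        refine congrArg (fun f => PMF.map f _) (funext fun U => ?_)
        exact hmul _ _
      let e : Matrix (Fin k) (Fin w) F ≃ Matrix (Fin k) (Fin w) F :=
        { toFun := fun M => (A * B⁻¹).1 * M
          invFun := fun M => (A * B⁻¹)⁻¹.1 * M
          left_inv := fun M => by simp only; rw [← Matrix.mul_assoc, ← Units.val_mul]; simp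
          right_inv := fun M => by simp only; rw [← Matrix.mul_assoc, ← Units.val_mul]; simp }
      have he : e v = u := by
        change (A * B⁻¹).1 * v = u
        rw [← hB, ← hmul, inv_mul_cancel_right, hA]
      have : P u = (P.map e) u := congrFun (congrArg DFunLike.coe hinv) u
      rw [this, map_equiv_apply, ← he, Equiv.symm_apply_apply]

end Scrambler
end Trapdoor

namespace Trapdoor

/-! ### An encoded block compared with the McEliece distribution -/

section Blocks

variable {F : Type*} [Field F] [Finite F]

/-- Columns of the product of a generator matrix with permuted rows and a matrix. -/
def applyCode {m k : ℕ} (G : Matrix (Fin m) (Fin k) F) (π : Equiv.Perm (Fin m))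
    (cols : List (List F)) : List (List F) :=
  cols.map fun c => List.ofFn fun i => dot (List.ofFn (G (π i))) c

theorem encodeBlock_map_fst (K : CodeFamily F) (m : ℕ) (cols : List (List F)) :
    (encodeBlock K m cols).map Prod.fst = (K.gen.matrix m).bind fun G =>
      (uniform (Equiv.Perm (Fin m))).map fun π => applyCode G π cols := by
  unfold encodeBlock CodeFamily.sample TrapdooredFamily.matrix
  rw [PMF.map_bind, PMF.bind_map, PMF.bind_map]
  refine congrArg _ (funext fun MC => ?_)
  simp only [Function.comp_apply]
  have : pairUp (rowsOf MC.1) (codeOf MC.2).2 =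
      List.ofFn fun i : Fin m => (List.ofFn (MC.1 i), (codeOf MC.2).2.getD i 0) := by
    unfold pairUp
    rw [length_rowsOf, map_range_eq_ofFn]
    congr 1
    funext i
    simp [rowsOf]
  rw [this, shuffle_ofFn, PMF.map_comp, PMF.map_comp]
  refine congrArg (fun f => PMF.map f _) (funext fun π => ?_)
  simp only [Function.comp_apply, List.map_ofFn]
  rfl

/-- The first columns of a permuted generator matrix times a random matrix. -/
noncomputable def codeColumns (K : CodeFamily F) (m w : ℕ) : PMF (List (List F)) :=
  (iid w (iid (K.dim m) (uniform F))).bind fun cols => (encodeBlock K m cols).map Prod.fst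

/-- The first `w` columns of the matrix with given rows. -/
def takeColumns (w : ℕ) (rows : List (List F)) : List (List F) :=
  (List.range w).map fun j => rows.map fun r => r.getD j 0

theorem takeColumns_rowsOf {m k w : ℕ} (h : w ≤ k) (M : Matrix (Fin m) (Fin k) F) :
    takeColumns w (rowsOf M) = (rowsOf M.transpose).take w := by
  refine List.ext_getElem (by simp [takeColumns, rowsOf, h]) fun j h1 h2 => ?_
  have hj : j < w := by simpa [takeColumns] using h1
  have hk : j < k := by omega
  simp [takeColumns, rowsOf, List.map_ofFn, Function.comp_def, hk]

theorem takeColumns_uniform {m k w : ℕ} (h : w ≤ k) :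
    (uniform (Matrix (Fin m) (Fin k) F)).map (fun C => takeColumns w (rowsOf C)) =
      iid w (iid m (uniform F)) := by
  simp only [takeColumns_rowsOf h]
  obtain ⟨d, rfl⟩ := Nat.exists_eq_add_of_le h
  rw [← iid_map_take w d, iid_iid_uniform, PMF.map_comp]
  rfl

theorem dot_ofFn {k : ℕ} (u v : Fin k → F) :
    dot (List.ofFn u) (List.ofFn v) = ∑ i, u i * v i := by
  rw [dot_eq_sum, List.length_ofFn, Finset.sum_range]
  simp

theorem takeColumns_mul {m k w : ℕ} (h : w ≤ k) (π : Equiv.Perm (Fin m))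
    (G : Matrix (Fin m) (Fin k) F) (S : Matrix (Fin k) (Fin k) F) :
    takeColumns w (rowsOf (π.permMatrix F * G * S)) =
      applyCode G π (rowsOf (firstColumns h S).transpose) := by
  rw [takeColumns_rowsOf h]
  refine List.ext_getElem (by simp [applyCode, rowsOf, h]) fun j h1 h2 => ?_
  have hj : j < w := by simpa [applyCode, rowsOf] using h2
  have hk : j < k := by omega
  simp only [rowsOf, List.getElem_take, List.getElem_ofFn, applyCode, List.getElem_map,
    Matrix.transpose_apply]
  congr 1
  funext i
  refine Eq.trans (Matrix.mul_apply (M := π.permMatrix F * G) (N := S)) (Eq.trans ?_ (dot_ofFn _ _).symm)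
  refine Finset.sum_congr rfl fun t _ => ?_
  have : (π.permMatrix F * G) i t = G (π i) t := by
    rw [Equiv.Perm.permMatrix, PEquiv.toMatrix_toPEquiv_mul]
    rfl
  rw [this]
  rfl

/-- The first `w` columns of `PGS` involve only the first `w` columns of `S`. This is the reason for
groups narrower than `k`: at width about `k / 2` both kinds of scrambler look alike, with
exponentially small error. -/
theorem mcEliece_columns_le (K : CodeFamily F) (σ : Scrambler) (m : ℕ) {w : ℕ} (h : w ≤ K.dim m)
    (κ : List (List F) → PMF Bool) :
    |prob ((K.mcEliece σ m).bind fun C => κ (takeColumns w (rowsOf C))) -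
      prob ((codeColumns K m w).bind κ)| ≤ (1 / 2 : ℝ) ^ (K.dim m - w) := by
  have h1 := scrambler_dist_le σ h fun cols => (uniform (Equiv.Perm (Fin m))).bind fun π =>
    (K.gen.matrix m).bind fun G => κ (applyCode G π cols)
  convert h1 using 3
  · unfold CodeFamily.mcEliece
    simp only [PMF.bind_bind, PMF.bind_map, Function.comp_def, takeColumns_mul h]
    congr 1
    rw [PMF.bind_comm]
    conv_rhs => rw [PMF.bind_comm]
    rw [PMF.bind_comm]
    refine congrArg _ (funext fun π => ?_)
    rw [PMF.bind_comm]
  · unfold codeColumns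
    simp only [encodeBlock_map_fst, PMF.bind_bind, PMF.bind_map, Function.comp_def]
    congr 2
    funext cols
    rw [PMF.bind_comm]

end Blocks

/-! ### Hybrids between random and encoded columns -/

section Columns

variable {F : Type*} [Field F] [Finite F]

/-- The effect of a level of the sampler on the columns. -/
noncomputable def levelColumns (K : CodeFamily F) (N : ℕ) (cols : List (List F)) (m : ℕ) :
    PMF (List (List F)) :=
  (mapP (fun i => (encodeBlock K m (chunk (halfPow (K.dim m)) cols i)).map Prod.fst)
    (List.range (N / halfPow (K.dim m)))).map List.flatten

theorem level_map_fst (K : CodeFamily F) (N : ℕ) (st : List (List F) × List (Instr F) × ℕ)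
    (m : ℕ) : (level K N st m).map Prod.fst = levelColumns K N st.1 m := by
  rw [level, levelColumns, encodeBlocks, ← mapP_map, PMF.map_comp, PMF.map_comp]
  refine congrArg (fun f => PMF.map f _) (funext fun res => ?_)
  simp [List.flatMap]

theorem levels_map_fst (K : CodeFamily F) (N : ℕ) (st : List (List F) × List (Instr F) × ℕ)
    (l : List ℕ) :
    (foldP (level K N) st l).map Prod.fst = foldP (levelColumns K N) st.1 l := by
  induction l generalizing st with
  | nil => simp [foldP, PMF.pure_map]
  | cons m l ih =>
    rw [foldP, foldP, ← level_map_fst, PMF.bind_map, PMF.map_bind]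
    simp only [ih, Function.comp_def]

/-- The matrix obtained from random columns with `r` entries through the levels in `acc`. -/
noncomputable def partialMatrix (K : CodeFamily F) (n r : ℕ) (acc : List ℕ) :
    PMF (Matrix (Fin n) (Fin n) F) :=
  ((randCols F (width n) r).bind fun cols => foldP (levelColumns K (width n)) cols acc).map
    (colsToMatrix n)

theorem trapdooredOfCodes_matrix (K : CodeFamily F) {s : ℕ → ℕ} (hs : PF s) (n : ℕ) :
    (trapdooredOfCodes K s hs).matrix n =
      partialMatrix K n (chain K (s n) n).2 (chain K (s n) n).1 := by
  change (sampleDist K s n).map Prod.fst = _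
  unfold partialMatrix sampleDist sampleCols
  simp only [PMF.map_comp, PMF.map_bind]
  refine congrArg _ (funext fun cols => ?_)
  rw [← levels_map_fst K (width n) (cols, [], width n), PMF.map_comp]
  rfl

theorem partialMatrix_nil (K : CodeFamily F) (n : ℕ) :
    partialMatrix K n n [] = uniform (Matrix (Fin n) (Fin n) F) := by
  unfold partialMatrix randCols
  simp only [foldP, PMF.bind_pure]
  obtain ⟨d, hd⟩ := Nat.exists_eq_add_of_le (lt_width n).le
  have h1 : (colsToMatrix n : List (List F) → _) = colsToMatrix n ∘ List.take n := by
    funext l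
    ext i j
    simp [colsToMatrix]
  rw [hd, h1, ← PMF.map_comp, iid_map_take, iid_iid_uniform, PMF.map_comp]
  have h2 : colsToMatrix n ∘ (fun C : Matrix (Fin n) (Fin n) F => rowsOf C.transpose) = id := by
    funext C
    ext i j
    simp [colsToMatrix, rowsOf]
  rw [h2, PMF.map_id]

/-- Both sides are powers of two; hence the groups tile the columns without remainder at every
level. -/
theorem halfPow_dvd_width {n k : ℕ} (h : k ≤ n) : halfPow k ∣ width n := by
  rw [width_eq, halfPow]
  refine pow_dvd_pow 2 ?_
  have := Nat.log_mono_right (b := 2) h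
  omega

/-- Hybrid between random columns with `m` entries and encoded random columns, with the block `x`
in position `b`. -/
noncomputable def hybridColumns (K : CodeFamily F) (n m b : ℕ) (up : List ℕ) (x : List (List F)) :
    PMF (List (List F)) :=
  (randCols F (b * halfPow (K.dim m)) m).bind fun l₁ =>
    (iid (width n / halfPow (K.dim m) - b - 1) (codeColumns K m (halfPow (K.dim m)))).bind fun l₂ =>
      foldP (levelColumns K (width n)) (l₁ ++ x ++ l₂.flatten) up

/-- Hybrid with `b` random blocks. -/
noncomputable def hybrid (K : CodeFamily F) (n m b : ℕ) (up : List ℕ) : PMF (List (List F)) :=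
  (randCols F (b * halfPow (K.dim m)) m).bind fun l₁ =>
    (iid (width n / halfPow (K.dim m) - b) (codeColumns K m (halfPow (K.dim m)))).bind fun l₂ =>
      foldP (levelColumns K (width n)) (l₁ ++ l₂.flatten) up

/-- Together with `hybrid_eq_right`: consecutive hybrids differ only in whether the block in
position `b` is encoded or random. -/
theorem hybrid_eq_left (K : CodeFamily F) {n m b : ℕ} (up : List ℕ)
    (hb : b < width n / halfPow (K.dim m)) :
    hybrid K n m b up = (codeColumns K m (halfPow (K.dim m))).bind (hybridColumns K n m b up) := by
  unfold hybrid hybridColumns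
  conv_rhs => rw [PMF.bind_comm]
  refine congrArg _ (funext fun l₁ => ?_)
  obtain ⟨t, ht⟩ : ∃ t, width n / halfPow (K.dim m) - b = t + 1 := ⟨_, (Nat.succ_pred (by omega)).symm⟩
  rw [ht, iid_succ, Nat.add_sub_cancel]
  simp only [PMF.bind_bind, PMF.bind_map, Function.comp_def, List.flatten_cons, List.append_assoc]

theorem hybrid_eq_right (K : CodeFamily F) (n m b : ℕ) (up : List ℕ) :
    hybrid K n m (b + 1) up =
      (randCols F (halfPow (K.dim m)) m).bind (hybridColumns K n m b up) := by
  unfold hybrid hybridColumns randCols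
  rw [Nat.succ_mul, iid_add]
  conv_rhs => rw [PMF.bind_comm]
  simp only [PMF.bind_bind, PMF.bind_map, Function.comp_def, Nat.sub_sub]

/-- With no random block, the hybrid is the matrix sampled from one level further down. With only
random blocks (`hybrid_last`) that level has disappeared. -/
theorem hybrid_zero (K : CodeFamily F) {n m : ℕ} (up : List ℕ) (hm : m ≤ n) :
    (hybrid K n m 0 up).map (colsToMatrix n) = partialMatrix K n (K.dim m) (m :: up) := by
  unfold hybrid partialMatrix randCols
  rw [zero_mul, iid_zero, PMF.pure_bind, Nat.sub_zero, codeColumns]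
  obtain ⟨q, hq⟩ := halfPow_dvd_width ((K.dim_le m).trans hm)
  have hw : 0 < halfPow (K.dim m) := by unfold halfPow; positivity
  have h := iid_bind_mapP q (halfPow (K.dim m)) (iid (K.dim m) (uniform F))
    fun cols => (encodeBlock K m cols).map Prod.fst
  have hq' : width n / halfPow (K.dim m) = q := by rw [hq, Nat.mul_div_cancel_left _ hw]
  rw [hq', ← h, mul_comm q, ← hq]
  simp only [foldP, levelColumns, hq', PMF.bind_bind, PMF.bind_map, Function.comp_def,
    List.nil_append]

theorem hybrid_last (K : CodeFamily F) {n m : ℕ} (up : List ℕ) (hm : m ≤ n) :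
    (hybrid K n m (width n / halfPow (K.dim m)) up).map (colsToMatrix n) =
      partialMatrix K n m up := by
  unfold hybrid partialMatrix
  rw [Nat.sub_self, iid_zero, Nat.div_mul_cancel (halfPow_dvd_width ((K.dim_le m).trans hm))]
  simp only [PMF.pure_bind, List.flatten_nil, List.append_nil]

end Columns
end Trapdoor

namespace Trapdoor
open Enc (enc)

/-! ### Recognizing acceptance -/

section Accept

variable {χ : Type*} [Enc χ]

/-- A tree as the list of its left subtrees. -/
def Data.toList : Data → List Data
  | Data.nil => []
  | Data.cons a b => a :: b.toList

theorem enc_toList (d : Data) : enc d.toList = d := by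
  induction d with
  | nil => rfl
  | cons a b _ ih => rw [Data.toList, enc_cons, ih, enc_data]

@[fun_prop]
theorem PF.toList {f : χ → Data} (hf : PF f) : PF fun x => (f x).toList :=
  hf.of_enc_eq fun x => by rw [enc_toList, enc_data]

/-- Whether the output of a program is `1`. -/
def isOne (d : Data) : Bool :=
  decide (1 ≤ d.toList.length ∧ d.toList.length ≤ 1 ∧ (d.toList.headD Data.nil).toList.length ≤ 0)

theorem PF.isOne {f : χ → Data} (hf : PF f) : PF fun x => isOne (f x) := by
  unfold Trapdoor.isOne
  fun_prop

theorem isOne_iff (d : Data) : isOne d = true ↔ d = Data.ofNat 1 := by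
  rw [isOne, decide_eq_true_iff]
  rcases d with _ | ⟨_ | ⟨a, b⟩, _ | ⟨c, e⟩⟩ <;> simp [Data.toList, Data.ofNat]

theorem prob_map_isOne (μ : PMF Data) : prob (μ.map isOne) = (μ (Data.ofNat 1)).toReal := by
  rw [prob, PMF.map_apply, tsum_eq_single (Data.ofNat 1)]
  · rw [if_pos ((isOne_iff _).2 rfl).symm]
  · intro d hd
    rw [if_neg]
    intro h
    exact hd ((isOne_iff d).1 h.symm)

theorem map_enc_apply (μ : PMF Bool) : ((μ.map enc) (Data.ofNat 1)).toReal = prob μ := by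
  rw [prob, PMF.map_apply, tsum_eq_single true]
  · rw [if_pos (show Data.ofNat 1 = enc true from rfl)]
  · intro b hb
    rw [if_neg]
    intro h
    exact hb (Enc.inj (show enc b = enc true from h.symm))

end Accept

/-! ### Running the distinguisher on a hybrid -/

section Trial

variable {F : Type*} [Field F] [Finite F] {χ : Type*} [Enc χ]

theorem exists_compOn_test {A : Prog} {out : ∀ n, Matrix (Fin n) (Fin n) F → PMF Data} {a : ℕ}
    (hA : RunsInTime A out fun n => (n : ℝ) ^ a + a) : ∃ n₀ : ℕ,
      CompOn {p : ℕ × List (List F) | n₀ ≤ p.1} (fun p => esize p + 1)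
        fun p => (out p.1 (colsToMatrix p.1 p.2)).map isOne := by
  obtain ⟨n₀, hn₀⟩ := eventually_atTop.1 hA
  refine ⟨n₀, ?_⟩
  -- The dimension is recovered from the number of rows, which makes one function on lists out of
  -- the dependent family `out`.
  set g : List (List F) → PMF Data := fun rows =>
    out rows.length (Matrix.of fun i j => (rows.getD i []).getD j 0) with hg
  have hgM : ∀ (n : ℕ) (M : Matrix (Fin n) (Fin n) F), g (rowsOf M) = out n M := by
    intro n M
    have h1 : ∀ l, l = n → out l (Matrix.of fun i j => ((rowsOf M).getD i []).getD j 0) =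
        out n (Matrix.of fun i j => ((rowsOf M).getD i []).getD j 0) := by
      rintro l rfl; rfl
    rw [hg]
    simp only
    rw [h1 _ (length_rowsOf M)]
    congr 1
    ext i j
    simp [rowsOf]
  -- Including `a` in the measure makes both `n ^ a` and the summand `a` at most its power `a`;
  -- exponent `a + 1` covers the sum.
  have hgc : CompOn {rows | ∃ n, n₀ ≤ n ∧ ∃ M : Matrix (Fin n) (Fin n) F, rows = rowsOf M}
      (fun rows => esize rows + a + 2) g := by
    refine ⟨fun rows _ => by simp only; omega, A, a + 1, ?_⟩
    rintro _ ⟨n, hn, M, rfl⟩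
    obtain ⟨t, ht, hrun⟩ := hn₀ n hn M
    unfold TRuns
    rw [hgM, enc_rowsOf, show (enc : Data → Data) = id from rfl, PMF.map_id]
    refine Runs.weaken hrun ?_
    have ht : t ≤ n ^ a + a := by
      simp only at ht
      exact_mod_cast ht
    have hne : n ≤ esize (rowsOf M) := by
      have := length_le_esize (rowsOf M)
      rwa [length_rowsOf] at this
    refine ht.trans ?_
    simp only
    set X := esize (rowsOf M) + a + 2
    have h1 : n ^ a ≤ X ^ a := Nat.pow_le_pow_left (by omega) a
    have h2 : a ≤ X ^ a := (Nat.lt_two_pow_self (n := a)).le.trans (Nat.pow_le_pow_left (by omega) a)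
    rw [pow_succ]
    have h3 := Nat.mul_le_mul_left (X ^ a) (show 2 ≤ X by omega)
    omega
  have hrows : PF fun p : ℕ × List (List F) => colsToRows p.1 p.2 :=
    PF.colsToRows (by fun_prop) (by fun_prop)
  have hS : ∀ p ∈ {p : ℕ × List (List F) | n₀ ≤ p.1}, esize p < esize p + 1 := fun _ _ => by omega
  have h2 := (hrows.compOn hS).two_le
  have hb : PBd {p : ℕ × List (List F) | n₀ ≤ p.1} (fun p => esize p + 1)
      fun p => esize (colsToRows p.1 p.2) + a + 2 := by
    obtain ⟨c, hc⟩ := (hrows.pb.add (PB.const a)).add (PB.const 2)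
    exact ⟨c, fun p _ => hc p trivial⟩
  have h3 := CompOn.comp_of hgc (hrows.compOn hS) hb (by
    intro p hp rows hrows
    rw [PMF.mem_support_pure_iff] at hrows
    subst hrows
    exact ⟨⟨p.1, hp, _, colsToRows_eq _ _⟩, le_rfl⟩)
  have h4 := CompOn.comp (g := fun d => PMF.pure (isOne d)) (PF.isOne PF.id) h3
  simp only [PMF.pure_bind, colsToRows_eq, hgM] at h4
  exact h4

theorem Poly.levelsColumns (K : CodeFamily F) : Poly fun x : ℕ × List ℕ × List (List F) =>
    foldP (levelColumns K x.1) x.2.2 x.2.1 := by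
  have := Poly.map (g := fun _ st => st.1) (Poly.levels K) (by fun_prop)
  simpa only [levels_map_fst] using this

theorem Poly.codeColumns (K : CodeFamily F) {m w : χ → ℕ} (hm : PF m) (hw : PF w) :
    Poly fun x => codeColumns K (m x) (w x) := by
  unfold Trapdoor.codeColumns
  refine Poly.bind (Poly.randCols hw (by fun_prop)) ?_
  have h1 : PF fun p : χ × List (List F) => m p.1 := PF.comp hm (by fun_prop)
  exact Poly.map (Poly.compF (f := fun p : χ × List (List F) => (m p.1, p.2))
    (Poly.encodeBlock K) (by fun_prop)) (by fun_prop)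

theorem PF.flatten {β : Type*} [Enc β] {f : χ → List (List β)} (hf : PF f) :
    PF fun x => (f x).flatten := by
  have := PF.flatMap (f := fun _ l => l) hf (by fun_prop)
  simpa [List.flatMap] using this

theorem PF.takeColumns {w : χ → ℕ} {rows : χ → List (List F)} (hw : PF w) (hr : PF rows) :
    PF fun x => takeColumns (w x) (rows x) := by
  unfold Trapdoor.takeColumns
  refine PF.map (PF.range hw) (PF.map (PF.comp hr (by fun_prop)) ?_)
  fun_prop

/-- The input of a trial: `n`, `m`, the position of the block, and the block. -/
theorem Poly.hybridColumns (K : CodeFamily F) :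
    Poly fun p : (ℕ × ℕ × ℕ) × List (List F) =>
      hybridColumns K p.1.1 p.1.2.1 p.1.2.2 (chain K p.1.2.1 p.1.1).1 p.2 := by
  unfold Trapdoor.hybridColumns
  refine Poly.bind (Poly.randCols (by fun_prop) (by fun_prop)) ?_
  refine Poly.bind (f := fun p : ((ℕ × ℕ × ℕ) × List (List F)) × List (List F) =>
    Trapdoor.iid (Trapdoor.width p.1.1.1 / Trapdoor.halfPow (K.dim p.1.1.2.1) - p.1.1.2.2 - 1)
      (Trapdoor.codeColumns K p.1.1.2.1 (Trapdoor.halfPow (K.dim p.1.1.2.1))))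
    (Poly.iid (by fun_prop) (Poly.codeColumns K (by fun_prop) (by fun_prop))) ?_
  refine Poly.compF (f := fun p : (((ℕ × ℕ × ℕ) × List (List F)) × List (List F)) ×
      List (List (List F)) => (Trapdoor.width p.1.1.1.1,
        (Trapdoor.chain K p.1.1.1.2.1 p.1.1.1.1).1, p.1.2 ++ p.1.1.2 ++ p.2.flatten))
    (Poly.levelsColumns K) ?_
  refine PF.prodMk (by fun_prop) (PF.prodMk (by fun_prop) ?_)
  exact PF.append (by fun_prop) (PF.flatten (by fun_prop))

/-- Run the distinguisher on a hybrid matrix with a given block. -/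
noncomputable def testBlock (K : CodeFamily F) (out : ∀ n, Matrix (Fin n) (Fin n) F → PMF Data)
    (n m b : ℕ) (x : List (List F)) : PMF Bool :=
  (hybridColumns K n m b (chain K m n).1 x).bind fun cols => (out n (colsToMatrix n cols)).map isOne

theorem CompOn.testBlock (K : CodeFamily F) {out : ∀ n, Matrix (Fin n) (Fin n) F → PMF Data}
    {n₀ : ℕ} (h : CompOn {p : ℕ × List (List F) | n₀ ≤ p.1} (fun p => esize p + 1)
        fun p => (out p.1 (colsToMatrix p.1 p.2)).map isOne)
    {n m b : χ → ℕ} (hn : PF n) (hm : PF m) (hb : PF b) {f : χ → PMF (List (List F))}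
    (hf : Poly f) {S : Set χ} (hS : ∀ x ∈ S, n₀ ≤ n x) :
    CompOn S (fun x => esize x + 1)
      fun x => (f x).bind (testBlock K out (n x) (m x) (b x)) := by
  have h1 : Poly fun x => (f x).bind fun y =>
      (Trapdoor.hybridColumns K (n x) (m x) (b x) (Trapdoor.chain K (m x) (n x)).1 y).map
        fun cols => (n x, cols) := by
    refine Poly.bind hf ?_
    have e1 : PF fun p : χ × List (List F) => n p.1 := PF.comp hn (by fun_prop)
    have e2 : PF fun p : χ × List (List F) => m p.1 := PF.comp hm (by fun_prop)
    have e3 : PF fun p : χ × List (List F) => b p.1 := PF.comp hb (by fun_prop)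
    refine Poly.map (f := fun p : χ × List (List F) => Trapdoor.hybridColumns K (n p.1) (m p.1)
      (b p.1) (Trapdoor.chain K (m p.1) (n p.1)).1 p.2) (g := fun p cols => (n p.1, cols)) ?_ ?_
    · exact Poly.compF (f := fun p : χ × List (List F) => ((n p.1, m p.1, b p.1), p.2))
        (Poly.hybridColumns K) (by fun_prop)
    · exact PF.prodMk (PF.comp hn (by fun_prop)) (by fun_prop)
  have hV : ∀ x ∈ S, esize x < esize x + 1 := fun _ _ => by omega
  have h2 := h1.compOn hV
  obtain ⟨u, hu, hub⟩ := h2.esize_bound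
  have h3 := CompOn.comp_of h h2 (hu.add h2.two_le (PBd.const h2.two_le 1)) (by
    intro x hx p hp
    refine ⟨?_, Nat.succ_le_succ (hub x hx p hp)⟩
    simp only [PMF.mem_support_bind_iff, PMF.mem_support_map_iff] at hp
    obtain ⟨y, -, cols, -, rfl⟩ := hp
    exact hS x hx)
  simp only [PMF.bind_bind, PMF.bind_map, Function.comp_def] at h3
  exact h3

end Trial
end Trapdoor

namespace Trapdoor
open Enc (enc)

/-! ### The reduction to the McEliece assumption -/

section Reduction

variable {F : Type*} [Field F] [Finite F]

theorem prob_bind_bool (μ : PMF Bool) (κ : Bool → PMF Bool) :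
    prob (μ.bind κ) = prob μ * prob (κ true) + (1 - prob μ) * prob (κ false) := by
  have h : (μ false).toReal = 1 - prob μ := by
    have := (hasSum_toReal μ).tsum_eq
    rw [tsum_fintype, Fintype.sum_bool] at this
    rw [prob]
    linarith
  rw [prob_bind, tsum_fintype, Fintype.sum_bool, h]
  rfl

/-- The output of the reduction, for the results of a trial with the challenge, a trial with
encoded columns and a trial with random columns. -/
def combine (p : Bool × Bool × Bool) : Bool :=
  bif p.2.1 then (bif p.2.2 then false else p.1) else (bif p.2.2 then (bif p.1 then false else true)
    else false)

/-- As a function of `prob t` this is affine with slope `p₁(1 - p₀) - (1 - p₁)p₀ = p₁ - p₀`, where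
`pᵢ = prob tᵢ`. If the challenge moves from `p₀` to `p₁`, acceptance grows by the square `(p₁ -
p₀)²`, whatever the sign of the difference. -/
theorem prob_combine (t t₁ t₀ : PMF Bool) :
    prob ((t.bind fun a => (t₁.bind fun x => t₀.map fun y => (x, y)).map fun p => (a, p)).map
      combine) = prob t * (prob t₁ * (1 - prob t₀)) + (1 - prob t) * ((1 - prob t₁) * prob t₀) := by
  have h1 : prob (PMF.pure true) = 1 := by simp [prob]
  have h0 : prob (PMF.pure false) = 0 := by simp [prob]
  simp only [PMF.map, PMF.bind_bind, PMF.pure_bind,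
    Function.comp_apply, prob_bind_bool, combine, cond_true, cond_false, h1, h0]
  ring

/-- The guess `z.2 = (n, b)` of a level of the sampler and a block is usable. -/
abbrev ValidGuess (K : CodeFamily F) (s : ℕ → ℕ) (n₀ m : ℕ) (g : ℕ × ℕ) : Prop :=
  n₀ ≤ g.1 ∧ s g.1 < m ∧ (chain K m g.1).2 ≤ m ∧ m ≤ (chain K m g.1).2 ∧
    g.2 < width g.1 / halfPow (K.dim m)

/-- The reduction for a given guess. -/
noncomputable def reduceGuess (K : CodeFamily F) (s : ℕ → ℕ)
    (out : ∀ n, Matrix (Fin n) (Fin n) F → PMF Data) (n₀ : ℕ) (z : List (List F) × ℕ × ℕ) :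
    PMF Bool :=
  bif decide (ValidGuess K s n₀ z.1.length z.2) then
    ((((PMF.pure (takeColumns (halfPow (K.dim z.1.length)) z.1)).bind
        (testBlock K out z.2.1 z.1.length z.2.2)).bind fun a =>
      (((codeColumns K z.1.length (halfPow (K.dim z.1.length))).bind
          (testBlock K out z.2.1 z.1.length z.2.2)).bind fun x =>
        ((randCols F (halfPow (K.dim z.1.length)) z.1.length).bind
          (testBlock K out z.2.1 z.1.length z.2.2)).map fun y => (x, y)).map fun p => (a, p)).map
      combine)
  else PMF.pure false

/-- The guard ensures `n₀ ≤ n`, where the distinguisher keeps its time bound. In `ValidGuess`, the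
equation saying that `m` lies on the chain from `n` is split into two inequalities, as `PF.le` is
the test at hand. -/
theorem Poly.reduceGuess (K : CodeFamily F) {s : ℕ → ℕ} (hs : PF s)
    {out : ∀ n, Matrix (Fin n) (Fin n) F → PMF Data} {n₀ : ℕ}
    (h : CompOn {p : ℕ × List (List F) | n₀ ≤ p.1} (fun p => esize p + 1)
      fun p => (out p.1 (colsToMatrix p.1 p.2)).map isOne) :
    Poly (reduceGuess K s out n₀) := by
  have hs1 : PF fun z : List (List F) × ℕ × ℕ => s z.2.1 := PF.comp hs (by fun_prop)
  have hc : PF fun z : List (List F) × ℕ × ℕ => decide (ValidGuess K s n₀ z.1.length z.2) := by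
    unfold ValidGuess
    fun_prop
  have hV : ∀ z ∈ (Set.univ : Set (List (List F) × ℕ × ℕ)), esize z < esize z + 1 :=
    fun _ _ => Nat.lt_succ_self _
  refine CompOn.cond (f := fun z : List (List F) × ℕ × ℕ => _) hc hV ?_
    (Poly.compOn (PF.const false) fun z _ => Nat.lt_succ_self _)
  have hS : ∀ z ∈ {z ∈ (Set.univ : Set (List (List F) × ℕ × ℕ)) |
      decide (ValidGuess K s n₀ z.1.length z.2) = true}, n₀ ≤ z.2.1 := by
    rintro z ⟨-, hz⟩
    exact (of_decide_eq_true hz).1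
  refine CompOn.comp (g := fun p => PMF.pure (combine p)) ?_ (CompOn.pair ?_ (CompOn.pair ?_ ?_))
  · change PF combine
    unfold combine
    fun_prop
  · exact CompOn.testBlock K h (by fun_prop) (by fun_prop) (by fun_prop)
      (show PF _ from PF.takeColumns (by fun_prop) (by fun_prop)) hS
  · exact CompOn.testBlock K h (by fun_prop) (by fun_prop) (by fun_prop)
      (Poly.codeColumns K (by fun_prop) (by fun_prop)) hS
  · exact CompOn.testBlock K h (by fun_prop) (by fun_prop) (by fun_prop)
      (Poly.randCols (by fun_prop) (by fun_prop)) hS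

/-- A random guess. -/
noncomputable def randGuess (R : ℕ) : PMF (ℕ × ℕ) :=
  (randNat R).bind fun n => (randNat R).map fun b => (n, b)

/-- The reduction: a distinguisher for the McEliece assumption. -/
noncomputable def reduction (K : CodeFamily F) (s R : ℕ → ℕ)
    (out : ∀ n, Matrix (Fin n) (Fin n) F → PMF Data) (n₀ : ℕ) (rows : List (List F)) : PMF Bool :=
  (randGuess (R rows.length)).bind fun g => reduceGuess K s out n₀ (rows, g)

/-- Drawing a guess requires writing `R` in unary, so `R` enters the measure; in the subexponential
case it dominates the input size. -/
theorem CompOn.reduction (K : CodeFamily F) {s R : ℕ → ℕ} (hs : PF s)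
    (hR : CompOn Set.univ (fun m => 2 * R m + 2) fun m => PMF.pure (R m))
    {out : ∀ n, Matrix (Fin n) (Fin n) F → PMF Data} {n₀ : ℕ}
    (h : CompOn {p : ℕ × List (List F) | n₀ ≤ p.1} (fun p => esize p + 1)
      fun p => (out p.1 (colsToMatrix p.1 p.2)).map isOne) :
    CompOn Set.univ (fun rows : List (List F) => esize rows + 2 * R rows.length + 2)
      (reduction K s R out n₀) := by
  have hV : ∀ rows ∈ (Set.univ : Set (List (List F))),
      esize rows < esize rows + 2 * R rows.length + 2 := fun _ _ => by omega
  have hl : PF fun rows : List (List F) => rows.length := by fun_prop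
  have h1 : CompOn Set.univ (fun rows : List (List F) => esize rows + 2 * R rows.length + 2)
      fun rows => PMF.pure (R rows.length) := by
    have := CompOn.comp_of hR (hl.compOn hV) PBd.self (by
      intro rows _ m hm
      rw [PMF.mem_support_pure_iff] at hm
      subst hm
      exact ⟨trivial, by simp only; omega⟩)
    simpa only [PMF.pure_bind] using this
  have hg : Poly randGuess := by
    unfold randGuess
    refine Poly.bind Poly.randNat ?_
    exact Poly.map (f := fun p : ℕ × ℕ => randNat p.1) (g := fun p b => (p.2, b))
      (Poly.compF Poly.randNat (by fun_prop)) (by fun_prop)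
  have h2 := CompOn.comp hg h1
  simp only [PMF.pure_bind] at h2
  exact CompOn.bind h2 (g := fun rows g => reduceGuess K s out n₀ (rows, g))
    (Poly.reduceGuess K hs h)

theorem esize_rowsOf_le {m k : ℕ} (M : Matrix (Fin m) (Fin k) F) :
    esize (rowsOf M) ≤ m * (k * (2 * Nat.card F + 2) + 1 + 1) + 1 := by
  refine esize_list_le (by simp [rowsOf]) fun r hr => ?_
  obtain ⟨i, rfl⟩ := (List.mem_ofFn' _ _).1 hr
  exact (esize_col_le _).trans (by simp)

theorem exists_reduction_prog (K : CodeFamily F) {s R : ℕ → ℕ} (hs : PF s)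
    (hR : CompOn Set.univ (fun m => 2 * R m + 2) fun m => PMF.pure (R m)) (hRm : ∀ m, m ≤ R m)
    {out : ∀ n, Matrix (Fin n) (Fin n) F → PMF Data} {n₀ : ℕ}
    (h : CompOn {p : ℕ × List (List F) | n₀ ≤ p.1} (fun p => esize p + 1)
      fun p => (out p.1 (colsToMatrix p.1 p.2)).map isOne) :
    ∃ (B : Prog) (c : ℕ), RunsInTime (r := fun n => n) (c := K.dim) B
      (fun _ M => (reduction K s R out n₀ (rowsOf M)).map enc) fun m => ((R m : ℝ) + 2) ^ c := by
  obtain ⟨-, B, c, hB⟩ := CompOn.reduction K hs hR h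
  have h2 : ∀ m ∈ (Set.univ : Set ℕ), 2 ≤ R m + 2 := fun _ _ => by omega
  have hX := PBd.self (S := Set.univ) (V := fun m => R m + 2)
  obtain ⟨d, hd⟩ := ((((hX.mul (((hX.mul (PBd.const h2 (2 * Nat.card F + 2))).add h2
    (PBd.const h2 1)).add h2 (PBd.const h2 1))).add h2 (PBd.const h2 1)).add h2
    ((PBd.const h2 2).mul hX)).add h2 (PBd.const h2 2))
  refine ⟨B, d * c, Eventually.of_forall fun m M => ⟨(R m + 2) ^ (d * c), by push_cast; rfl, ?_⟩⟩
  have := hB (rowsOf M) trivial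
  unfold TRuns at this
  rw [enc_rowsOf] at this
  refine Runs.weaken this ?_
  rw [pow_mul]
  refine Nat.pow_le_pow_left (le_trans ?_ (hd m trivial)) c
  simp only [length_rowsOf]
  have e1 : esize (rowsOf M) ≤ m * (K.dim m * (2 * Nat.card F + 2) + 1 + 1) + 1 := esize_rowsOf_le M
  have e2 : m * (K.dim m * (2 * Nat.card F + 2) + 1 + 1) ≤
      (R m + 2) * ((R m + 2) * (2 * Nat.card F + 2) + 1 + 1) := by
    have a1 := hRm m
    have a2 := K.dim_le m
    gcongr <;> omega
  omega

theorem randNat_apply {R i : ℕ} (h : i < R) : randNat R i = (R : ENNReal)⁻¹ := by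
  obtain ⟨r, rfl⟩ := Nat.exists_eq_succ_of_ne_zero (Nat.ne_zero_of_lt h)
  rw [Nat.succ_eq_add_one, randNat_eq_uniform, PMF.map_apply, tsum_eq_single (⟨i, h⟩ : Fin (r + 1))]
  · rw [if_pos rfl, uniform_apply, Nat.card_eq_fintype_card, Fintype.card_fin]
  · intro j hj
    rw [if_neg]
    rintro rfl
    exact hj rfl

theorem le_randGuess {R n b : ℕ} (hn : n < R) (hb : b < R) :
    1 / (R : ℝ) ^ 2 ≤ (randGuess R (n, b)).toReal := by
  have h1 : randNat R n * randNat R b ≤ randGuess R (n, b) := by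
    rw [randGuess, PMF.bind_apply]
    refine le_trans ?_ (ENNReal.le_tsum n)
    gcongr
    rw [PMF.map_apply]
    refine le_trans ?_ (ENNReal.le_tsum b)
    rw [if_pos rfl]
  have h2 := ENNReal.toReal_mono (PMF.apply_ne_top _ _) h1
  rw [randNat_apply hn, randNat_apply hb, ENNReal.toReal_mul, ENNReal.toReal_inv,
    ENNReal.toReal_natCast] at h2
  refine le_trans (le_of_eq ?_) h2
  rw [one_div, pow_two, mul_inv]

theorem prob_reduceGuess {m : ℕ} (K : CodeFamily F) (s : ℕ → ℕ)
    (out : ∀ n, Matrix (Fin n) (Fin n) F → PMF Data) (n₀ : ℕ) (g : ℕ × ℕ)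
    (D : PMF (Matrix (Fin m) (Fin (K.dim m)) F)) :
    prob (D.bind fun C => reduceGuess K s out n₀ (rowsOf C, g)) =
      if ValidGuess K s n₀ m g then
        (let p := prob (D.bind fun C =>
          testBlock K out g.1 m g.2 (takeColumns (halfPow (K.dim m)) (rowsOf C)))
        let p₁ := prob ((codeColumns K m (halfPow (K.dim m))).bind (testBlock K out g.1 m g.2))
        let p₀ := prob ((randCols F (halfPow (K.dim m)) m).bind (testBlock K out g.1 m g.2))
        p * (p₁ * (1 - p₀)) + (1 - p) * ((1 - p₁) * p₀)) else 0 := by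
  simp only [reduceGuess, length_rowsOf]
  split_ifs with hv
  · simp only [decide_eq_true hv, cond_true, PMF.pure_bind]
    rw [← prob_combine, ← PMF.map_bind, ← PMF.bind_bind]
  · have h0 : prob (PMF.pure false) = 0 := by simp [prob]
    simp only [decide_eq_false hv, cond_false, PMF.bind_const, h0]

/-- Every usable guess contributes a square up to the statistical error, and an unusable guess
contributes zero. All guesses but `(n, b)` can thus be discarded, and this one has probability at
least `1 / R ^ 2`. -/
theorem sq_div_le_advantage_add {m : ℕ} (K : CodeFamily F) (σ : Scrambler) (s R : ℕ → ℕ)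
    (out : ∀ n, Matrix (Fin n) (Fin n) F → PMF Data) (n₀ : ℕ) {n b : ℕ}
    (hw : halfPow (K.dim m) ≤ K.dim m)
    (hg : ValidGuess K s n₀ m (n, b)) (hn : n < R m) (hb : b < R m) :
    (prob ((codeColumns K m (halfPow (K.dim m))).bind (testBlock K out n m b)) -
      prob ((randCols F (halfPow (K.dim m)) m).bind (testBlock K out n m b))) ^ 2 / (R m : ℝ) ^ 2 ≤
    advantage (K.mcEliece σ m) (uniform (Matrix (Fin m) (Fin (K.dim m)) F))
      (fun M => (reduction K s R out n₀ (rowsOf M)).map enc) +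
      (1 / 2 : ℝ) ^ (K.dim m - halfPow (K.dim m)) := by
  set w := halfPow (K.dim m) with hwdef
  set η := (1 / 2 : ℝ) ^ (K.dim m - w) with hη
  have hη0 : 0 ≤ η := by positivity
  set p₁ : ℕ × ℕ → ℝ := fun g => prob ((codeColumns K m w).bind (testBlock K out g.1 m g.2))
  set p₀ : ℕ × ℕ → ℝ := fun g => prob ((randCols F w m).bind (testBlock K out g.1 m g.2))
  set U := uniform (Matrix (Fin m) (Fin (K.dim m)) F)
  set P := K.mcEliece σ m
  set G := randGuess (R m)
  have hbind : ∀ D : PMF (Matrix (Fin m) (Fin (K.dim m)) F),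
      ((D.bind fun M => (reduction K s R out n₀ (rowsOf M)).map enc) (Data.ofNat 1)).toReal =
      ∑' g, (G g).toReal * prob (D.bind fun C => reduceGuess K s out n₀ (rowsOf C, g)) := by
    intro D
    rw [← PMF.map_bind, map_enc_apply, ← prob_bind, PMF.bind_comm]
    simp only [reduction, length_rowsOf]
    rfl
  have hU : ∀ g : ℕ × ℕ, prob (U.bind fun C => testBlock K out g.1 m g.2
      (takeColumns w (rowsOf C))) = p₀ g := by
    intro g
    have := takeColumns_uniform (F := F) (m := m) hw
    simp only [p₀, randCols]
    rw [← this, PMF.bind_map]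
    rfl
  have hP : ∀ g : ℕ × ℕ, |prob (P.bind fun C => testBlock K out g.1 m g.2
      (takeColumns w (rowsOf C))) - p₁ g| ≤ η := fun g => mcEliece_columns_le K σ m hw _
  rw [advantage, hbind, hbind, ← (summable_prob G _).tsum_sub (summable_prob G _)]
  -- The lower bound charges the error `η` to every guess, since the weights add up to one.
  have hlow : HasSum (fun g => (if g = (n, b) then (G (n, b)).toReal * (p₁ (n, b) - p₀ (n, b)) ^ 2
      else 0) - (G g).toReal * η) ((G (n, b)).toReal * (p₁ (n, b) - p₀ (n, b)) ^ 2 - 1 * η) :=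
    (hasSum_ite_eq _ _).sub ((hasSum_toReal G).mul_right η)
  have hle : (G (n, b)).toReal * (p₁ (n, b) - p₀ (n, b)) ^ 2 - 1 * η ≤
      ∑' g, ((G g).toReal * prob (P.bind fun C => reduceGuess K s out n₀ (rowsOf C, g)) -
        (G g).toReal * prob (U.bind fun C => reduceGuess K s out n₀ (rowsOf C, g))) := by
    rw [← hlow.tsum_eq]
    refine hlow.summable.tsum_le_tsum (fun g => ?_) ((summable_prob G _).sub (summable_prob G _))
    rw [prob_reduceGuess, prob_reduceGuess, ← mul_sub]
    have hG : 0 ≤ (G g).toReal := ENNReal.toReal_nonneg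
    have key : (if g = (n, b) then (p₁ g - p₀ g) ^ 2 else 0) - η ≤
        (if ValidGuess K s n₀ m g then
          (p₁ g - p₀ g) * (prob (P.bind fun C => testBlock K out g.1 m g.2
            (takeColumns w (rowsOf C))) - p₀ g) else 0) := by
      set x := prob (P.bind fun C => testBlock K out g.1 m g.2 (takeColumns w (rowsOf C)))
      -- The contribution `(p₁ - p₀)(x - p₀)` is `(p₁ - p₀)² + (p₁ - p₀)(x - p₁)`, and the second
      -- term is the error.
      have b1 : |(p₁ g - p₀ g) * (x - p₁ g)| ≤ 1 * η := by
        have a2 := prob_nonneg ((codeColumns K m w).bind (testBlock K out g.1 m g.2))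
        have a3 := prob_le_one ((codeColumns K m w).bind (testBlock K out g.1 m g.2))
        have a4 := prob_nonneg ((randCols F w m).bind (testBlock K out g.1 m g.2))
        have a5 := prob_le_one ((randCols F w m).bind (testBlock K out g.1 m g.2))
        rw [abs_mul]
        refine mul_le_mul (abs_le.2 ⟨?_, ?_⟩) (hP g) (abs_nonneg _) zero_le_one <;>
        · simp only [p₁, p₀]; linarith
      have b2 := (abs_le.1 b1).1
      split_ifs with h1 h2 h2
      · nlinarith
      · exact absurd (h1 ▸ hg) h2
      · nlinarith [sq_nonneg (p₁ g - p₀ g)]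
      · linarith
    have h3 := mul_le_mul_of_nonneg_left key hG
    refine le_trans (le_of_eq ?_) (h3.trans (le_of_eq ?_))
    · split_ifs with h1
      · rw [h1]; ring
      · ring
    · simp only [← hwdef, hU]
      split_ifs
      · simp only [p₁, p₀]; ring
      · ring
  have h4 := le_abs_self (∑' g, ((G g).toReal *
    prob (P.bind fun C => reduceGuess K s out n₀ (rowsOf C, g)) -
        (G g).toReal * prob (U.bind fun C => reduceGuess K s out n₀ (rowsOf C, g))))
  have h5 := mul_le_mul_of_nonneg_right (le_randGuess hn hb) (sq_nonneg (p₁ (n, b) - p₀ (n, b)))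
  have h6 : (p₁ (n, b) - p₀ (n, b)) ^ 2 / (R m : ℝ) ^ 2 =
    1 / (R m : ℝ) ^ 2 * (p₁ (n, b) - p₀ (n, b)) ^ 2 := by ring
  change (p₁ (n, b) - p₀ (n, b)) ^ 2 / (R m : ℝ) ^ 2 ≤ _
  linarith

end Reduction
end Trapdoor

namespace Trapdoor
open Enc (enc)

/-! ### The hybrid argument over all blocks and levels -/

section Telescope

variable {F : Type*} [Field F] [Finite F] {K : CodeFamily F} {th n : ℕ}

theorem IsChain.lt_of_mem (hdim : ∀ m, th < m → K.dim m < m) {r : ℕ} {acc : List ℕ}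
    (h : IsChain K th n r acc) : (∀ x ∈ acc, r < x) ∧ acc.length + r ≤ n := by
  induction acc generalizing r with
  | nil =>
    obtain rfl : r = n := h
    simp
  | cons m up ih =>
    obtain ⟨rfl, h1, h2⟩ := h
    obtain ⟨h3, h4⟩ := ih h2
    have h5 := hdim m h1
    refine ⟨fun x hx => ?_, by rw [List.length_cons]; omega⟩
    rcases List.mem_cons.1 hx with rfl | hx
    · exact h5
    · exact h5.trans (h3 x hx)

theorem IsChain.iterate {r t : ℕ} {acc : List ℕ} (h : IsChain K th n r acc)
    (ht : ∀ x ∈ acc, t < x) : (chainStep K t)^[acc.length] ([], n) = (acc, r) := by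
  induction acc generalizing r with
  | nil =>
    obtain rfl : r = n := h
    rfl
  | cons m up ih =>
    obtain ⟨rfl, -, h2⟩ := h
    rw [List.length_cons, Function.iterate_succ_apply', ih h2 fun x hx => ht x (by simp [hx]),
      chainStep, if_pos (ht m (by simp))]

/-- The reduction knows only `m` and its guess for `n`. It recovers the levels above `m` by running
the chain with `m` itself as threshold. -/
theorem IsChain.chain_eq (hdim : ∀ m, th < m → K.dim m < m) {r : ℕ} {acc : List ℕ}
    (h : IsChain K th n r acc) : chain K r n = (acc, r) := by
  obtain ⟨h1, h2⟩ := h.lt_of_mem hdim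
  have h3 := h.iterate h1
  have h4 : ∀ i, (chainStep K r)^[i] (acc, r) = (acc, r) := by
    intro i
    induction i with
    | zero => rfl
    | succ i ih => rw [Function.iterate_succ_apply', ih, chainStep, if_neg (lt_irrefl r)]
  obtain ⟨i, hi⟩ := Nat.exists_eq_add_of_le (show acc.length ≤ n by omega)
  have h5 : (chainStep K r)^[acc.length + i] ([], n) = (acc, r) := by
    rw [add_comm, Function.iterate_add_apply, h3, h4]
  rwa [← hi] at h5

variable {out : ∀ n, Matrix (Fin n) (Fin n) F → PMF Data}

/-- Telescoping over the blocks of one level; `partialMatrix_le` telescopes over the levels. -/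
theorem partialMatrix_step_le {m : ℕ} (hm : m ≤ n) {δ : ℝ}
    (hδ : ∀ b < width n / halfPow (K.dim m),
      |prob ((codeColumns K m (halfPow (K.dim m))).bind (testBlock K out n m b)) -
        prob ((randCols F (halfPow (K.dim m)) m).bind (testBlock K out n m b))| ≤ δ) :
    |prob ((partialMatrix K n (K.dim m) (m :: (chain K m n).1)).bind fun M => (out n M).map isOne) -
      prob ((partialMatrix K n m (chain K m n).1).bind fun M => (out n M).map isOne)| ≤
      (width n / halfPow (K.dim m) : ℕ) * δ := by
  rw [← hybrid_zero K _ hm, ← hybrid_last K _ hm, PMF.bind_map, PMF.bind_map]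
  have := dist_le_range_sum_of_dist_le (f := fun b => prob ((hybrid K n m b (chain K m n).1).bind
    ((fun M => (out n M).map isOne) ∘ colsToMatrix n))) (d := fun _ => δ)
    (width n / halfPow (K.dim m)) (fun {b} hb => by
      rw [Real.dist_eq, hybrid_eq_left K _ hb, hybrid_eq_right, PMF.bind_bind, PMF.bind_bind]
      exact hδ b hb)
  simpa [Real.dist_eq] using this

theorem partialMatrix_le (hdim : ∀ m, th < m → K.dim m < m) {δ : ℝ} (hδ0 : 0 ≤ δ)
    (hδ : ∀ m ≤ n, th < m → (chain K m n).2 = m → ∀ b < width n / halfPow (K.dim m),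
      |prob ((codeColumns K m (halfPow (K.dim m))).bind (testBlock K out n m b)) -
        prob ((randCols F (halfPow (K.dim m)) m).bind (testBlock K out n m b))| ≤ δ)
    {r : ℕ} {acc : List ℕ} (h : IsChain K th n r acc) :
    |prob ((partialMatrix K n r acc).bind fun M => (out n M).map isOne) -
      prob ((uniform (Matrix (Fin n) (Fin n) F)).bind fun M => (out n M).map isOne)| ≤
      acc.length * (width n * δ) := by
  induction acc generalizing r with
  | nil =>
    obtain rfl : r = n := h
    simp [partialMatrix_nil]
  | cons m up ih =>
    obtain ⟨rfl, h1, h2⟩ := h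
    have hc := h2.chain_eq hdim
    have h3 := ih h2
    have h4 := partialMatrix_step_le h2.le (hδ m h2.le h1 (by rw [hc]))
    rw [hc] at h4
    simp only at h4
    have h5 : ((width n / halfPow (K.dim m) : ℕ) : ℝ) * δ ≤ width n * δ := by
      gcongr
      exact Nat.div_le_self _ _
    rw [List.length_cons, Nat.cast_succ, add_mul, one_mul]
    rw [add_comm (_ * _)]
    exact (abs_sub_le _ _ _).trans (add_le_add (h4.trans h5) h3)

theorem halfPow_le {k : ℕ} (hk : 2 ≤ k) : 2 * halfPow k ≤ k := by
  have h1 : 1 ≤ Nat.log 2 k := Nat.log_pos one_lt_two hk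
  rw [halfPow, ← pow_succ', Nat.sub_add_cancel h1]
  exact Nat.pow_log_le_self 2 (by omega)

/-- Indistinguishability of the matrices built from codes, with a running time `R` for the reduction
that may be superpolynomial. -/
theorem trapdooredOfCodes_indistinguishable (σ : Scrambler) {s R : ℕ → ℕ} (hs : PF s)
    (hR : CompOn Set.univ (fun m => 2 * R m + 2) fun m => PMF.pure (R m)) (hRm : ∀ m, m ≤ R m)
    (hsR : ∀ n m, s n < m → 2 * n + 1 ≤ R m) (hslim : Tendsto s atTop atTop)
    (hdim : ∀ n m, s n < m → K.dim m < m)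
    (hsec : ∀ (B : Prog) (out : ∀ m, Matrix (Fin m) (Fin (K.dim m)) F → PMF Data) (c : ℕ),
      RunsInTime B out (fun m => ((R m : ℝ) + 2) ^ c) → ∀ e : ℕ, ∀ᶠ m in atTop,
        advantage (K.mcEliece σ m) (uniform _) (out m) * (R m : ℝ) ^ e ≤ 1)
    (hk : ∀ e : ℕ, ∀ᶠ m in atTop, (R m : ℝ) ^ e ≤ 2 ^ (K.dim m / 2)) :
    (trapdooredOfCodes K s hs).Indistinguishable := by
  intro A out a hA d
  obtain ⟨n₀, htest⟩ := exists_compOn_test hA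
  obtain ⟨B, c, hB⟩ := exists_reduction_prog K hs hR hRm htest
  -- Advantage and statistical error are each at most `R ^ (-(2d + 9))`. The factor `R ^ 2` for
  -- guessing leaves `2 / R ^ (2d + 7)`, and `R ≥ 2n` makes this at most `δ ^ 2`.
  obtain ⟨m₁, hm₁⟩ := eventually_atTop.1 ((hsec B _ c hB (2 * d + 9)).and
    ((hk (2 * d + 9)).and (hk 1)))
  filter_upwards [hslim.eventually_ge_atTop (m₁ + 2), eventually_ge_atTop (n₀ + 1)] with n hn hn₀
  have hn1 : (1 : ℝ) ≤ n := by exact_mod_cast (by omega : 1 ≤ n)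
  -- At most `n` levels with at most `2n` blocks each lose `δ` per block, `n ^ (-d)` in total.
  set δ : ℝ := 1 / (2 * (n : ℝ) ^ (d + 2)) with hδ
  have hδ0 : 0 < δ := by positivity
  have key := partialMatrix_le (out := out) (hdim n) hδ0.le (fun m hmn hm hc b hb => by
    obtain ⟨h1, h2, h3⟩ := hm₁ m (by omega)
    have hRn := hsR n m hm
    -- If `K.dim m < 2`, then `h3` gives `R m ≤ 1`, although `R m ≥ m > 2`.
    have hk2 : 2 ≤ K.dim m := by
      by_contra hlt
      have : K.dim m / 2 = 0 := by omega
      rw [this, pow_zero, pow_one] at h3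
      have h4 : R m ≤ 1 := by exact_mod_cast h3
      have := hRm m
      omega
    have hw := halfPow_le hk2
    have hbw : b < R m := by
      have := Nat.div_le_self (width n) (halfPow (K.dim m))
      have := width_le (n := n) (by omega)
      omega
    have hadv := sq_div_le_advantage_add K σ s R out n₀ (n := n) (b := b) (by omega)
      ⟨by simp only; omega, hm, hc.le, hc.ge, hb⟩ (by omega) hbw
    set Δ := prob ((codeColumns K m (halfPow (K.dim m))).bind (testBlock K out n m b)) -
        prob ((randCols F (halfPow (K.dim m)) m).bind (testBlock K out n m b))
    have hRpos : (0 : ℝ) < R m := by exact_mod_cast (by omega : 0 < R m)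
    have hRn' : 2 * (n : ℝ) ≤ R m := by exact_mod_cast (by omega : 2 * n ≤ R m)
    have hη : (1 / 2 : ℝ) ^ (K.dim m - halfPow (K.dim m)) ≤ 1 / (R m : ℝ) ^ (2 * d + 9) := by
      refine (pow_le_pow_of_le_one (by norm_num) (by norm_num)
        (show K.dim m / 2 ≤ K.dim m - halfPow (K.dim m) by omega)).trans ?_
      rw [one_div, inv_pow, ← one_div]
      exact one_div_le_one_div_of_le (by positivity) h2
    rw [← le_div_iff₀ (by positivity)] at h1
    have hsq : Δ ^ 2 ≤ δ ^ 2 := by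
      have h4 := hadv.trans (add_le_add h1 hη)
      rw [div_le_iff₀ (by positivity)] at h4
      refine h4.trans ?_
      have e1 : (1 / (R m : ℝ) ^ (2 * d + 9) + 1 / (R m : ℝ) ^ (2 * d + 9)) * (R m : ℝ) ^ 2 =
          2 / (R m : ℝ) ^ (2 * d + 7) := by
        rw [show 2 * d + 9 = 2 * d + 7 + 2 by ring, pow_add (R m : ℝ) (2 * d + 7)]
        field_simp
        norm_num
      have e2 : δ ^ 2 = 2 / (8 * (n : ℝ) ^ (2 * d + 4)) := by
        rw [hδ, div_pow, mul_pow, ← pow_mul]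
        rw [show (d + 2) * 2 = 2 * d + 4 by ring]
        field_simp
        norm_num
      rw [e1, e2]
      refine div_le_div_of_nonneg_left (by norm_num) (by positivity) ?_
      rw [show 2 * d + 7 = 3 + (2 * d + 4) by ring, pow_add _ 3 (2 * d + 4)]
      have h8 : (8 : ℝ) ≤ (R m : ℝ) ^ 3 := by
        have := pow_le_pow_left₀ (by norm_num) (show (2 : ℝ) ≤ R m by linarith) 3
        linarith
      have h9 : (n : ℝ) ^ (2 * d + 4) ≤ (R m : ℝ) ^ (2 * d + 4) :=
        pow_le_pow_left₀ (by positivity) (by linarith) _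
      exact mul_le_mul h8 h9 (by positivity) (by positivity)
    exact abs_le.2 (abs_le_of_sq_le_sq' hsq hδ0.le)) (isChain_chain K (s n) n)
  have hlen := (isChain_chain K (s n) n).lt_of_mem (hdim n)
  rw [← trapdooredOfCodes_matrix K hs] at key
  have hadv : advantage ((trapdooredOfCodes K s hs).matrix n)
      (uniform (Matrix (Fin n) (Fin n) F)) (out n) ≤ n * (2 * n * δ) := by
    rw [advantage, ← prob_map_isOne, ← prob_map_isOne, PMF.map_bind, PMF.map_bind]
    refine key.trans ?_
    have h1 : ((chain K (s n) n).1.length : ℝ) ≤ n := by exact_mod_cast (by omega)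
    have h2 : (width n : ℝ) ≤ 2 * n := by exact_mod_cast width_le (n := n) (by omega)
    gcongr
  refine (mul_le_mul_of_nonneg_right hadv (by positivity)).trans (le_of_eq ?_)
  rw [hδ, pow_add]
  have : (n : ℝ) ≠ 0 := by positivity
  field_simp

end Telescope
end Trapdoor

namespace Trapdoor

/-! ### The number of levels and the size of the circuits -/

section Efficiency

variable {F : Type*} [Field F] [Finite F] {K : CodeFamily F} {th n : ℕ}

theorem chain_le_or (K : CodeFamily F) (th n i : ℕ) :
    ((chainStep K th)^[i] ([], n)).2 ≤ th ∨ ((chainStep K th)^[i] ([], n)).1.length = i := by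
  induction i with
  | zero => exact Or.inr rfl
  | succ i ih =>
    rw [Function.iterate_succ_apply']
    rcases ih with h | h
    · left
      rwa [chainStep, if_neg (by omega)]
    · rw [chainStep]
      split_ifs with h1
      · right
        rw [List.length_cons, h]
      · left
        omega

/-- The chain decreases strictly above `th`, so `n` steps are enough: a chain still running after
`n` steps would have reached `0`. -/
theorem chain_snd_le (hdim : ∀ m, th < m → K.dim m < m) : (chain K th n).2 ≤ th := by
  rcases chain_le_or K th n n with h | h
  · exact h
  · have := ((isChain_chain K th n).lt_of_mem hdim).2
    have h' : (chain K th n).1.length = n := h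
    omega

/-- Each level shrinks the length by the factor `ρ` at least, so there are at most `log n / (-log
ρ)` levels. -/
theorem IsChain.length_mul_le {ρ : ℝ} (hρ : 0 < ρ) (hth : ∀ m, th < m → (K.dim m : ℝ) ≤ ρ * m)
    (hpos : ∀ m, th < m → 0 < K.dim m) {r : ℕ} {acc : List ℕ} (h : IsChain K th n r acc) :
    acc.length * -Real.log ρ + Real.log r ≤ Real.log n := by
  induction acc generalizing r with
  | nil =>
    obtain rfl : r = n := h
    simp
  | cons m up ih =>
    obtain ⟨rfl, h1, h2⟩ := h
    have h3 := ih h2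
    have hk : (0 : ℝ) < K.dim m := by exact_mod_cast hpos m h1
    have hm : (0 : ℝ) < m := by exact_mod_cast (by omega : 0 < m)
    have h4 := Real.log_le_log hk (hth m h1)
    rw [Real.log_mul hρ.ne' hm.ne'] at h4
    rw [List.length_cons, Nat.cast_succ]
    linarith

theorem IsChain.mem_bounds {r : ℕ} {acc : List ℕ} (h : IsChain K th n r acc) :
    ∀ m ∈ acc, th < m ∧ m ≤ n := by
  induction acc generalizing r with
  | nil => simp
  | cons m up ih =>
    intro x hx
    rcases List.mem_cons.1 hx with rfl | hx
    · exact ⟨h.2.1, h.2.2.le⟩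
    · exact ih h.2.2 x hx

/-- The constant is `2 * 4`, from `width n ≤ 2n` and `halfPow k > k / 4`. -/
theorem width_div_halfPow_le {k : ℕ} (hn : n ≠ 0) (hk : 2 ≤ k) :
    ((width n / halfPow k : ℕ) : ℝ) ≤ 8 * n / k := by
  have hkpos : (0 : ℝ) < k := by exact_mod_cast (by omega : 0 < k)
  rw [le_div_iff₀ hkpos]
  have h1 : 1 ≤ Nat.log 2 k := Nat.log_pos one_lt_two hk
  have h2 : k < 4 * halfPow k := by
    have := Nat.lt_pow_succ_log_self (b := 2) one_lt_two k
    have e : 2 ^ (Nat.log 2 k).succ = 4 * halfPow k := by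
      rw [halfPow, show (Nat.log 2 k).succ = Nat.log 2 k - 1 + 2 by omega, pow_add]
      ring
    omega
  have h3 := Nat.div_mul_le_self (width n) (halfPow k)
  have h4 := width_le hn
  have h5 : width n / halfPow k * k ≤ 8 * n := by
    have := Nat.mul_le_mul_left (width n / halfPow k) h2.le
    nlinarith
  exact_mod_cast h5

theorem levelCost_le {E : ℕ → ℕ} {N : ℕ} {acc : List ℕ} {X : ℝ}
    (h : ∀ m ∈ acc, ((N / halfPow (K.dim m) : ℕ) : ℝ) * (E m + m) ≤ X) :
    (levelCost K E N acc : ℝ) ≤ acc.length * X := by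
  induction acc with
  | nil => simp [levelCost]
  | cons m up ih =>
    have h1 := ih fun x hx => h x (by simp [hx])
    have h2 := h m (by simp)
    rw [levelCost] at h1 ⊢
    rw [List.map_cons, List.sum_cons, List.length_cons]
    push_cast at h1 h2 ⊢
    linarith

/-- The size of the circuits, when the ratio of length and dimension is at most `Q`. -/
theorem trapdooredOfCodes_size_le {s : ℕ → ℕ} (hs : PF s) {ρ Q : ℝ} {a : ℕ} (hρ : 0 < ρ)
    (hρ1 : ρ < 1) (h3 : 3 ≤ s n) (hn : 1 ≤ n)
    (hrate : ∀ m, s n < m → (K.dim m : ℝ) ≤ ρ * m) (hpos : ∀ m, s n < m → 2 ≤ K.dim m)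
    (hsize : ∀ m, s n < m → ∀ MC ∈ (K.gen.dist m).support,
      (MC.2.size : ℝ) ≤ ((m : ℝ) + K.dim m) * Real.log m ^ a)
    (hQ0 : 0 ≤ Q) (hQ : ∀ m, s n < m → m ≤ n → (m : ℝ) ≤ K.dim m * Q)
    {MC : Matrix (Fin n) (Fin n) F × Circuit F n n}
    (h : MC ∈ ((trapdooredOfCodes K s hs).dist n).support) :
    (MC.2.size : ℝ) ≤ n * (3 + 6 * s n + 24 / -Real.log ρ * (Q * Real.log n ^ (a + 1))) := by
  have hdim : ∀ m, s n < m → K.dim m < m := by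
    intro m hm
    have h1 := hrate m hm
    have h2 : (0 : ℝ) < m := by exact_mod_cast (by omega : 0 < m)
    have : (K.dim m : ℝ) < m := h1.trans_lt (by nlinarith)
    exact_mod_cast this
  have hc : 0 < -Real.log ρ := by have := Real.log_neg hρ hρ1; linarith
  have hn1 : (1 : ℝ) ≤ n := by exact_mod_cast hn
  have hlogn : 0 ≤ Real.log n := Real.log_nonneg hn1
  set E : ℕ → ℕ := fun m => ⌊((m : ℝ) + K.dim m) * Real.log m ^ a⌋₊ with hE
  have h1 := trapdooredOfCodes_size (K := K) hs (n := n) (E := E) (fun m hm MC hMC => by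
    refine Nat.le_floor ?_
    refine le_trans ?_ (hsize m hm MC hMC)
    rw [Circuit.size]
    exact_mod_cast (by omega)) h
  have hr : (chain K (s n) n).2 ≤ s n := chain_snd_le hdim
  have hchain := isChain_chain K (s n) n
  set acc := (chain K (s n) n).1
  have hlen : (acc.length : ℝ) ≤ Real.log n / -Real.log ρ := by
    have h4 := hchain.length_mul_le hρ hrate fun m hm => by have := hpos m hm; omega
    have h5 := Real.log_natCast_nonneg (chain K (s n) n).2
    rw [le_div_iff₀ hc]
    linarith
  have hcost : (levelCost K E (width n) acc : ℝ) ≤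
      acc.length * (24 * n * (Q * Real.log n ^ a)) := by
    refine levelCost_le fun m hm => ?_
    obtain ⟨hm1, hm2⟩ := hchain.mem_bounds m hm
    have hk := hpos m hm1
    have hkpos : (0 : ℝ) < K.dim m := by exact_mod_cast (by omega : 0 < K.dim m)
    have hmpos : (0 : ℝ) < m := by exact_mod_cast (by omega : 0 < m)
    have hlog1 : 1 ≤ Real.log m := by
      rw [Real.le_log_iff_exp_le hmpos]
      have : (3 : ℝ) ≤ m := by exact_mod_cast (by omega : 3 ≤ m)
      linarith [Real.exp_one_lt_d9]
    have hlogm : Real.log m ≤ Real.log n := Real.log_le_log hmpos (by exact_mod_cast hm2)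
    have hpow : Real.log m ^ a ≤ Real.log n ^ a := pow_le_pow_left₀ (by linarith) hlogm a
    have hpow1 : 1 ≤ Real.log m ^ a := one_le_pow₀ hlog1
    have hkm : (K.dim m : ℝ) ≤ m := by exact_mod_cast K.dim_le m
    have hEm : (E m : ℝ) + m ≤ 3 * m * Real.log n ^ a := by
      have h6 : (E m : ℝ) ≤ ((m : ℝ) + K.dim m) * Real.log m ^ a :=
        Nat.floor_le (by positivity)
      have h7 : ((m : ℝ) + K.dim m) * Real.log m ^ a ≤ (2 * m) * Real.log n ^ a := by
        gcongr
        linarith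
      have h8 : (m : ℝ) * 1 ≤ m * Real.log n ^ a := by
        gcongr
        linarith
      linarith
    have hQm := hQ m hm1 hm2
    -- At most `8n / k` blocks, each of cost at most `3m log ^ a n` (two parts for encoding, one for
    -- additions), and `m ≤ kQ`.
    calc ((width n / halfPow (K.dim m) : ℕ) : ℝ) * (E m + m)
        ≤ (8 * n / K.dim m) * (3 * m * Real.log n ^ a) := by
          gcongr
          exact width_div_halfPow_le (by omega) hk
      _ ≤ (8 * n / K.dim m) * (3 * (K.dim m * Q) * Real.log n ^ a) := by gcongr
      _ = 24 * n * (Q * Real.log n ^ a) := by field_simp; ring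
  have hX : 0 ≤ 24 * (n : ℝ) * (Q * Real.log n ^ a) := by positivity
  have h2 : (MC.2.size : ℝ) ≤ 2 * n + 1 + 3 * (width n * (chain K (s n) n).2) +
      levelCost K E (width n) acc := by exact_mod_cast h1
  have hw : (width n : ℝ) ≤ 2 * n := by exact_mod_cast width_le (n := n) (by omega)
  have hr' : ((chain K (s n) n).2 : ℝ) ≤ s n := by exact_mod_cast hr
  have h4 : (width n : ℝ) * (chain K (s n) n).2 ≤ 2 * n * s n := by gcongr
  have h5 := hcost.trans (mul_le_mul_of_nonneg_right hlen hX)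
  have h6 : Real.log n / -Real.log ρ * (24 * n * (Q * Real.log n ^ a)) =
      n * (24 / -Real.log ρ * (Q * Real.log n ^ (a + 1))) := by
    rw [pow_succ]; field_simp
  rw [h6] at h5
  linarith

end Efficiency
end Trapdoor

namespace Trapdoor

/-! ### Integral roots -/

section Root

/-- The integral part of the `c`-th root. -/
def root (c n : ℕ) : ℕ := Nat.findGreatest (fun t => t ^ c ≤ n) n

@[fun_prop]
theorem PF.root {χ : Type*} [Enc χ] (c : ℕ) {f : χ → ℕ} (hf : PF f) : PF fun x => root c (f x) := by
  unfold Trapdoor.root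
  exact PF.findGreatest hf (by fun_prop)

theorem root_pow_le {c : ℕ} (hc : c ≠ 0) (n : ℕ) : root c n ^ c ≤ n :=
  Nat.findGreatest_spec (P := fun t => t ^ c ≤ n) (Nat.zero_le n) (by simp [hc])

theorem lt_root_succ_pow {c : ℕ} (hc : c ≠ 0) (n : ℕ) : n < (root c n + 1) ^ c := by
  rcases Nat.lt_or_ge (root c n) n with h | h
  · by_contra hle
    exact Nat.findGreatest_is_greatest (P := fun t => t ^ c ≤ n) (Nat.lt_succ_self (root c n)) h
      (not_lt.1 hle)
  · exact (Nat.lt_succ_of_le h).trans_le (Nat.le_self_pow hc _)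

theorem root_le_rpow {c : ℕ} (hc : c ≠ 0) (n : ℕ) : (root c n : ℝ) ≤ (n : ℝ) ^ ((c : ℝ)⁻¹) := by
  have h : ((root c n : ℝ)) ^ c ≤ n := by exact_mod_cast root_pow_le hc n
  rw [← Real.pow_rpow_inv_natCast (Nat.cast_nonneg (root c n)) hc]
  exact Real.rpow_le_rpow (by positivity) h (by positivity)

theorem tendsto_root {c : ℕ} (hc : c ≠ 0) : Tendsto (root c) atTop atTop := by
  refine tendsto_atTop.2 fun b => ?_
  filter_upwards [eventually_ge_atTop (b ^ c)] with n hn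
  by_contra h
  have h1 := lt_root_succ_pow hc n
  have h2 : (root c n + 1) ^ c ≤ b ^ c := Nat.pow_le_pow_left (by omega) c
  omega

end Root

/-! ### The polynomial McEliece assumption -/

section PolynomialPart

variable {F : Type*} [Field F] [Finite F] {K : CodeFamily F}

theorem RunsInTime.mono {r c : ℕ → ℕ} {A : Prog}
    {out : ∀ n, Matrix (Fin (r n)) (Fin (c n)) F → PMF Data} {T T' : ℕ → ℝ}
    (h : RunsInTime A out T) (hT : ∀ᶠ n in atTop, T n ≤ T' n) : RunsInTime A out T' := by
  filter_upwards [h, hT] with n hn hT M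
  obtain ⟨t, ht, hr⟩ := hn M
  exact ⟨t, ht.trans hT, hr⟩

theorem eventually_pow_le_two_pow (D : ℕ) : ∀ᶠ k : ℕ in atTop, (k : ℝ) ^ D ≤ 2 ^ (k / 2) := by
  have h := tendsto_pow_const_div_const_pow_of_one_lt D (show (1 : ℝ) < √2 by
    rw [Real.lt_sqrt zero_le_one]; norm_num)
  filter_upwards [h.eventually_le_const (show (0 : ℝ) < 1 / 2 by norm_num)] with k hk
  rw [div_le_iff₀ (by positivity)] at hk
  refine hk.trans ?_
  have h2 : (√2 : ℝ) ≤ 2 := by rw [Real.sqrt_le_left (by norm_num)]; norm_num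
  -- The factor `2` accounts for the rounding in `k / 2`; the `1 / 2` in the limit above makes up
  -- for it.
  have h3 : (√2 : ℝ) ^ k ≤ 2 * 2 ^ (k / 2) := by
    conv_lhs => rw [← Nat.div_add_mod k 2]
    rw [pow_add, pow_mul, Real.sq_sqrt (by norm_num), mul_comm]
    gcongr
    rcases Nat.mod_two_eq_zero_or_one k with h | h <;> rw [h]
    · norm_num
    · simp [h2]
  linarith

theorem exists_threshold (K : CodeFamily F) (hrate : K.RateBelowOne)
    (hk : ∀ᶠ m in atTop, 2 ≤ K.dim m) : ∃ ρ : ℝ, 0 < ρ ∧ ρ < 1 ∧ ∃ a : ℕ, ∀ᶠ m₀ in atTop,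
      3 ≤ m₀ ∧ ∀ m, m₀ < m → (K.dim m : ℝ) ≤ ρ * m ∧ 2 ≤ K.dim m ∧ K.dim m < m ∧
      ∀ MC ∈ (K.gen.dist m).support, (MC.2.size : ℝ) ≤ ((m : ℝ) + K.dim m) * Real.log m ^ a := by
  obtain ⟨ρ, hρ1, hρ⟩ := hrate
  obtain ⟨a, ha⟩ := K.nearLinear
  -- The rate bound is made positive because the number of levels is expressed through its
  -- logarithm.
  refine ⟨max ρ (1 / 2), by positivity, max_lt hρ1 (by norm_num), a, ?_⟩
  obtain ⟨m₁, h⟩ := eventually_atTop.1 ((hρ.and hk).and ha)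
  filter_upwards [eventually_ge_atTop m₁, eventually_ge_atTop 3] with m₀ h1 h3
  refine ⟨h3, fun m hm => ?_⟩
  obtain ⟨⟨h4, h5⟩, h6⟩ := h m (by omega)
  have hm0 : (0 : ℝ) < m := by exact_mod_cast (by omega : 0 < m)
  have hmax : ρ * m ≤ max ρ (1 / 2) * m := by gcongr; exact le_max_left _ _
  refine ⟨h4.trans hmax, h5, ?_, h6⟩
  have : (K.dim m : ℝ) < m := h4.trans_lt (by nlinarith)
  exact_mod_cast this

/-- The length is polynomial in the dimension. -/
theorem exists_le_dim_pow {δ B : ℝ} (hδ : δ < 1)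
    (hB : ∀ᶠ n : ℕ in atTop, (n : ℝ) ≤ B * K.dim n * (n : ℝ) ^ δ) :
    ∃ t : ℕ, ∀ᶠ m : ℕ in atTop, (m : ℝ) ≤ (K.dim m : ℝ) ^ t := by
  -- With `(1 - δ)t ≥ 2`, the power `t` of `m ^ (1 - δ) ≤ |B| k` gives `m * m ≤ |B| ^ t * k ^ t`,
  -- and one factor `m` absorbs `|B| ^ t`.
  obtain ⟨t, ht⟩ := exists_nat_ge (2 / (1 - δ))
  have ht : 2 ≤ (1 - δ) * t := by
    rw [div_le_iff₀ (by linarith)] at ht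
    linarith
  refine ⟨t, ?_⟩
  filter_upwards [hB, eventually_ge_atTop 1, eventually_ge_atTop ⌈(|B|) ^ t⌉₊] with m hm h1 hBm
  have hm1 : (1 : ℝ) ≤ m := by exact_mod_cast h1
  have hm0 : (0 : ℝ) < m := by linarith
  have hBm : |B| ^ t ≤ m := Nat.ceil_le.1 hBm
  have h2 : (m : ℝ) ^ (1 - δ) ≤ |B| * K.dim m := by
    rw [Real.rpow_sub hm0, Real.rpow_one, div_le_iff₀ (Real.rpow_pos_of_pos hm0 δ)]
    refine hm.trans ?_
    gcongr
    exact le_abs_self B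
  have h3 := pow_le_pow_left₀ (by positivity) h2 t
  rw [← Real.rpow_natCast, ← Real.rpow_mul hm0.le, mul_pow] at h3
  have h4 : (m : ℝ) * m ≤ m ^ ((1 - δ) * t) := by
    rw [← pow_two, ← Real.rpow_natCast]
    exact Real.rpow_le_rpow_of_exponent_le hm1 (by exact_mod_cast ht)
  have h5 : |B| ^ t * (K.dim m : ℝ) ^ t ≤ m * (K.dim m : ℝ) ^ t := by gcongr
  exact le_of_mul_le_mul_left (h4.trans (h3.trans h5)) hm0

theorem tendsto_dim_of_le_pow {t : ℕ} (h : ∀ᶠ m : ℕ in atTop, (m : ℝ) ≤ (K.dim m : ℝ) ^ t) :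
    Tendsto K.dim atTop atTop := by
  refine tendsto_atTop.2 fun b => ?_
  filter_upwards [h, eventually_gt_atTop (b ^ t)] with m hm hb
  by_contra hlt
  have h1 : m ≤ K.dim m ^ t := by exact_mod_cast hm
  have h2 : K.dim m ^ t ≤ b ^ t := Nat.pow_le_pow_left (by omega) t
  omega

theorem eventually_add_mul_log_le {ε δ γ : ℝ} (hε : 0 < ε) (hδ : δ < ε) (hγ : γ < ε)
    (A D M C B : ℝ) (b : ℕ) : ∀ᶠ x : ℝ in atTop,
      A + D * (x ^ γ + M) + C * (B * x ^ δ * Real.log x ^ b) ≤ x ^ ε := by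
  have hconst : ∀ c : ℝ, (fun _ : ℝ => c) =o[atTop] fun x : ℝ => x ^ ε := fun c =>
    Asymptotics.isLittleO_const_left.2 (Or.inr (tendsto_norm_atTop_atTop.comp (tendsto_rpow_atTop hε)))
  have hlog : ∀ u < ε, ∀ b : ℕ,
      (fun x : ℝ => x ^ u * Real.log x ^ b) =o[atTop] fun x : ℝ => x ^ ε := by
    intro u hu b
    have h1 := (Asymptotics.isBigO_refl (fun x : ℝ => x ^ u) atTop).mul_isLittleO
      (isLittleO_log_rpow_rpow_atTop b (sub_pos.2 hu))
    refine h1.congr' (Eventually.of_forall fun x => by simp) ?_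
    filter_upwards [eventually_gt_atTop 0] with x hx
    rw [← Real.rpow_add hx]
    congr 1
    ring
  have h := ((hconst A).add (((hlog γ hγ 0).add (hconst M)).const_mul_left D)).add
    (((hlog δ hδ b).const_mul_left B).const_mul_left C)
  filter_upwards [h.bound one_pos, eventually_gt_atTop 0] with x hx hx0
  rw [one_mul, Real.norm_of_nonneg (Real.rpow_nonneg hx0.le ε)] at hx
  refine le_trans (le_of_eq ?_) ((Real.le_norm_self _).trans hx)
  rw [pow_zero]
  ring

/-- The threshold is about `n ^ (1/c)` with `1/c < ε`. It is small enough for the initial products,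
of cost about `n ^ (1 + 1/c)`, and large enough for `n` to be polynomial in every `m` that occurs,
so a polynomial range of guesses suffices. -/
theorem exists_trapdooredFamily_of_polyMcEliece (σ : Scrambler) {ε δ : ℝ} (hδ0 : 0 ≤ δ)
    (hδε : δ < ε) (hδ1 : δ < 1) (K : CodeFamily F) (hrate : K.RateBelowOne)
    (hB : ∃ B : ℝ, ∀ᶠ n : ℕ in atTop, (n : ℝ) ≤ B * K.dim n * (n : ℝ) ^ δ)
    (hK : K.PolyMcEliece σ) : ∃ D : TrapdooredFamily F (fun n => n) (fun n => n),
      D.Indistinguishable ∧ D.Efficient fun n => (n : ℝ) ^ (1 + ε) := by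
  obtain ⟨B, hB⟩ := hB
  obtain ⟨t, ht⟩ := exists_le_dim_pow hδ1 hB
  have hdim := tendsto_dim_of_le_pow ht
  obtain ⟨ρ, hρ0, hρ1, a, hth⟩ := exists_threshold K hrate (hdim.eventually_ge_atTop 2)
  obtain ⟨m₁, hm₁⟩ := eventually_atTop.1 hB
  obtain ⟨m₀, ⟨hm₀, hth⟩, hm₁'⟩ := (hth.and (eventually_ge_atTop m₁)).exists
  obtain ⟨c, hc⟩ := exists_nat_gt (1 / ε)
  have hε : 0 < ε := by linarith
  have hc0 : c ≠ 0 := by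
    rintro rfl
    have : 0 < 1 / ε := by positivity
    simp only [Nat.cast_zero] at hc
    linarith
  have hs : PF fun n => root c n + m₀ := by fun_prop
  -- If `m` exceeds the threshold then `n < m ^ c`, so `2n + 1 ≤ R m`; the summand `m` provides `m ≤
  -- R m`.
  set R : ℕ → ℕ := fun m => 2 * m ^ c + m + 1 with hRdef
  have hRpf : PF R := by simp only [hRdef]; fun_prop
  have hRk : ∃ u : ℕ, ∀ᶠ m in atTop, (R m : ℝ) + 2 ≤ (K.dim m : ℝ) ^ u := by
    refine ⟨t * (c + 3), ?_⟩
    filter_upwards [ht, eventually_ge_atTop 2] with m hm h2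
    rw [pow_mul]
    refine le_trans ?_ (pow_le_pow_left₀ (by positivity) hm (c + 3))
    have : R m + 2 ≤ m ^ (c + 3) := by
      have e1 : 1 ≤ m ^ c := Nat.one_le_pow _ _ (by omega)
      have e2 : m ^ (c + 3) = m ^ c * m ^ 3 := pow_add _ _ _
      have e3 : m ^ 3 = m * (m * m) := by ring
      have e4 : 2 * m ≤ m * m := Nat.mul_le_mul_right m h2
      simp only [hRdef]
      rw [e2]
      nlinarith [Nat.mul_le_mul e1 (le_refl (m ^ 3)), Nat.mul_le_mul_left m e4]
    exact_mod_cast this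
  obtain ⟨u, hu⟩ := hRk
  have hRpow : ∀ e : ℕ, ∀ᶠ m in atTop, (R m : ℝ) ^ e ≤ (K.dim m : ℝ) ^ (u * e) := by
    intro e
    filter_upwards [hu] with m hm
    rw [pow_mul]
    exact pow_le_pow_left₀ (by positivity) (by linarith) e
  refine ⟨trapdooredOfCodes K _ hs, ?_, ?_⟩
  · refine trapdooredOfCodes_indistinguishable σ hs (R := R) (hRpf.compOn fun m _ => ?_)
      (fun m => ?_) (fun n m hm => ?_) ?_ (fun n m hm => (hth m (by omega)).2.2.1) ?_ fun e => ?_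
    · rw [esize_nat]; simp only [hRdef]; omega
    · simp only [hRdef]; omega
    · simp only [hRdef]
      have h1 := lt_root_succ_pow hc0 n
      have h2 : (root c n + 1) ^ c ≤ m ^ c := Nat.pow_le_pow_left (by omega) c
      omega
    · exact tendsto_atTop_mono (fun n => Nat.le_add_right _ _) (tendsto_root hc0)
    · intro A out b hA e
      have hrun : RunsInTime A out fun m => (K.dim m : ℝ) ^ (u * b) + (u * b : ℕ) := by
        refine hA.mono ?_
        filter_upwards [hu] with m hm
        have := pow_le_pow_left₀ (by positivity) hm b
        rw [← pow_mul] at this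
        have h0 : (0 : ℝ) ≤ (u * b : ℕ) := Nat.cast_nonneg _
        linarith
      filter_upwards [hK A out (u * b) hrun (u * e), hRpow e] with m h1 h2
      refine le_trans ?_ h1
      gcongr
      exact abs_nonneg _
    · filter_upwards [hRpow e, hdim.eventually (eventually_pow_le_two_pow (u * e))] with m h1 h2
      exact h1.trans h2
  · have hlim : ∀ᶠ n : ℕ in atTop, 3 + 6 * ((n : ℝ) ^ ((c : ℝ)⁻¹) + m₀) + 24 / -Real.log ρ *
        (|B| * (n : ℝ) ^ δ * Real.log n ^ (a + 1)) ≤ (n : ℝ) ^ ε :=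
      tendsto_natCast_atTop_atTop.eventually (eventually_add_mul_log_le hε hδε
        (inv_lt_of_inv_lt₀ hε (by rwa [one_div] at hc)) 3 6 m₀ (24 / -Real.log ρ) |B| (a + 1))
    filter_upwards [hlim, eventually_ge_atTop 1] with n hn h1 MC hMC
    have hn0 : (0 : ℝ) < n := by exact_mod_cast h1
    have h2 := trapdooredOfCodes_size_le hs (Q := |B| * (n : ℝ) ^ δ) (a := a) hρ0 hρ1
      (n := n) (by omega) h1 (fun m hm => (hth m (by omega)).1) (fun m hm => (hth m (by omega)).2.1)
      (fun m hm => (hth m (by omega)).2.2.2) (by positivity) (fun m hm hmn => by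
        refine (hm₁ m (by omega)).trans ?_
        rw [mul_comm B, mul_assoc]
        gcongr
        exact le_abs_self B) hMC
    refine h2.trans ?_
    rw [Real.rpow_add hn0, Real.rpow_one]
    gcongr
    refine le_trans ?_ hn
    have h3 := root_le_rpow hc0 n
    push_cast
    gcongr

end PolynomialPart
end Trapdoor

namespace Trapdoor

/-! ### The subexponential McEliece assumption -/

section Subexponential

variable {F : Type*} [Field F] [Finite F] {K : CodeFamily F}

/-- A running time that is subexponential in `m`. -/
def subexp (q m : ℕ) : ℕ := m + 2 ^ (root q m + 2)

/-- The power of two is obtained by repeated doubling, in time polynomial in the value itself. Time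
is therefore measured by the output; the summand `m` lets this measure dominate the input too. -/
theorem compOn_subexp (q : ℕ) :
    CompOn Set.univ (fun m => 2 * subexp q m + 2) fun m => PMF.pure (subexp q m) := by
  have hV : ∀ m ∈ (Set.univ : Set ℕ), esize m < 2 * subexp q m + 2 := fun m _ => by
    rw [esize_nat, subexp]
    generalize 2 ^ (root q m + 2) = y
    omega
  have hl : PF fun m => List.range (root q m + 2) := by fun_prop
  have h := CompOn.fold (f := fun _ s _ => PMF.pure (s + s)) (hl.compOn hV)
    ((PF.const 1).compOn hV) (show Poly fun p : ℕ × ℕ × ℕ => PMF.pure (p.2.1 + p.2.1) from by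
      change PF fun p : ℕ × ℕ × ℕ => p.2.1 + p.2.1
      fun_prop)
    (fun _ i s => s = 2 ^ i) (fun _ _ => rfl) (fun x _ i s b _ _ hs s' hs' => by
      rw [PMF.mem_support_pure_iff] at hs'
      rw [hs', hs, pow_succ]; ring) _ PBd.self (fun m _ i s hi hs => by
      rw [List.length_range] at hi
      rw [esize_nat, hs]
      simp only [subexp]
      have := Nat.pow_le_pow_right (n := 2) two_pos hi
      omega)
  have hfold : ∀ t, (List.range t).foldl (fun s _ => s + s) 1 = 2 ^ t := by
    intro t
    induction t with
    | zero => rfl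
    | succ t ih => rw [List.range_succ, List.foldl_append, ih, pow_succ]; simp; ring
  simp only [foldP_pure, hfold] at h
  have h2 := CompOn.bind h (g := fun m v => PMF.pure (m + v)) (by
    change PF fun p : ℕ × ℕ => p.1 + p.2
    fun_prop)
  simp only [PMF.pure_bind] at h2
  exact h2

/-- Above the threshold `(log n) ^ q` the root of `m` is at least `log n`, so the power of two
exceeds `2n`. -/
theorem le_subexp {q n m : ℕ} (hq : q ≠ 0) (h : Nat.log 2 n ^ q < m) : 2 * n + 1 ≤ subexp q m := by
  have h1 : Nat.log 2 n ≤ root q m := by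
    by_contra hlt
    have h2 := lt_root_succ_pow hq m
    have h3 : (root q m + 1) ^ q ≤ Nat.log 2 n ^ q := Nat.pow_le_pow_left (by omega) q
    omega
  have h2 := Nat.lt_pow_succ_log_self (b := 2) one_lt_two n
  have h3 : 2 ^ (Nat.log 2 n).succ ≤ 2 ^ (root q m + 1) := Nat.pow_le_pow_right two_pos (by omega)
  have h4 : 2 ^ (root q m + 2) = 2 * 2 ^ (root q m + 1) := by rw [pow_succ' 2 (root q m + 1)]
  rw [subexp]
  omega

theorem rpow_le_dim {b : ℕ} (hb : ∀ᶠ n : ℕ in atTop, (n : ℝ) ≤ K.dim n * Real.log n ^ b) {θ : ℝ}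
    (hθ : θ < 1) : ∀ᶠ m : ℕ in atTop, (m : ℝ) ^ θ ≤ K.dim m := by
  have h := tendsto_natCast_atTop_atTop.eventually
    (eventually_add_mul_log_le (sub_pos.2 hθ) (sub_pos.2 hθ) (sub_pos.2 hθ) 0 0 0 1 1 b (δ := 0)
      (γ := 0))
  filter_upwards [h, hb, eventually_ge_atTop 1] with m h1 h2 h3
  have hm : (0 : ℝ) < m := by exact_mod_cast h3
  simp only [zero_mul, zero_add, one_mul, Real.rpow_zero] at h1
  have h4 : (m : ℝ) ≤ K.dim m * (m : ℝ) ^ (1 - θ) := h2.trans (by gcongr)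
  rw [Real.rpow_sub hm, Real.rpow_one, mul_div_assoc', le_div_iff₀ (Real.rpow_pos_of_pos hm θ),
    mul_comm] at h4
  exact le_of_mul_le_mul_right h4 hm

/-- For `1/q < β < α` one has `m ^ (1/q) ≪ m ^ β ≤ k ^ α`, since near-constant rate gives `k ≥ m ^
(β/α)`. The room between `1/q` and `β` absorbs the exponent `c`. -/
theorem subexp_pow_le {b q : ℕ} (hb : ∀ᶠ n : ℕ in atTop, (n : ℝ) ≤ K.dim n * Real.log n ^ b)
    (hq : q ≠ 0) {α : ℝ} (hα : 0 < α) (hqα : (q : ℝ)⁻¹ < α) (c : ℕ) :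
    ∀ᶠ m : ℕ in atTop, ((subexp q m : ℝ) + 2) ^ c ≤ (2 : ℝ) ^ ((K.dim m : ℝ) ^ α) := by
  obtain ⟨β, hβ1, hβ2⟩ := exists_between hqα
  have hq0 : (0 : ℝ) < (q : ℝ)⁻¹ := by positivity
  have hβ0 : 0 < β := hq0.trans hβ1
  have h := tendsto_natCast_atTop_atTop.eventually
    (eventually_add_mul_log_le hβ0 hβ0 hβ1 0 c 2 (2 * c / Real.log 2) 1 1)
  filter_upwards [h, rpow_le_dim hb (show β / α < 1 by rwa [div_lt_one hα]),
    eventually_ge_atTop 2] with m h1 h2 h3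
  have hm : (2 : ℝ) ≤ m := by exact_mod_cast h3
  have hm0 : (0 : ℝ) < m := by linarith
  have hl2 : 0 < Real.log 2 := Real.log_pos one_lt_two
  have hβk : (m : ℝ) ^ β ≤ (K.dim m : ℝ) ^ α := by
    have := Real.rpow_le_rpow (by positivity) h2 hα.le
    rwa [← Real.rpow_mul hm0.le, div_mul_cancel₀ _ hα.ne'] at this
  refine le_trans ?_ (Real.rpow_le_rpow_of_exponent_le one_le_two hβk)
  rw [Real.le_rpow_iff_log_le (by positivity) two_pos, Real.log_pow]
  have h4 : (subexp q m : ℝ) + 2 ≤ (m * m) * 2 ^ (root q m + 2) := by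
    have e : subexp q m + 2 ≤ (m * m) * 2 ^ (root q m + 2) := by
      rw [subexp]
      have e1 : 2 ^ 2 ≤ 2 ^ (root q m + 2) := Nat.pow_le_pow_right two_pos (by omega)
      generalize 2 ^ (root q m + 2) = y at e1
      have e2 : 2 * m ≤ m * m := Nat.mul_le_mul_right m h3
      nlinarith [Nat.mul_le_mul_right y e2]
    exact_mod_cast e
  have h5 : Real.log ((subexp q m : ℝ) + 2) ≤ 2 * Real.log m + (root q m + 2) * Real.log 2 := by
    refine (Real.log_le_log (by positivity) h4).trans (le_of_eq ?_)
    rw [Real.log_mul (by positivity) (by positivity), Real.log_mul hm0.ne' hm0.ne', Real.log_pow]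
    push_cast
    ring
  have h6 := root_le_rpow hq m
  have h7 : (c : ℝ) * Real.log ((subexp q m : ℝ) + 2) ≤
      c * (2 * Real.log m + ((m : ℝ) ^ ((q : ℝ)⁻¹) + 2) * Real.log 2) := by
    gcongr
    refine h5.trans ?_
    gcongr
  refine h7.trans ?_
  rw [Real.rpow_zero, pow_one, one_mul, one_mul, zero_add] at h1
  have h8 := mul_le_mul_of_nonneg_right h1 hl2.le
  refine le_trans (le_of_eq ?_) h8
  field_simp
  ring

/-- With threshold `(log n) ^ q` the initial products are near-linear. The reduction takes time
superpolynomial in `m`, which the assumption allows because `q > 1/α`. -/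
theorem exists_trapdooredFamily_of_subexpMcEliece (σ : Scrambler) (K : CodeFamily F)
    (hrate : K.RateBelowOne)
    (hb : ∃ b : ℕ, ∀ᶠ n : ℕ in atTop, (n : ℝ) ≤ K.dim n * Real.log n ^ b)
    (hK : K.SubexpMcEliece σ) : ∃ D : TrapdooredFamily F (fun n => n) (fun n => n),
      D.Indistinguishable ∧ ∃ a : ℕ, D.Efficient fun n => (n : ℝ) * Real.log n ^ a := by
  obtain ⟨b, hb⟩ := hb
  obtain ⟨α, hα0, hα1, hsec⟩ := hK
  obtain ⟨q, hq⟩ := exists_nat_gt (1 / α)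
  have hq0 : q ≠ 0 := by
    rintro rfl
    have : 0 < 1 / α := by positivity
    simp only [Nat.cast_zero] at hq
    linarith
  have hqα : (q : ℝ)⁻¹ < α := inv_lt_of_inv_lt₀ hα0 (by rwa [one_div] at hq)
  have hdim : Tendsto K.dim atTop atTop := by
    have h1 : Tendsto (fun m : ℕ => (K.dim m : ℝ)) atTop atTop :=
      tendsto_atTop_mono' _ (rpow_le_dim hb (show (1 / 2 : ℝ) < 1 by norm_num))
        ((tendsto_rpow_atTop (by norm_num)).comp tendsto_natCast_atTop_atTop)
    exact tendsto_natCast_atTop_iff.1 h1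
  obtain ⟨ρ, hρ0, hρ1, a, hth⟩ := exists_threshold K hrate (hdim.eventually_ge_atTop 2)
  obtain ⟨m₁, hm₁⟩ := eventually_atTop.1 hb
  obtain ⟨m₀, ⟨hm₀, hth⟩, hm₁'⟩ := (hth.and (eventually_ge_atTop m₁)).exists
  have hs : PF fun n => Nat.log 2 n ^ q + m₀ := by fun_prop
  have hpow := subexp_pow_le hb hq0 hα0 hqα
  have hpow' : ∀ e : ℕ, ∀ᶠ m : ℕ in atTop,
      (subexp q m : ℝ) ^ e ≤ (2 : ℝ) ^ ((K.dim m : ℝ) ^ α) := by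
    intro e
    filter_upwards [hpow e] with m hm
    exact (pow_le_pow_left₀ (by positivity) (by linarith) e).trans hm
  -- The threshold contributes `log ^ q`, the levels `log ^ (a + b + 1)`; one more factor `log n`
  -- swallows all constants.
  refine ⟨trapdooredOfCodes K _ hs, ?_, q + a + b + 2, ?_⟩
  · refine trapdooredOfCodes_indistinguishable σ hs (compOn_subexp q)
      (fun m => Nat.le_add_right _ _) (fun n m hm => le_subexp hq0 (by omega)) ?_
      (fun n m hm => (hth m (by omega)).2.2.1) ?_ fun e => ?_
    · refine tendsto_atTop.2 fun y => ?_
      filter_upwards [eventually_ge_atTop (2 ^ y)] with n hn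
      have h1 : y ≤ Nat.log 2 n := Nat.le_log_of_pow_le one_lt_two hn
      exact (h1.trans (Nat.le_self_pow hq0 _)).trans (Nat.le_add_right _ _)
    · intro A out c hA e
      filter_upwards [hsec A out (hA.mono (hpow c)), hpow' e] with m h1 h2
      refine (mul_le_mul h1 h2 (by positivity) (by positivity)).trans (le_of_eq ?_)
      rw [← Real.rpow_add two_pos, neg_add_cancel, Real.rpow_zero]
    -- Because `α < 1`, eventually `1 + 2 k ^ α ≤ k`, hence `k ^ α ≤ k / 2` also after rounding
    -- down.
    · have h := tendsto_natCast_atTop_atTop.eventually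
        (eventually_add_mul_log_le one_pos one_pos hα1 1 2 0 0 0 0)
      filter_upwards [hpow' e, hdim.eventually h] with m h1 h2
      refine h1.trans ?_
      rw [← Real.rpow_natCast]
      refine Real.rpow_le_rpow_of_exponent_le one_le_two ?_
      rw [Real.rpow_one] at h2
      have h3 : (K.dim m : ℝ) ≤ 2 * (K.dim m / 2 : ℕ) + 1 := by
        exact_mod_cast (by omega : K.dim m ≤ 2 * (K.dim m / 2) + 1)
      linarith
  · have hlog : Tendsto (fun n : ℕ => Real.log n) atTop atTop :=
      Real.tendsto_log_atTop.comp tendsto_natCast_atTop_atTop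
    filter_upwards [hlog.eventually_ge_atTop 1,
      hlog.eventually_ge_atTop (3 + 6 * m₀ + 6 * 2 ^ q + 24 / -Real.log ρ),
      eventually_ge_atTop 1] with n hn1 hn2 h1 MC hMC
    have hn0 : (0 : ℝ) < n := by exact_mod_cast h1
    have hc : 0 < -Real.log ρ := by have := Real.log_neg hρ0 hρ1; linarith
    have h2 := trapdooredOfCodes_size_le hs (Q := Real.log n ^ b) (a := a) hρ0 hρ1
      (n := n) (by omega) h1 (fun m hm => (hth m (by omega)).1) (fun m hm => (hth m (by omega)).2.1)
      (fun m hm => (hth m (by omega)).2.2.2) (by positivity) (fun m hm hmn => by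
        refine (hm₁ m (by omega)).trans ?_
        have hm0 : (0 : ℝ) < m := by exact_mod_cast (by omega : 0 < m)
        gcongr) hMC
    refine h2.trans ?_
    gcongr
    set x := Real.log n
    have h3 : ((Nat.log 2 n : ℕ) : ℝ) ≤ 2 * x := by
      have h4 : (2 : ℝ) ^ Nat.log 2 n ≤ n := by exact_mod_cast Nat.pow_log_le_self 2 (by omega)
      have h5 := Real.log_le_log (by positivity) h4
      rw [Real.log_pow] at h5
      have := Real.log_two_gt_d9
      have h6 : (0 : ℝ) ≤ Nat.log 2 n := Nat.cast_nonneg _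
      have h7 : Real.log n = x := rfl
      nlinarith
    have h4 : ((Nat.log 2 n : ℕ) : ℝ) ^ q ≤ 2 ^ q * x ^ q := by
      rw [← mul_pow]; gcongr
    have hX : ∀ t ≤ q + a + b + 1, x ^ t ≤ x ^ (q + a + b + 1) := fun t ht =>
      pow_le_pow_right₀ hn1 ht
    have h5 := hX 0 (by omega)
    have h6 := hX q (by omega)
    have h7 := hX (b + (a + 1)) (by omega)
    rw [pow_zero] at h5
    rw [← pow_add]
    rw [show q + a + b + 2 = (q + a + b + 1) + 1 by ring, pow_succ' x (q + a + b + 1)]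
    refine le_trans ?_ (mul_le_mul_of_nonneg_right hn2 (by positivity))
    set Y := x ^ (q + a + b + 1)
    have h8 : 24 / -Real.log ρ * x ^ (b + (a + 1)) ≤ 24 / -Real.log ρ * Y := by gcongr
    have h9 : (2 : ℝ) ^ q * x ^ q ≤ 2 ^ q * Y := by gcongr
    have h10 : (m₀ : ℝ) * 1 ≤ m₀ * Y := by gcongr
    push_cast
    linarith

end Subexponential
end Trapdoor

theorem mainTheorem3 {F : Type*} [Field F] [Finite F] (σ : Trapdoor.Scrambler) :
    (∀ ε δ : ℝ, 0 ≤ δ → δ < ε → δ < 1 →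
      ∀ K : Trapdoor.CodeFamily F, K.RateBelowOne →
        (∃ B : ℝ, ∀ᶠ n : ℕ in Filter.atTop, (n : ℝ) ≤ B * K.dim n * (n : ℝ) ^ δ) →
        K.PolyMcEliece σ →
        ∃ D : Trapdoor.TrapdooredFamily F (fun n => n) (fun n => n),
          D.Indistinguishable ∧ D.Efficient fun n => (n : ℝ) ^ (1 + ε)) ∧
    (∀ K : Trapdoor.CodeFamily F, K.RateBelowOne →
        (∃ b : ℕ, ∀ᶠ n : ℕ in Filter.atTop, (n : ℝ) ≤ K.dim n * Real.log n ^ b) →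
        K.SubexpMcEliece σ →
        ∃ D : Trapdoor.TrapdooredFamily F (fun n => n) (fun n => n),
          D.Indistinguishable ∧ ∃ a : ℕ, D.Efficient fun n => (n : ℝ) * Real.log n ^ a) :=
  ⟨fun _ _ hδ0 hδε hδ1 K hrate hB hK =>
    Trapdoor.exists_trapdooredFamily_of_polyMcEliece σ hδ0 hδε hδ1 K hrate hB hK,
  fun K hrate hb hK => Trapdoor.exists_trapdooredFamily_of_subexpMcEliece σ K hrate hb hK⟩
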